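/- For an undirected graph $G=(V,E)$ on $n$ vertices and integers $k\ge 1$, $r,s\ge 0$, consider the following randomized algorithm Hamiltonian$(G,k,r,s)$. A simple path of length $k$ is a path with $k$ edges and $k+1$ distinct vertices. For every $v_0\in V$, repeat $T=\Big\lfloor 2^{k+1}/\big(\binom{r}{k-r-s+1}\binom{k-r}{s}\big)\Big\rfloor$ times: 1. Choose a uniformly random partition $V=V_1\cup V_2$ with $v_0\in V_1$. Let $E_2$ be the set of edges with both ends in $V_2$. 2. Call a walk $v_0,v_1,\dots,v_k$ in $G$ (repetitions allowed) $(r,s)$-legitimate if exactly $r$ of the indices $0\le i\le k$ have $v_i\in V_1$, exactly $s$ of the indices $0\le i<k$ have $\{v_i,v_{i+1}\}\in E_2$, and there is no $i$ with $v_{i+2}=v_i\in V_2$ and $v_{i+1}\in V_1$. Build by dynamic programming (over the length, the two counts and the last two vertices) an arithmetic circuit for the polynomial $f(x,y,z)=\sum_p \prod_{e\in E(p)}x_e\prod_{v\in V(p)\cap V_1}y_v\prod_{e\in E(p)\cap E_2}z_e$, where $p$ ranges over the $(r,s)$-legitimate walks of length $k$ starting at $v_0$, and $V(p)$ and $E(p)$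 are multisets. 3. Test whether $\phi f=\sum_{S\subseteq[s]}\sum_{R\subseteq[r]} f\big(x,\sum_{i\in R}y^{(i)},\sum_{j\in S}z^{(j)}\big)\not\equiv 0$ by evaluating $\phi f$ at one uniformly random point over the field $\mathbb F_{2^m}$, where $m$ is the least integer with $2^m>4(2k+1)$. If the value is nonzero, answer YES and halt. If the algorithm has not halted after all $v_0\in V$ and all repetitions, it answers NO. Call $(k,r,s)$ admissible if $\binom{r}{k-r-s+1}\neq0$ and $\binom{k-r}{s}\ne 0$ (with $\binom{a}{b}=0$ for $b<0$ and $\binom{-1}{0}=1$); these are the parameters for which $T$ is defined. (If $(k,r,s)$ is not admissible, the loop is run with some fixed finite number of repetitions, possibly zero.) Then: (i) There are constants $C,c$ such that for every $G$ and every admissible $(k,r,s)$ with $1\le k\le n$, every execution of Hamiltonian$(G,k,r,s)$ takes at most $$C\cdot\frac{2^{r+s+k}\,n^{c}}{\binom{r}{k-r-s+1}\binom{k-r}{s}}$$ steps (bit operations of a randomized random access machine that accesses $G$ through its adjacency matrix). (ii) If $(k,r,s)$ is admissible with $k\geq 1$ and $G$ contains a simple path of length $k$, then the answer is YES with probability at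 least $1/2$. (iii) If $k\ge1$ and $G$ contains no simple path of length $k$, then the answer is NO with probability $1$. (iv) Running the algorithm with $r=\lfloor 0.5k\rfloor$ and $s=\lfloor0.208k\rfloor$ solves the undirected $k$-path problem in time $O^*(1.657^k)$. More precisely, consider the algorithm that answers NO if $k\ge n$, and otherwise runs Hamiltonian$(G,k,r,s)$ with these $r,s$ if $k\ge 10$ and with $r=k+1$, $s=0$ if $k<10$. For all $k\geq 1$ and all $G$ it takes at most $C'(n+1)^{c'}\,1.657^k$ steps in every execution, for constants $C',c'$. It answers YES with probability at least $1/2$ if $G$ contains a simple path of length $k$, and NO with probability $1$ otherwise. -/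

import Mathlib

namespace KPath

/-! ## Machine model

A randomized program is a tree of elementary instructions.  The input graph (vertex set `Fin n`) can
only be inspected by the instruction `adj`, random bits are only obtained by `coin` and `rand`, and
all arithmetic on integers and on elements of the field `F` is done by instructions.  Operands are
fetched from memory, and the result is stored, as part of an instruction.  What the programs below do
between two instructions is only to branch on a bit or on a loop index and to form addresses. -/

inductive ArithOp
  | add | sub | mul | div | lt

def ArithOp.eval : ArithOp → ℕ → ℕ → ℕ
  | .add, a, b => a + b
  | .sub, a, b => a - b
  | .mul, a, b => a * b
  | .div, a, b => a / b
  | .lt, a, b => if a < b then 1 else 0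

/-- The elementary instructions, indexed by the type of the value that they produce. -/
inductive Instr (n : ℕ) (F : Type) : Type → Type
  /-- bookkeeping of control flow: one loop iteration, one memory write, one emitted gate -/
  | tick : Instr n F Unit
  /-- set up the arithmetic of the field -/
  | setup : Instr n F Unit
  /-- toss a fair coin -/
  | coin : Instr n F Bool
  /-- draw a uniformly random field element -/
  | rand : Instr n F F
  /-- look up an entry of the adjacency matrix -/
  | adj (u v : Fin n) : Instr n F Bool
  /-- integer arithmetic -/
  | arith (op : ArithOp) (a b : ℕ) : Instr n F ℕ
  /-- field arithmetic -/
  | fadd (a b : F) : Instr n F F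
  | fmul (a b : F) : Instr n F F
  | fzero (a : F) : Instr n F Bool

/-- Cost of an instruction in bit operations, when a field element is stored in `m` bits (as a
polynomial over the two-element field modulo an irreducible one of degree `m`).
Integer and field arithmetic is charged at schoolbook rates.  `setup` is charged for finding an
irreducible polynomial of degree `m` by trial division of each of the `2 ^ m` candidates by each of
at most `2 ^ m` polynomials of smaller degree. -/
def Instr.cost {n : ℕ} {F β : Type} (m : ℕ) : Instr n F β → ℕ
  | .tick => 1
  | .setup => 4 ^ m * (m + 1) ^ 2
  | .coin => 1
  | .rand => m + 1
  | .adj _ _ => 1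
  | .arith _ a b => (Nat.size a + 1) * (Nat.size b + 1)
  | .fadd _ _ => m + 1
  | .fmul _ _ => (m + 1) ^ 2
  | .fzero _ => m + 1

/-- Randomized programs that return a value of type `α`. -/
inductive Prog (n : ℕ) (F : Type) (α : Type) : Type 1
  | ret (a : α) : Prog n F α
  | step {β : Type} (i : Instr n F β) (k : β → Prog n F α) : Prog n F α

namespace Prog

variable {n : ℕ} {F α β ι σ : Type}

def bind (p : Prog n F α) (f : α → Prog n F β) : Prog n F β :=
  match p with
  | .ret a => f a
  | .step i k => .step i fun b => (k b).bind f

instance instMonad : Monad (Prog n F) where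
  pure := Prog.ret
  bind := Prog.bind

/-- The program that consists of a single instruction. -/
def exec (i : Instr n F β) : Prog n F β := .step i .ret

/-- `for i in l do a ← f a i`, then return `a`. -/
def fold (l : List ι) (a : σ) (f : σ → ι → Prog n F σ) : Prog n F σ :=
  match l with
  | [] => pure a
  | i :: l => do
      exec .tick
      let a' ← f a i
      fold l a' f

/-- Concatenate the lists produced by `f i`, for `i` in `l`. -/
def collect (l : List ι) (f : ι → Prog n F (List β)) : Prog n F (List β) :=
  match l with
  | [] => pure []
  | i :: l => do
      exec .tick
      let b ← f i
      let bs ← collect l f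
      pure (b ++ bs)

/-- Fill an array: the entry at `i` is produced by `f i`, for `i` in `l`; other entries are `d`. -/
def tabulate [DecidableEq ι] (d : β) (l : List ι) (f : ι → Prog n F β) : Prog n F (ι → β) :=
  match l with
  | [] => pure fun _ => d
  | i :: l => do
      exec .tick
      let b ← f i
      let t ← tabulate d l f
      pure (Function.update t i b)

/-- `for i in l do (if f i then answer YES and halt)`; afterwards answer NO. -/
def anyOf (l : List ι) (f : ι → Prog n F Bool) : Prog n F Bool :=
  match l with
  | [] => pure false
  | i :: l => do
      exec .tick
      let b ← f i
      if b then pure true else anyOf l f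

end Prog

/-- The (random) effect of an instruction, for the input graph `G` and the field with `2 ^ m`
elements. -/
noncomputable def Instr.sem {n m : ℕ} (G : SimpleGraph (Fin n)) {β : Type} :
    Instr n (GaloisField 2 m) β → PMF β
  | .tick => PMF.pure ()
  | .setup => PMF.pure ()
  | .coin => PMF.uniformOfFintype Bool
  | .rand => letI := Fintype.ofFinite (GaloisField 2 m); PMF.uniformOfFintype (GaloisField 2 m)
  | .adj u v => open Classical in PMF.pure (decide (G.Adj u v))
  | .arith op a b => PMF.pure (op.eval a b)
  | .fadd a b => PMF.pure (a + b)
  | .fmul a b => PMF.pure (a * b)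
  | .fzero a => open Classical in PMF.pure (decide (a = 0))

/-- Joint distribution of the returned value and of the running time (the total cost of the executed
instructions) of a program on the input graph `G`. -/
noncomputable def Prog.run {n m : ℕ} (G : SimpleGraph (Fin n)) {α : Type} :
    Prog n (GaloisField 2 m) α → PMF (α × ℕ)
  | .ret a => PMF.pure (a, 0)
  | .step i k => (i.sem G).bind fun b => ((k b).run G).map fun o => (o.1, i.cost m + o.2)

/-! ## Arithmetic circuits -/

/-- The variables `x_e`, `y_v`, `z_e`.  (Only those `x_e` with `e` an edge, those `y_v` with `v ∈ V₁`
and those `z_e` with `e` an edge inside `V₂` will occur in a circuit.) -/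
inductive Var (n : ℕ)
  | x (e : Sym2 (Fin n))
  | y (v : Fin n)
  | z (e : Sym2 (Fin n))

/-- Names of the gates: `path j r s u₁ u₂` holds the polynomial of the `(r,s)`-legitimate `j`-paths
from `v₀` whose last two vertices are `u₁, u₂`; `out` is the output. -/
inductive Node (n : ℕ)
  | path (j r s : ℕ) (u₁ u₂ : Fin n)
  | out
  deriving DecidableEq

inductive Wire (n : ℕ)
  | zero
  | input (v : Var n)
  | node (ν : Node n)

inductive GateOp
  | add | mul

/-- The assignment `dst := lhs op rhs`. -/
structure Gate (n : ℕ) where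
  dst : Node n
  op : GateOp
  lhs : Wire n
  rhs : Wire n

/-- Arithmetic circuits, as straight-line programs. -/
abbrev Circuit (n : ℕ) := List (Gate n)

section Algorithm

open Prog

variable {n : ℕ} {F : Type}

def Wire.val [Zero F] (ρ : Var n → F) (t : Node n → F) : Wire n → F
  | .zero => 0
  | .input v => ρ v
  | .node ν => t ν

/-- Compute the value of one gate, from the values `ρ` of the inputs and `t` of the other gates. -/
def Gate.compute [Zero F] (ρ : Var n → F) (t : Node n → F) (g : Gate n) : Prog n F F :=
  match g.op with
  | .add => exec (.fadd (g.lhs.val ρ t) (g.rhs.val ρ t))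
  | .mul => exec (.fmul (g.lhs.val ρ t) (g.rhs.val ρ t))

/-- Evaluate a circuit at the assignment `ρ`, gate by gate. -/
def evalCircuit [Zero F] (C : Circuit n) (ρ : Var n → F) : Prog n F F := do
  let t ← fold C (fun _ : Node n => (0 : F)) fun t g => do
    let a ← g.compute ρ t
    pure (Function.update t g.dst a)
  pure (t .out)

def emit (g : Gate n) : Prog n F (List (Gate n)) := do
  exec .tick
  pure [g]

/-- `ν := 0` -/
def clear (ν : Node n) : Prog n F (List (Gate n)) := emit ⟨ν, .add, .zero, .zero⟩

/-- `ν := ν + μ` -/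
def addNode (ν μ : Node n) : Prog n F (List (Gate n)) := emit ⟨ν, .add, .node ν, .node μ⟩

/-- `ν := ν * v` -/
def mulVar (ν : Node n) (v : Var n) : Prog n F (List (Gate n)) := emit ⟨ν, .mul, .node ν, .input v⟩

/-- `ν := ∑ path j r s w u`, over the neighbours `w` of `u` with `ok w`. -/
def sumGates (ν : Node n) (j r s : ℕ) (u : Fin n) (ok : Fin n → Bool) :
    Prog n F (List (Gate n)) := do
  let g₀ ← clear ν
  let g₁ ← collect (List.finRange n) fun w => do
    let e ← exec (.adj u w)
    if e && ok w then addNode ν (.path j r s w u) else pure []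
  pure (g₀ ++ g₁)

/-- The gates that compute `path j r s u₁ u₂` from the gates `path (j - 1) r' s' w u₁`;
here `V₁ v = true` says that `v` lies in the first part of the partition. -/
def pathGates (v₀ : Fin n) (V₁ : Fin n → Bool) (j r s : ℕ) (u₁ u₂ : Fin n) :
    Prog n F (List (Gate n)) := do
  let ν : Node n := .path j r s u₁ u₂
  let e ← exec (.adj u₁ u₂)
  if e then
    if j = 1 then
      if u₁ = v₀ ∧ V₁ u₂ = false ∧ r = 1 ∧ s = 0 then
        emit ⟨ν, .mul, .input (.x s(v₀, u₂)), .input (.y v₀)⟩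
      else if u₁ = v₀ ∧ V₁ u₂ = true ∧ r = 2 ∧ s = 0 then do
        let g₀ ← emit ⟨ν, .mul, .input (.x s(v₀, u₂)), .input (.y v₀)⟩
        let g₁ ← mulVar ν (.y u₂)
        pure (g₀ ++ g₁)
      else clear ν
    else if V₁ u₂ then
      match r with
      | 0 => clear ν
      | r' + 1 => do
        let g₀ ← sumGates ν (j - 1) r' s u₁ fun _ => true
        let g₁ ← mulVar ν (.x s(u₁, u₂))
        let g₂ ← mulVar ν (.y u₂)
        pure (g₀ ++ g₁ ++ g₂)
    else if V₁ u₁ then do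
      let g₀ ← sumGates ν (j - 1) r s u₁ fun w => decide (w ≠ u₂)
      let g₁ ← mulVar ν (.x s(u₁, u₂))
      pure (g₀ ++ g₁)
    else
      match s with
      | 0 => clear ν
      | s' + 1 => do
        let g₀ ← sumGates ν (j - 1) r s' u₁ fun _ => true
        let g₁ ← mulVar ν (.x s(u₁, u₂))
        let g₂ ← mulVar ν (.z s(u₁, u₂))
        pure (g₀ ++ g₁ ++ g₂)
  else clear ν

/-- Build, by dynamic programming, the circuit for the sum of the monomials
`∏_{e ∈ E(p)} x_e · ∏_{v ∈ V(p) ∩ V₁} y_v · ∏_{e ∈ E(p) ∩ E₂} z_e` over all `(r,s)`-legitimate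
`k`-paths `p` that start from `v₀`. -/
def buildCircuit (k r s : ℕ) (v₀ : Fin n) (V₁ : Fin n → Bool) : Prog n F (Circuit n) := do
  let g₀ ← collect (List.range' 1 k) fun j =>
    collect (List.range (r + 1)) fun r' =>
      collect (List.range (s + 1)) fun s' =>
        collect (List.finRange n) fun u₁ =>
          collect (List.finRange n) fun u₂ => pathGates v₀ V₁ j r' s' u₁ u₂
  let g₁ ← clear .out
  let g₂ ← collect (List.finRange n) fun u₁ =>
    collect (List.finRange n) fun u₂ => addNode .out (.path k r s u₁ u₂)
  pure (g₀ ++ g₁ ++ g₂)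

/-! ## The algorithm -/

/-- The array of the sums `∑_{i ∈ R} Y i a`, for `a` in `l`. -/
def sumArray [Zero F] {ι : Type} [DecidableEq ι] {q : ℕ} (l : List ι) (Y : Fin q → ι → F)
    (R : List (Fin q)) : Prog n F (ι → F) :=
  tabulate 0 l fun a => fold R 0 fun c i => exec (.fadd c (Y i a))

def assign (x : Sym2 (Fin n) → F) (y : Fin n → F) (z : Sym2 (Fin n) → F) : Var n → F
  | .x e => x e
  | .y v => y v
  | .z e => z e

/-- All unordered pairs of vertices. -/
def pairs (n : ℕ) : List (Sym2 (Fin n)) := (List.finRange n).sym2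

/-- Schwartz-Zippel test of
`∑_{S ⊆ [s]} ∑_{R ⊆ [r]} f (x, ∑_{i ∈ R} y⁽ⁱ⁾, ∑_{j ∈ S} z⁽ʲ⁾) ≢ 0`, for the polynomial `f` of the
circuit `C`: evaluate at a uniformly random point and compare with zero. -/
def phiTest [Zero F] (r s : ℕ) (C : Circuit n) : Prog n F Bool := do
  let x ← tabulate 0 (pairs n) fun _ => exec .rand
  let Y ← tabulate (fun _ => 0) (List.finRange r) fun _ =>
    tabulate 0 (List.finRange n) fun _ => exec .rand
  let Z ← tabulate (fun _ => 0) (List.finRange s) fun _ =>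
    tabulate 0 (pairs n) fun _ => exec .rand
  let total ← fold (List.finRange s).sublists 0 fun acc S => do
    let z ← sumArray (pairs n) Z S
    fold (List.finRange r).sublists acc fun acc R => do
      let y ← sumArray (List.finRange n) Y R
      let a ← evalCircuit C (assign x y z)
      exec (.fadd acc a)
  let isZero ← exec (.fzero total)
  pure (!isZero)

/-- One round: random partition with `v₀ ∈ V₁`, circuit, test. -/
def trial [Zero F] (k r s : ℕ) (v₀ : Fin n) : Prog n F Bool := do
  let V₁ ← tabulate true (List.finRange n) fun v => if v = v₀ then pure true else exec .coin
  let C ← buildCircuit k r s v₀ V₁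
  phiTest r s C

def powTwo (e : ℕ) : Prog n F ℕ := fold (List.range e) 1 fun a _ => exec (.arith .mul 2 a)

/-- The binomial coefficient `a choose b`. -/
def binomial (a b : ℕ) : Prog n F ℕ :=
  fold (List.range b) 1 fun c i => do
    let d ← exec (.arith .sub a i)
    let p ← exec (.arith .mul c d)
    let i' ← exec (.arith .add i 1)
    exec (.arith .div p i')

/-- The number of rounds for each start vertex, the integer part of
`2 ^ (k + 1) / ((r choose k - r - s + 1) * (k - r choose s))`. -/
def rounds (k r s : ℕ) : Prog n F ℕ := do
  let k' ← exec (.arith .add k 1)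
  let p ← powTwo k'
  let d ← exec (.arith .sub k' r)
  let t ← exec (.arith .sub d s)
  let b₁ ← binomial r t
  let d' ← exec (.arith .sub k r)
  let b₂ ← binomial d' s
  let b ← exec (.arith .mul b₁ b₂)
  exec (.arith .div p b)

/-- The algorithm `Hamiltonian(G, k, r, s)`; `true` is the answer YES. -/
def hamiltonian [Zero F] (n k r s : ℕ) : Prog n F Bool := do
  exec .setup
  let T ← rounds k r s
  anyOf (List.finRange n) fun v₀ =>
    anyOf (List.range T) fun _ => trial k r s v₀

/-- The algorithm for the undirected `k`-path problem: answer NO if there are not more than `k`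
vertices; otherwise run `Hamiltonian(G, k, r, s)` with `r = ⌊0.5 k⌋` and `s = ⌊0.208 k⌋`
(with `r = k + 1` and `s = 0` for the finitely many `k < 10`, where the binomial coefficients of the
former choice may vanish). -/
def kPath [Zero F] (n k : ℕ) : Prog n F Bool := do
  let b ← exec (.arith .lt k n)
  if b = 0 then pure false
  else if k < 10 then hamiltonian n k (k + 1) 0
  else hamiltonian n k (k / 2) (208 * k / 1000)

end Algorithm

/-- Bit length of the field elements used for paths of length `k`: the field has more than
`4 * (2 * k + 1)` elements. -/
def fieldBits (k : ℕ) : ℕ := Nat.size (4 * (2 * k + 1))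

/-- Distribution of answer and running time of `Hamiltonian(G, k, r, s)`. -/
noncomputable def runHamiltonian {n : ℕ} (G : SimpleGraph (Fin n)) (k r s : ℕ) : PMF (Bool × ℕ) :=
  Prog.run (m := fieldBits k) G (hamiltonian n k r s)

/-- Distribution of answer and running time of the `k`-path algorithm. -/
noncomputable def runKPath {n : ℕ} (G : SimpleGraph (Fin n)) (k : ℕ) : PMF (Bool × ℕ) :=
  Prog.run (m := fieldBits k) G (kPath n k)

/-- `G` contains a simple path with `k` edges. -/
def HasSimplePath {n : ℕ} (G : SimpleGraph (Fin n)) (k : ℕ) : Prop :=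
  ∃ (u v : Fin n) (p : G.Walk u v), p.IsPath ∧ p.length = k

/-- The parameters for which the number of rounds is defined: the binomial coefficients
`r choose k - r - s + 1` and `k - r choose s` are nonzero.  (The first one vanishes when
`k - r - s + 1` is negative; for `r = k + 1`, `s = 0` the second one is `-1 choose 0 = 1`.) -/
def Admissible (k r s : ℕ) : Prop :=
  r + s ≤ k + 1 ∧ r.choose (k + 1 - r - s) ≠ 0 ∧ (k - r).choose s ≠ 0

/-- Every possible execution takes time at most `B`. -/
def RunsInTime {α : Type} (D : PMF (α × ℕ)) (B : ℝ) : Prop :=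
  ∀ o ∈ D.support, (o.2 : ℝ) ≤ B

/-- The probability that the answer is `b`. -/
noncomputable def answerProb (D : PMF (Bool × ℕ)) (b : Bool) : ENNReal :=
  (D.map Prod.fst) b

end KPath

namespace KPath

/-!
Fix a partition `V = V₁ ∪ V₂`. In characteristic two, summing `f` over all subsets of the auxiliary
variables annihilates the walks which repeat a vertex of `V₁` or an edge of `E₂`. A surviving walk
that is not simple contains a closed segment; reversing the segment between the first and the last
visit of its first repeated vertex is an involution without fixed points that preserves the monomial
of the edges, so these walks cancel in pairs. Hence `φ f` is the zero polynomial if there is no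
simple path, and a simple path that is `(r, s)`-legitimate contributes to a nonzero coefficient,
because it is determined by its edges and its start. In that case the Schwartz–Zippel lemma bounds
the failure probability of one evaluation.

A given simple path is `(r, s)`-legitimate for at least `C(r, k - r - s + 1) C(k - r, s)` of the
`2 ^ k` patterns in which a partition can split its vertices other than `v₀`, which is why about
`2 ^ k / (C(r, k - r - s + 1) C(k - r, s))` rounds suffice. For `r = ⌊0.5 k⌋` and `s = ⌊0.208 k⌋`
both coefficients are about `C(0.5 k, 0.208 k)`, and the entropy bound for binomial coefficients
turns the running time into `1.657 ^ k`.
-/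

/-! ## Correctness and running time of programs -/

namespace Prog

variable {n m : ℕ} {G : SimpleGraph (Fin n)} {α β ι σ : Type} {p : Prog n (GaloisField 2 m) α}
  {f : α → Prog n (GaloisField 2 m) β}

theorem run_pure (a : α) : (pure a : Prog n (GaloisField 2 m) α).run G = PMF.pure (a, 0) := rfl

theorem run_bind (p : Prog n (GaloisField 2 m) α) (f : α → Prog n (GaloisField 2 m) β) :
    (p >>= f).run G =
      (p.run G).bind fun o => ((f o.1).run G).map fun o' => (o'.1, o.2 + o'.2) := by
  change (p.bind f).run G = _
  induction p with
  | ret a =>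
    simp only [Prog.bind, run, PMF.pure_bind, zero_add]
    exact (PMF.map_id _).symm
  | step i k ih =>
    simp only [Prog.bind, run, ih, PMF.bind_bind, PMF.map_bind, PMF.bind_map, PMF.map_comp,
      Function.comp_def, add_assoc]

theorem run_exec (i : Instr n (GaloisField 2 m) β) :
    (exec i).run G = (i.sem G).map fun b => (b, i.cost m) := by
  simp only [exec, run, PMF.pure_map, add_zero]
  exact PMF.bind_pure_comp _ _

/-- The distribution of the result of `p`, irrespective of its running time. -/
noncomputable def dist (G : SimpleGraph (Fin n)) (p : Prog n (GaloisField 2 m) α) : PMF α :=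
  (p.run G).map Prod.fst

/-- Partial correctness: every possible result of `p` on the input graph `G` satisfies the
postcondition `Q`. -/
def Ensures (G : SimpleGraph (Fin n)) (p : Prog n (GaloisField 2 m) α) (Q : α → Prop) : Prop :=
  ∀ a ∈ (p.dist G).support, Q a

/-- Worst-case running time: every possible execution of `p` on the input graph `G` takes at most
`B` steps. -/
def TimeLe (G : SimpleGraph (Fin n)) (p : Prog n (GaloisField 2 m) α) (B : ℕ) : Prop :=
  ∀ o ∈ (p.run G).support, o.2 ≤ B

/-! ### Distribution of the result -/

theorem dist_pure (a : α) : (pure a : Prog n (GaloisField 2 m) α).dist G = PMF.pure a := by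
  rw [dist, run_pure, PMF.pure_map]

theorem dist_bind (p : Prog n (GaloisField 2 m) α) (f : α → Prog n (GaloisField 2 m) β) :
    (p >>= f).dist G = (p.dist G).bind fun a => (f a).dist G := by
  simp only [dist, run_bind, PMF.map_bind, PMF.bind_map, PMF.map_comp, Function.comp_def]

theorem dist_exec (i : Instr n (GaloisField 2 m) β) : (exec i).dist G = i.sem G := by
  rw [dist, run_exec, PMF.map_comp]
  exact PMF.map_id _

theorem dist_tick_bind (f : Unit → Prog n (GaloisField 2 m) β) :
    (exec (.tick : Instr n (GaloisField 2 m) Unit) >>= f).dist G = (f ()).dist G := by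
  rw [dist_bind, dist_exec]
  exact PMF.pure_bind _ _

theorem le_dist_bind {Q : α → Prop} (hp : p.Ensures G Q) {b : β} {c : ENNReal}
    (h : ∀ a, Q a → c ≤ (f a).dist G b) : c ≤ (p >>= f).dist G b := by
  rw [dist_bind, PMF.bind_apply]
  calc c = ∑' a, p.dist G a * c := by rw [ENNReal.tsum_mul_right, PMF.tsum_coe, one_mul]
    _ ≤ ∑' a, p.dist G a * (f a).dist G b := ENNReal.tsum_le_tsum fun a => by
        by_cases ha : a ∈ (p.dist G).support
        · exact mul_le_mul_right (h a (hp a ha)) _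
        · rw [(PMF.apply_eq_zero_iff _ _).2 ha, zero_mul, zero_mul]

/-! ### Postconditions -/

theorem ensures_true (p : Prog n (GaloisField 2 m) α) : p.Ensures G fun _ => True :=
  fun _ _ => trivial

theorem ensures_forall {κ : Sort*} {Q : κ → α → Prop} :
    p.Ensures G (fun a => ∀ i, Q i a) ↔ ∀ i, p.Ensures G (Q i) :=
  ⟨fun h i a ha => h a ha i, fun h a ha i => h i a ha⟩

theorem Ensures.mono {Q Q' : α → Prop} (h : p.Ensures G Q) (hQ : ∀ a, Q a → Q' a) :
    p.Ensures G Q' :=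
  fun a ha => hQ a (h a ha)

theorem ensures_pure {a : α} {Q : α → Prop} (h : Q a) :
    (pure a : Prog n (GaloisField 2 m) α).Ensures G Q := by
  simpa [Ensures, dist_pure] using h

theorem Ensures.bind {Q : α → Prop} {Q' : β → Prop} (hp : p.Ensures G Q)
    (hf : ∀ a, Q a → (f a).Ensures G Q') : (p >>= f).Ensures G Q' := by
  intro b hb
  rw [dist_bind] at hb
  obtain ⟨a, ha, hb⟩ := (PMF.mem_support_bind_iff _ _ _).1 hb
  exact hf a (hp a ha) b hb

theorem Ensures.dist_eq_pure {a : α} (h : p.Ensures G fun b => b = a) :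
    p.dist G = PMF.pure a := by
  have hs : (p.dist G).support = {a} := (p.dist G).support_nonempty.subset_singleton_iff.1 h
  ext b
  by_cases hb : b = a
  · rw [hb, PMF.pure_apply_self, (PMF.apply_eq_one_iff _ _).2 hs]
  · rw [PMF.pure_apply_of_ne _ _ hb, PMF.apply_eq_zero_iff, hs]
    exact hb

theorem ensures_exec_of_sem_eq_pure {i : Instr n (GaloisField 2 m) β} {b : β}
    (h : i.sem G = PMF.pure b) : (exec i).Ensures G fun c => c = b := by
  intro c hc
  simpa [dist_exec, h] using hc

open Classical in
theorem ensures_adj (u v : Fin n) :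
    (exec (.adj u v : Instr n (GaloisField 2 m) Bool)).Ensures G fun b => b = decide (G.Adj u v) :=
  ensures_exec_of_sem_eq_pure rfl

theorem ensures_arith (op : ArithOp) (a b : ℕ) :
    (exec (.arith op a b : Instr n (GaloisField 2 m) ℕ)).Ensures G fun c => c = op.eval a b :=
  ensures_exec_of_sem_eq_pure rfl

theorem ensures_fadd (a b : GaloisField 2 m) :
    (exec (.fadd a b : Instr n (GaloisField 2 m) _)).Ensures G fun c => c = a + b :=
  ensures_exec_of_sem_eq_pure rfl

theorem ensures_fmul (a b : GaloisField 2 m) :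
    (exec (.fmul a b : Instr n (GaloisField 2 m) _)).Ensures G fun c => c = a * b :=
  ensures_exec_of_sem_eq_pure rfl

open Classical in
theorem ensures_fzero (a : GaloisField 2 m) :
    (exec (.fzero a : Instr n (GaloisField 2 m) _)).Ensures G fun b => b = decide (a = 0) :=
  ensures_exec_of_sem_eq_pure rfl

/-! ### Running times -/

theorem TimeLe.mono {B B' : ℕ} (h : p.TimeLe G B) (hB : B ≤ B') : p.TimeLe G B' :=
  fun o ho => (h o ho).trans hB

theorem timeLe_pure (a : α) (B : ℕ) : (pure a : Prog n (GaloisField 2 m) α).TimeLe G B := by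
  simp [TimeLe, run_pure]

theorem TimeLe.bind_of_ensures {Q : α → Prop} {B B' : ℕ} (hp : p.TimeLe G B)
    (hQ : p.Ensures G Q) (hf : ∀ a, Q a → (f a).TimeLe G B') : (p >>= f).TimeLe G (B + B') := by
  intro o ho
  rw [run_bind] at ho
  obtain ⟨o₁, h₁, ho⟩ := (PMF.mem_support_bind_iff _ _ _).1 ho
  obtain ⟨o₂, h₂, rfl⟩ := (PMF.mem_support_map_iff _ _ _).1 ho
  have hQ₁ : Q o₁.1 := hQ o₁.1 ((PMF.mem_support_map_iff _ _ _).2 ⟨o₁, h₁, rfl⟩)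
  exact Nat.add_le_add (hp o₁ h₁) (hf _ hQ₁ o₂ h₂)

theorem TimeLe.bind {B B' : ℕ} (hp : p.TimeLe G B) (hf : ∀ a, (f a).TimeLe G B') :
    (p >>= f).TimeLe G (B + B') :=
  hp.bind_of_ensures (ensures_true p) fun a _ => hf a

theorem timeLe_exec {i : Instr n (GaloisField 2 m) β} {B : ℕ} (h : i.cost m ≤ B) :
    (exec i).TimeLe G B := by
  intro o ho
  rw [run_exec] at ho
  obtain ⟨b, -, rfl⟩ := (PMF.mem_support_map_iff _ _ _).1 ho
  exact h

theorem timeLe_tick : (exec (.tick : Instr n (GaloisField 2 m) Unit)).TimeLe G 1 :=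
  timeLe_exec le_rfl

/-! ### Loops -/

theorem fold_cons (i : ι) (l : List ι) (a : σ) (f : σ → ι → Prog n (GaloisField 2 m) σ) :
    fold (i :: l) a f = exec .tick >>= fun _ => f a i >>= fun a' => fold l a' f := rfl

theorem collect_cons (i : ι) (l : List ι) (f : ι → Prog n (GaloisField 2 m) (List β)) :
    collect (i :: l) f = exec .tick >>= fun _ => f i >>= fun b =>
      collect l f >>= fun bs => pure (b ++ bs) := rfl

theorem tabulate_cons [DecidableEq ι] (d : β) (i : ι) (l : List ι)
    (f : ι → Prog n (GaloisField 2 m) β) :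
    tabulate d (i :: l) f = exec .tick >>= fun _ => f i >>= fun b =>
      tabulate d l f >>= fun t => pure (Function.update t i b) := rfl

theorem anyOf_cons (i : ι) (l : List ι) (f : ι → Prog n (GaloisField 2 m) Bool) :
    anyOf (i :: l) f = exec .tick >>= fun _ => f i >>= fun b =>
      if b then pure true else anyOf l f := rfl

theorem ensures_fold {f : σ → ι → Prog n (GaloisField 2 m) σ} {g : σ → ι → σ}
    {l : List ι} (h : ∀ a, ∀ i ∈ l, (f a i).Ensures G fun b => b = g a i) (a : σ) :
    (fold l a f).Ensures G fun b => b = l.foldl g a := by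
  induction l generalizing a with
  | nil => exact ensures_pure rfl
  | cons i l ih =>
    rw [fold_cons]
    refine (ensures_true _).bind fun _ _ => (h a i List.mem_cons_self).bind ?_
    rintro _ rfl
    exact ih (fun a j hj => h a j (List.mem_cons_of_mem i hj)) _

theorem ensures_tabulate [DecidableEq ι] {d : β} {f : ι → Prog n (GaloisField 2 m) β}
    {Q : ι → β → Prop} (h : ∀ i, (f i).Ensures G (Q i)) (l : List ι) :
    (tabulate d l f).Ensures G fun t => ∀ i ∈ l, Q i (t i) := by
  induction l with
  | nil => exact ensures_pure (by simp)
  | cons i l ih =>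
    rw [tabulate_cons]
    refine (ensures_true _).bind fun _ _ => (h i).bind fun b hb => ih.bind fun t ht =>
      ensures_pure fun j hj => ?_
    obtain rfl | hji := eq_or_ne j i
    · simpa using hb
    · rw [Function.update_of_ne hji]
      exact ht j (List.mem_of_ne_of_mem hji hj)

theorem ensures_anyOf_false {f : ι → Prog n (GaloisField 2 m) Bool}
    (h : ∀ i, (f i).Ensures G fun b => b = false) (l : List ι) :
    (anyOf l f).Ensures G fun b => b = false := by
  induction l with
  | nil => exact ensures_pure rfl
  | cons i l ih =>
    rw [anyOf_cons]
    refine (ensures_true _).bind fun _ _ => (h i).bind ?_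
    rintro _ rfl
    exact ih

theorem ensures_fold_range {f : σ → ℕ → Prog n (GaloisField 2 m) σ} {v : ℕ → σ} {b : ℕ}
    (h : ∀ i < b, (f (v i) i).Ensures G fun a => a = v (i + 1)) :
    (fold (List.range b) (v 0) f).Ensures G fun a => a = v b := by
  suffices hsuffix : ∀ l j, j + l = b →
      (fold (List.range' j l) (v j) f).Ensures G fun a => a = v b by
    rw [List.range_eq_range']
    exact hsuffix b 0 (zero_add b)
  intro l
  induction l with
  | zero => rintro j rfl; exact ensures_pure rfl
  | succ l ih =>
    intro j hj
    rw [List.range'_succ, fold_cons]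
    refine (ensures_true _).bind fun _ _ => (h j (by omega)).bind ?_
    rintro _ rfl
    exact ih (j + 1) (by omega)

theorem timeLe_fold_range {f : σ → ℕ → Prog n (GaloisField 2 m) σ} {v : ℕ → σ} {b B : ℕ}
    (h : ∀ i < b, (f (v i) i).Ensures G fun a => a = v (i + 1))
    (hB : ∀ i < b, (f (v i) i).TimeLe G B) :
    (fold (List.range b) (v 0) f).TimeLe G (b * (B + 1)) := by
  suffices hsuffix : ∀ l j, j + l = b →
      (fold (List.range' j l) (v j) f).TimeLe G (l * (B + 1)) by
    rw [List.range_eq_range']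
    exact hsuffix b 0 (zero_add b)
  intro l
  induction l with
  | zero => exact fun _ _ => timeLe_pure _ _
  | succ l ih =>
    intro j hj
    have htail : ∀ a, a = v (j + 1) →
        (fold (List.range' (j + 1) l) a f).TimeLe G (l * (B + 1)) := by
      rintro _ rfl
      exact ih (j + 1) (by omega)
    rw [List.range'_succ, fold_cons]
    refine (timeLe_tick.bind fun _ =>
      (hB j (by omega)).bind_of_ensures (h j (by omega)) htail).mono ?_
    linarith

theorem timeLe_fold {f : σ → ι → Prog n (GaloisField 2 m) σ} {B : ℕ} {l : List ι}
    (h : ∀ a, ∀ i ∈ l, (f a i).TimeLe G B) (a : σ) :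
    (fold l a f).TimeLe G (l.length * (B + 1)) := by
  induction l generalizing a with
  | nil => exact timeLe_pure _ _
  | cons i l ih =>
    rw [fold_cons]
    refine (timeLe_tick.bind fun _ => (h a i List.mem_cons_self).bind
      (ih fun a j hj => h a j (List.mem_cons_of_mem i hj))).mono ?_
    rw [List.length_cons]
    linarith

theorem timeLe_tabulate [DecidableEq ι] {d : β} {f : ι → Prog n (GaloisField 2 m) β} {B : ℕ}
    (h : ∀ i, (f i).TimeLe G B) (l : List ι) :
    (tabulate d l f).TimeLe G (l.length * (B + 1)) := by
  induction l with
  | nil => exact timeLe_pure _ _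
  | cons i l ih =>
    rw [tabulate_cons]
    refine (timeLe_tick.bind fun _ => (h i).bind fun _ => ih.bind fun _ => timeLe_pure _ 0).mono ?_
    rw [List.length_cons]
    linarith

theorem timeLe_anyOf {f : ι → Prog n (GaloisField 2 m) Bool} {B : ℕ}
    (h : ∀ i, (f i).TimeLe G B) (l : List ι) :
    (anyOf l f).TimeLe G (l.length * (B + 1)) := by
  induction l with
  | nil => exact timeLe_pure _ _
  | cons i l ih =>
    have htail (b : Bool) : (if b then pure true else anyOf l f).TimeLe G (l.length * (B + 1)) := by
      cases b
      · exact ih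
      · exact timeLe_pure _ _
    rw [anyOf_cons]
    refine (timeLe_tick.bind fun _ => (h i).bind htail).mono ?_
    rw [List.length_cons]
    linarith

theorem dist_anyOf_false (f : ι → Prog n (GaloisField 2 m) Bool) (l : List ι) :
    (anyOf l f).dist G false = (l.map fun i => (f i).dist G false).prod := by
  induction l with
  | nil => simp [anyOf, dist_pure]
  | cons i l ih =>
    rw [anyOf_cons, dist_tick_bind, dist_bind, PMF.bind_apply, tsum_bool]
    simp [ih, dist_pure]

theorem ensures_tabulate_of_notMem [DecidableEq ι] (d : β) (f : ι → Prog n (GaloisField 2 m) β)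
    {i : ι} {l : List ι} (hi : i ∉ l) : (tabulate d l f).Ensures G fun t => t i = d := by
  induction l with
  | nil => exact ensures_pure rfl
  | cons j l ih =>
    obtain ⟨hij, hi⟩ : i ≠ j ∧ i ∉ l := by simpa using hi
    rw [tabulate_cons]
    exact (ensures_true _).bind fun _ _ => (ensures_true _).bind fun _ _ => (ih hi).bind
      fun t ht => ensures_pure (by rwa [Function.update_of_ne hij])

theorem dist_tabulate_cons [DecidableEq ι] (d : β) (f : ι → Prog n (GaloisField 2 m) β) {i : ι}
    {l : List ι} (hi : i ∉ l) (g : ι → β) :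
    (tabulate d (i :: l) f).dist G g =
      (f i).dist G (g i) * (tabulate d l f).dist G (Function.update g i d) := by
  classical
  rw [tabulate_cons, dist_tick_bind]
  simp only [dist_bind, PMF.bind_apply, dist_pure, PMF.pure_apply]
  rw [tsum_eq_single (g i)]
  · rw [tsum_eq_single (Function.update g i d)]
    · simp
    · intro t ht
      rw [mul_ite, mul_one, mul_zero, ite_eq_right_iff]
      intro hg
      by_contra h0
      have htd : t i = d := ensures_tabulate_of_notMem d f hi t ((PMF.mem_support_iff _ _).2 h0)
      exact ht (by rw [hg, Function.update_idem, ← htd, Function.update_eq_self])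
  · intro b hb
    refine mul_eq_zero.2 (Or.inr (ENNReal.tsum_eq_zero.2 fun t => ?_))
    rw [if_neg fun hg => hb (by rw [hg, Function.update_self]), mul_zero]

theorem dist_tabulate_nodup [DecidableEq ι] (d : β) (f : ι → Prog n (GaloisField 2 m) β)
    {l : List ι} (hl : l.Nodup) {g : ι → β} (hg : ∀ i, i ∉ l → g i = d) :
    (tabulate d l f).dist G g = (l.map fun i => (f i).dist G (g i)).prod := by
  induction l generalizing g with
  | nil =>
    have : g = fun _ => d := funext fun i => hg i List.not_mem_nil
    simp [tabulate, dist_pure, this]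
  | cons i l ih =>
    obtain ⟨hi, hl⟩ := List.nodup_cons.1 hl
    rw [dist_tabulate_cons d f hi, ih hl, List.map_cons, List.prod_cons]
    · congr 2
      refine List.map_congr_left fun j hj => ?_
      rw [Function.update_of_ne (ne_of_mem_of_not_mem hj hi)]
    · intro j hj
      obtain rfl | hji := eq_or_ne j i
      · simp
      · rw [Function.update_of_ne hji, hg j (List.not_mem_cons_of_ne_of_not_mem hji hj)]

theorem dist_tabulate [DecidableEq ι] [Fintype ι] (d : β) (f : ι → Prog n (GaloisField 2 m) β)
    {l : List ι} (hl : l.Nodup) (hc : ∀ i, i ∈ l) (g : ι → β) :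
    (tabulate d l f).dist G g = ∏ i, (f i).dist G (g i) := by
  have huniv : (Finset.univ : Finset ι) = l.toFinset := by ext i; simp [hc i]
  rw [dist_tabulate_nodup d f hl fun i hi => absurd (hc i) hi, huniv, List.prod_toFinset _ hl]

end Prog

/-! ## Legitimate walks -/

section Walks

variable {V : Type*} {k : ℕ}

/-- The sequence `p 0, …, p k`, continued by `p k`. Walks range over the finite type
`Fin (k + 1) → V`, but indices are easier to manipulate in `ℕ`. -/
def extend (p : Fin (k + 1) → V) (t : ℕ) : V := p (Fin.clamp t k)

theorem extend_val (p : Fin (k + 1) → V) (t : Fin (k + 1)) : extend p t = p t :=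
  congrArg p (Fin.ext (Nat.min_eq_left (Nat.le_of_lt_succ t.isLt)))

theorem extend_restrict (P : ℕ → V) {t : ℕ} (ht : t ≤ k) :
    extend (fun t : Fin (k + 1) => P t) t = P t :=
  congrArg P (Nat.min_eq_left ht)

theorem extend_snoc_of_le (p : Fin (k + 1) → V) (u : V) {t : ℕ} (ht : t ≤ k) :
    extend (Fin.snoc p u : Fin (k + 1 + 1) → V) t = extend p t := by
  have hclamp : Fin.clamp t (k + 1) = (Fin.clamp t k).castSucc :=
    Fin.ext (by simp [Fin.clamp, ht, Nat.le_succ_of_le ht])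
  rw [extend, hclamp, Fin.snoc_castSucc, extend]

theorem extend_snoc_last (p : Fin (k + 1) → V) (u : V) :
    extend (Fin.snoc p u : Fin (k + 1 + 1) → V) (k + 1) = u := by
  have hclamp : Fin.clamp (k + 1) (k + 1) = Fin.last (k + 1) := Fin.ext (Nat.min_self _)
  rw [extend, hclamp, Fin.snoc_last]

/-- The indices of the vertices of the walk `p 0, …, p k` that lie in the first part `V₁`. -/
def firstIdx (V₁ : V → Bool) (k : ℕ) (p : ℕ → V) : Finset ℕ :=
  {t ∈ Finset.range (k + 1) | V₁ (p t) = true}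

/-- The indices of the edges of the walk `p 0, …, p k` that have both ends in the second part. -/
def secondIdx (V₁ : V → Bool) (k : ℕ) (p : ℕ → V) : Finset ℕ :=
  {t ∈ Finset.range k | V₁ (p t) = false ∧ V₁ (p (t + 1)) = false}

/-- The sequence `p 0, …, p k` is an `(r, s)`-legitimate walk from `v₀`. -/
structure IsLegit (G : SimpleGraph V) (V₁ : V → Bool) (v₀ : V) (k r s : ℕ) (p : ℕ → V) :
    Prop where
  start : p 0 = v₀
  adj : ∀ t < k, G.Adj (p t) (p (t + 1))
  card_first : (firstIdx V₁ k p).card = r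
  card_second : (secondIdx V₁ k p).card = s
  no_return : ∀ t, t + 2 ≤ k → p (t + 2) = p t → V₁ (p t) = false → V₁ (p (t + 1)) = false

variable {G : SimpleGraph V} {V₁ : V → Bool} {v₀ : V} {r s : ℕ} {p q : ℕ → V}

theorem firstIdx_congr (h : ∀ t ≤ k, p t = q t) : firstIdx V₁ k p = firstIdx V₁ k q :=
  Finset.filter_congr fun t ht => by rw [h t (Nat.le_of_lt_succ (Finset.mem_range.1 ht))]

theorem secondIdx_congr (h : ∀ t ≤ k, p t = q t) : secondIdx V₁ k p = secondIdx V₁ k q :=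
  Finset.filter_congr fun t ht => by
    have htk := Finset.mem_range.1 ht
    rw [h t htk.le, h (t + 1) htk]

theorem firstIdx_succ (V₁ : V → Bool) (k : ℕ) (p : ℕ → V) :
    firstIdx V₁ (k + 1) p =
      if V₁ (p (k + 1)) then insert (k + 1) (firstIdx V₁ k p) else firstIdx V₁ k p := by
  rw [firstIdx, Finset.range_add_one, Finset.filter_insert]; rfl

theorem secondIdx_succ (V₁ : V → Bool) (k : ℕ) (p : ℕ → V) :
    secondIdx V₁ (k + 1) p =
      if V₁ (p k) = false ∧ V₁ (p (k + 1)) = false then insert k (secondIdx V₁ k p)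
      else secondIdx V₁ k p := by
  rw [secondIdx, Finset.range_add_one, Finset.filter_insert]; rfl

theorem notMem_firstIdx : k + 1 ∉ firstIdx V₁ k p := by simp [firstIdx]

theorem notMem_secondIdx : k ∉ secondIdx V₁ k p := by simp [secondIdx]

theorem card_firstIdx_succ (V₁ : V → Bool) (k : ℕ) (p : ℕ → V) :
    (firstIdx V₁ (k + 1) p).card =
      (firstIdx V₁ k p).card + if V₁ (p (k + 1)) then 1 else 0 := by
  rw [firstIdx_succ]
  split_ifs
  · exact Finset.card_insert_of_notMem notMem_firstIdx
  · rfl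

theorem card_secondIdx_succ (V₁ : V → Bool) (k : ℕ) (p : ℕ → V) :
    (secondIdx V₁ (k + 1) p).card = (secondIdx V₁ k p).card +
      if V₁ (p k) = false ∧ V₁ (p (k + 1)) = false then 1 else 0 := by
  rw [secondIdx_succ]
  split_ifs
  · exact Finset.card_insert_of_notMem notMem_secondIdx
  · rfl

theorem IsLegit.congr (hp : IsLegit G V₁ v₀ k r s p) (h : ∀ t ≤ k, p t = q t) :
    IsLegit G V₁ v₀ k r s q where
  start := by rw [← h 0 (by omega), hp.start]
  adj t ht := by rw [← h t (by omega), ← h (t + 1) (by omega)]; exact hp.adj t ht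
  card_first := by rw [← firstIdx_congr h, hp.card_first]
  card_second := by rw [← secondIdx_congr h, hp.card_second]
  no_return t ht := by
    rw [← h t (by omega), ← h (t + 1) (by omega), ← h (t + 2) (by omega)]
    exact hp.no_return t ht

theorem isLegit_congr (h : ∀ t ≤ k, p t = q t) :
    IsLegit G V₁ v₀ k r s p ↔ IsLegit G V₁ v₀ k r s q :=
  ⟨fun hp => hp.congr h, fun hq => hq.congr fun t ht => (h t ht).symm⟩

/-- For `k = 0` the truncated index `k - 1` is `0`, and the last condition holds since `V₁`
separates `p 0` from `p 1`. -/
theorem isLegit_succ_iff :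
    IsLegit G V₁ v₀ (k + 1) (r + if V₁ (p (k + 1)) then 1 else 0)
        (s + if V₁ (p k) = false ∧ V₁ (p (k + 1)) = false then 1 else 0) p ↔
      IsLegit G V₁ v₀ k r s p ∧ G.Adj (p k) (p (k + 1)) ∧
        (V₁ (p k) = true ∧ V₁ (p (k + 1)) = false → p (k - 1) ≠ p (k + 1)) := by
  constructor
  · intro h
    have hr := h.card_first
    have hs := h.card_second
    rw [card_firstIdx_succ] at hr
    rw [card_secondIdx_succ] at hs
    refine ⟨⟨h.start, fun t ht => h.adj t (by omega), by omega, by omega,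
      fun t ht => h.no_return t (by omega)⟩, h.adj k (by omega), ?_⟩
    rintro ⟨h₁, h₂⟩ he
    obtain _ | j := k
    · simp_all
    · simpa [h₁] using h.no_return j le_rfl he.symm (by rw [← h₂, ← he]; rfl)
  · rintro ⟨h, ha, hr⟩
    refine ⟨h.start, fun t ht => ?_, by rw [card_firstIdx_succ, h.card_first],
      by rw [card_secondIdx_succ, h.card_second], fun t ht he hf => ?_⟩
    · obtain ht | rfl := Nat.lt_succ_iff_lt_or_eq.1 ht
      · exact h.adj t ht
      · exact ha
    · obtain ht' | rfl : t + 2 ≤ k ∨ k = t + 1 := by omega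
      · exact h.no_return t ht' he hf
      · by_contra hc
        exact hr ⟨by simpa using hc, by rw [← hf, ← he]⟩ he.symm

theorem isLegit_one_iff (hv₀ : V₁ v₀ = true) :
    IsLegit G V₁ v₀ 1 r s p ↔
      p 0 = v₀ ∧ G.Adj (p 0) (p 1) ∧ r = (1 + if V₁ (p 1) then 1 else 0) ∧ s = 0 := by
  have hfirst (h : p 0 = v₀) : (firstIdx V₁ 1 p).card = 1 + if V₁ (p 1) then 1 else 0 := by
    rw [card_firstIdx_succ]
    simp [firstIdx, Finset.filter_singleton, h, hv₀]
  have hsecond (h : p 0 = v₀) : (secondIdx V₁ 1 p).card = 0 := by simp [secondIdx, h, hv₀]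
  constructor
  · intro h
    exact ⟨h.start, h.adj 0 one_pos, h.card_first.symm.trans (hfirst h.start),
      h.card_second.symm.trans (hsecond h.start)⟩
  · rintro ⟨hstart, hadj, hr, hs⟩
    refine ⟨hstart, fun t ht => ?_, (hfirst hstart).trans hr.symm, (hsecond hstart).trans hs.symm,
      fun t ht => by omega⟩
    rwa [Nat.lt_one_iff.1 ht]

open Classical in
/-- The `(r, s)`-legitimate walks of length `k` from `v₀`, as tuples of vertices. -/
noncomputable def legitWalks [Fintype V] (G : SimpleGraph V) (V₁ : V → Bool) (v₀ : V)
    (k r s : ℕ) : Finset (Fin (k + 1) → V) :=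
  {p | IsLegit G V₁ v₀ k r s (extend p)}

theorem mem_legitWalks [Fintype V] {p : Fin (k + 1) → V} :
    p ∈ legitWalks G V₁ v₀ k r s ↔ IsLegit G V₁ v₀ k r s (extend p) := by
  simp [legitWalks]

end Walks

section WalkSum

variable {n : ℕ} {R : Type*} [CommSemiring R] {V₁ : Fin n → Bool} {ρ : Var n → R} {k : ℕ}

/-- The monomial of the walk `p 0, …, p k`, evaluated at `ρ`. -/
def weight (V₁ : Fin n → Bool) (ρ : Var n → R) (k : ℕ) (p : ℕ → Fin n) : R :=
  (∏ t ∈ Finset.range k, ρ (.x s(p t, p (t + 1)))) * (∏ t ∈ firstIdx V₁ k p, ρ (.y (p t))) *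
    ∏ t ∈ secondIdx V₁ k p, ρ (.z s(p t, p (t + 1)))

/-- The factor by which the monomial of a walk that ends in `u` grows when it is continued
to `v`. -/
def stepWeight (V₁ : Fin n → Bool) (ρ : Var n → R) (u v : Fin n) : R :=
  ρ (.x s(u, v)) * (if V₁ v then ρ (.y v) else 1) *
    if V₁ u = false ∧ V₁ v = false then ρ (.z s(u, v)) else 1

theorem weight_succ (V₁ : Fin n → Bool) (ρ : Var n → R) (k : ℕ) (p : ℕ → Fin n) :
    weight V₁ ρ (k + 1) p = weight V₁ ρ k p * stepWeight V₁ ρ (p k) (p (k + 1)) := by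
  have hy : ∏ t ∈ firstIdx V₁ (k + 1) p, ρ (.y (p t)) = (∏ t ∈ firstIdx V₁ k p, ρ (.y (p t))) *
      if V₁ (p (k + 1)) then ρ (.y (p (k + 1))) else 1 := by
    rw [firstIdx_succ]
    split_ifs
    · rw [Finset.prod_insert notMem_firstIdx, mul_comm]
    · rw [mul_one]
  have hz : ∏ t ∈ secondIdx V₁ (k + 1) p, ρ (.z s(p t, p (t + 1))) =
      (∏ t ∈ secondIdx V₁ k p, ρ (.z s(p t, p (t + 1)))) *
        if V₁ (p k) = false ∧ V₁ (p (k + 1)) = false then ρ (.z s(p k, p (k + 1))) else 1 := by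
    rw [secondIdx_succ]
    split_ifs
    · rw [Finset.prod_insert notMem_secondIdx, mul_comm]
    · rw [mul_one]
  rw [weight, hy, hz, Finset.prod_range_succ, weight, stepWeight]
  ring

theorem weight_congr {p q : ℕ → Fin n} (h : ∀ t ≤ k, p t = q t) :
    weight V₁ ρ k p = weight V₁ ρ k q := by
  have hedge {t : ℕ} (ht : t ∈ Finset.range k) : s(p t, p (t + 1)) = s(q t, q (t + 1)) := by
    have htk := Finset.mem_range.1 ht
    rw [h t htk.le, h (t + 1) htk]
  rw [weight, weight, firstIdx_congr h, secondIdx_congr h]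
  congr 1
  · congr 1
    · exact Finset.prod_congr rfl fun t ht => by rw [hedge ht]
    · refine Finset.prod_congr rfl fun t ht => ?_
      rw [h t (Nat.le_of_lt_succ (Finset.mem_range.1 (Finset.mem_filter.1 ht).1))]
  · exact Finset.prod_congr rfl fun t ht => by rw [hedge (Finset.mem_filter.1 ht).1]

/-- The value at `ρ` of the polynomial of the gate `path k r s u₁ u₂`: the sum of the monomials of
the `(r, s)`-legitimate walks of length `k` from `v₀` whose last two vertices are `u₁, u₂`. -/
noncomputable def walkSum (G : SimpleGraph (Fin n)) (V₁ : Fin n → Bool) (v₀ : Fin n)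
    (ρ : Var n → R) (k r s : ℕ) (u₁ u₂ : Fin n) : R :=
  ∑ p ∈ legitWalks G V₁ v₀ k r s with extend p (k - 1) = u₁ ∧ extend p k = u₂,
    weight V₁ ρ k (extend p)

variable {G : SimpleGraph (Fin n)} {v₀ : Fin n} {r s : ℕ} {u₁ u₂ : Fin n}

theorem sum_walkSum (G : SimpleGraph (Fin n)) (V₁ : Fin n → Bool) (v₀ : Fin n) (ρ : Var n → R)
    (k r s : ℕ) : ∑ u₁, ∑ u₂, walkSum G V₁ v₀ ρ k r s u₁ u₂ =
      ∑ p ∈ legitWalks G V₁ v₀ k r s, weight V₁ ρ k (extend p) := by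
  simp only [walkSum, ← Finset.filter_filter, Finset.sum_fiberwise]

theorem walkSum_eq_zero (h : ∀ p : ℕ → Fin n, IsLegit G V₁ v₀ k r s p → p (k - 1) = u₁ →
    p k ≠ u₂) : walkSum G V₁ v₀ ρ k r s u₁ u₂ = 0 := by
  rw [walkSum, Finset.filter_eq_empty_iff.2, Finset.sum_empty]
  exact fun p hp hu => h _ (mem_legitWalks.1 hp) hu.1 hu.2

theorem walkSum_of_not_adj (hk : 1 ≤ k) (h : ¬ G.Adj u₁ u₂) :
    walkSum G V₁ v₀ ρ k r s u₁ u₂ = 0 :=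
  walkSum_eq_zero fun p hp h₁ h₂ => h (by
    simpa [h₁, h₂, Nat.sub_add_cancel hk] using hp.adj (k - 1) (by omega))

theorem walkSum_of_first_eq_zero (h : V₁ u₂ = true) : walkSum G V₁ v₀ ρ k 0 s u₁ u₂ = 0 :=
  walkSum_eq_zero fun p hp _ h₂ => by
    have hk : k ∈ firstIdx V₁ k p := by simp [firstIdx, h₂, h]
    simp [Finset.card_eq_zero.1 hp.card_first] at hk

theorem walkSum_of_second_eq_zero (hk : 1 ≤ k) (hu₁ : V₁ u₁ = false) (hu₂ : V₁ u₂ = false) :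
    walkSum G V₁ v₀ ρ k r 0 u₁ u₂ = 0 :=
  walkSum_eq_zero fun p hp h₁ h₂ => by
    have hk : k - 1 ∈ secondIdx V₁ k p := by
      simp [secondIdx, Nat.sub_add_cancel hk, h₁, h₂, hu₁, hu₂]
      omega
    simp [Finset.card_eq_zero.1 hp.card_second] at hk

theorem snoc_mem_legitWalks_iff {q : Fin (k + 1) → Fin n} (hq : extend q k = u₁) :
    Fin.snoc q u₂ ∈ legitWalks G V₁ v₀ (k + 1) (r + if V₁ u₂ then 1 else 0)
        (s + if V₁ u₁ = false ∧ V₁ u₂ = false then 1 else 0) ↔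
      q ∈ legitWalks G V₁ v₀ k r s ∧ G.Adj u₁ u₂ ∧
        (V₁ u₁ = true ∧ V₁ u₂ = false → extend q (k - 1) ≠ u₂) := by
  have heq : ∀ t ≤ k, extend (Fin.snoc q u₂ : Fin (k + 1 + 1) → Fin n) t = extend q t :=
    fun t ht => extend_snoc_of_le q u₂ ht
  have hstep := isLegit_succ_iff (k := k) (G := G) (V₁ := V₁) (v₀ := v₀) (r := r) (s := s)
    (p := extend (Fin.snoc q u₂ : Fin (k + 1 + 1) → Fin n))
  rw [isLegit_congr heq, extend_snoc_last, heq k le_rfl, heq (k - 1) (by omega), hq] at hstep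
  rw [mem_legitWalks, mem_legitWalks, hstep]

theorem walkSum_succ (h : G.Adj u₁ u₂) :
    walkSum G V₁ v₀ ρ (k + 1) (r + if V₁ u₂ then 1 else 0)
        (s + if V₁ u₁ = false ∧ V₁ u₂ = false then 1 else 0) u₁ u₂ =
      (∑ w with V₁ u₁ = true ∧ V₁ u₂ = false → w ≠ u₂, walkSum G V₁ v₀ ρ k r s w u₁) *
        stepWeight V₁ ρ u₁ u₂ := by
  classical
  have hpenultimate : ∑ w with V₁ u₁ = true ∧ V₁ u₂ = false → w ≠ u₂,
      walkSum G V₁ v₀ ρ k r s w u₁ = ∑ q ∈ legitWalks G V₁ v₀ k r s with extend q k = u₁ ∧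
        (V₁ u₁ = true ∧ V₁ u₂ = false → extend q (k - 1) ≠ u₂), weight V₁ ρ k (extend q) := by
    rw [← Finset.sum_fiberwise_of_maps_to (g := fun q => extend q (k - 1))
      (t := {w | V₁ u₁ = true ∧ V₁ u₂ = false → w ≠ u₂})
      fun q hq => by simpa using (Finset.mem_filter.1 hq).2.2]
    refine Finset.sum_congr rfl fun w hw => Finset.sum_congr ?_ fun _ _ => rfl
    ext q
    simp only [Finset.mem_filter, Finset.mem_univ, true_and] at hw ⊢
    grind
  rw [hpenultimate, Finset.sum_mul, walkSum]
  symm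
  refine Finset.sum_bij (fun q _ => (Fin.snoc q u₂ : Fin (k + 1 + 1) → Fin n)) ?_ ?_ ?_ ?_
  · intro q hq
    obtain ⟨hq, hu₁, hu₂⟩ := Finset.mem_filter.1 hq
    rw [Finset.mem_filter, snoc_mem_legitWalks_iff hu₁, Nat.add_sub_cancel,
      extend_snoc_of_le q u₂ le_rfl, extend_snoc_last]
    exact ⟨⟨hq, h, hu₂⟩, hu₁, rfl⟩
  · intro q _ q' _ heq
    exact (Fin.snoc_injective2 heq).1
  · intro p hp
    obtain ⟨hp, hu₁, hu₂⟩ := Finset.mem_filter.1 hp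
    have hp_snoc : (Fin.snoc (Fin.init p) u₂ : Fin (k + 1 + 1) → Fin n) = p := by
      have hlast : p (Fin.last (k + 1)) = u₂ := (extend_val p (Fin.last (k + 1))).symm.trans hu₂
      rw [← hlast, Fin.snoc_init_self]
    refine ⟨Fin.init p, ?_, hp_snoc⟩
    rw [← hp_snoc] at hp hu₁
    rw [Nat.add_sub_cancel, extend_snoc_of_le _ u₂ le_rfl] at hu₁
    rw [snoc_mem_legitWalks_iff hu₁] at hp
    exact Finset.mem_filter.2 ⟨hp.1, hu₁, hp.2.2⟩
  · intro q hq
    rw [weight_succ, weight_congr fun t ht => extend_snoc_of_le q u₂ ht, extend_snoc_last,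
      extend_snoc_of_le q u₂ le_rfl, (Finset.mem_filter.1 hq).2.1]

theorem walkSum_succ_of_first (h : G.Adj u₁ u₂) (hu₂ : V₁ u₂ = true) :
    walkSum G V₁ v₀ ρ (k + 1) (r + 1) s u₁ u₂ =
      (∑ w, walkSum G V₁ v₀ ρ k r s w u₁) * ρ (.x s(u₁, u₂)) * ρ (.y u₂) := by
  simpa [hu₂, stepWeight, mul_assoc] using
    walkSum_succ (V₁ := V₁) (v₀ := v₀) (ρ := ρ) (k := k) (r := r) (s := s) h

theorem walkSum_succ_of_first_of_second (h : G.Adj u₁ u₂) (hu₁ : V₁ u₁ = true)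
    (hu₂ : V₁ u₂ = false) :
    walkSum G V₁ v₀ ρ (k + 1) r s u₁ u₂ =
      (∑ w with w ≠ u₂, walkSum G V₁ v₀ ρ k r s w u₁) * ρ (.x s(u₁, u₂)) := by
  simpa [hu₁, hu₂, stepWeight] using
    walkSum_succ (V₁ := V₁) (v₀ := v₀) (ρ := ρ) (k := k) (r := r) (s := s) h

theorem walkSum_succ_of_second (h : G.Adj u₁ u₂) (hu₁ : V₁ u₁ = false) (hu₂ : V₁ u₂ = false) :
    walkSum G V₁ v₀ ρ (k + 1) r (s + 1) u₁ u₂ =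
      (∑ w, walkSum G V₁ v₀ ρ k r s w u₁) * ρ (.x s(u₁, u₂)) * ρ (.z s(u₁, u₂)) := by
  simpa [hu₁, hu₂, stepWeight, mul_assoc] using
    walkSum_succ (V₁ := V₁) (v₀ := v₀) (ρ := ρ) (k := k) (r := r) (s := s) h

theorem walkSum_one (hv₀ : V₁ v₀ = true) (h : G.Adj u₁ u₂) :
    walkSum G V₁ v₀ ρ 1 r s u₁ u₂ =
      if u₁ = v₀ ∧ r = (1 + if V₁ u₂ then 1 else 0) ∧ s = 0 then
        ρ (.x s(u₁, u₂)) * ρ (.y u₁) * (if V₁ u₂ then ρ (.y u₂) else 1) else 0 := by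
  by_cases hcond : u₁ = v₀ ∧ r = (1 + if V₁ u₂ then 1 else 0) ∧ s = 0
  · rw [if_pos hcond]
    obtain ⟨rfl, hr, hs⟩ := hcond
    have hwalks : {p ∈ legitWalks G V₁ u₁ 1 r s | extend p (1 - 1) = u₁ ∧ extend p 1 = u₂} =
        {![u₁, u₂]} := by
      refine Finset.eq_singleton_iff_unique_mem.2 ⟨?_, fun p hp => ?_⟩
      · rw [Finset.mem_filter, mem_legitWalks, isLegit_one_iff hv₀]
        exact ⟨⟨rfl, h, hr, hs⟩, rfl, rfl⟩
      · obtain ⟨-, hp₁, hp₂⟩ := Finset.mem_filter.1 hp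
        exact funext (Fin.forall_fin_two.2 ⟨hp₁, hp₂⟩)
    rw [walkSum, hwalks, Finset.sum_singleton, weight_succ]
    simp [weight, stepWeight, firstIdx, secondIdx, extend, Fin.clamp, Finset.filter_singleton, hv₀]
    split_ifs <;> ring
  · rw [if_neg hcond]
    refine walkSum_eq_zero fun p hp hp₁ hp₂ => hcond ?_
    obtain ⟨hstart, -, hr, hs⟩ := (isLegit_one_iff hv₀).1 hp
    exact ⟨hp₁.symm.trans hstart, hp₂ ▸ hr, hs⟩

end WalkSum

/-! ## The circuit -/

namespace Circuit

variable {n : ℕ} {R : Type} [CommSemiring R] {ρ : Var n → R} {t τ : Node n → R} {ν : Node n}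
  {a b : R} {C D : Circuit n}

/-- The value that the gate `g` computes from the values `ρ` of the inputs and `t` of the other
gates. Whereas `Gate.compute` is a program, this is the algebraic meaning of the gate. -/
def gateValue (ρ : Var n → R) (t : Node n → R) (g : Gate n) : R :=
  match g.op with
  | .add => g.lhs.val ρ t + g.rhs.val ρ t
  | .mul => g.lhs.val ρ t * g.rhs.val ρ t

/-- The values of all gates after the circuit `C` has been evaluated, starting from the values
`t`. -/
def eval (ρ : Var n → R) (t : Node n → R) (C : Circuit n) : Node n → R :=
  C.foldl (fun t g => Function.update t g.dst (gateValue ρ t g)) t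

theorem eval_append (ρ : Var n → R) (t : Node n → R) (C D : Circuit n) :
    eval ρ t (C ++ D) = eval ρ (eval ρ t C) D :=
  List.foldl_append

/-- The effect of the circuit `C` on the values `t` is to assign the value `a` to `ν`. -/
def Sets (ρ : Var n → R) (t : Node n → R) (ν : Node n) (a : R) (C : Circuit n) : Prop :=
  eval ρ t C = Function.update t ν a

theorem sets_nil (ρ : Var n → R) (t : Node n → R) (ν : Node n) : Sets ρ t ν (t ν) [] :=
  (Function.update_eq_self ν t).symm

theorem Sets.append (hC : C.Sets ρ t ν a) (hD : D.Sets ρ (Function.update t ν a) ν b) :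
    Sets ρ t ν b (C ++ D) := by
  rw [Sets, eval_append, show eval ρ t C = _ from hC, show eval ρ _ D = _ from hD,
    Function.update_idem]

/-- If the gates in `A` have their intended values `τ` before the circuit `C` is evaluated, then the
gates in `B` have them afterwards. -/
def Achieves (ρ : Var n → R) (τ : Node n → R) (A B : Set (Node n)) (C : Circuit n) : Prop :=
  ∀ t, Set.EqOn t τ A → Set.EqOn (eval ρ t C) τ B

theorem achieves_nil (ρ : Var n → R) (τ : Node n → R) (A : Set (Node n)) : Achieves ρ τ A A [] :=
  fun _ ht => ht

theorem Achieves.append {A B B' : Set (Node n)} (hC : C.Achieves ρ τ A B)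
    (hD : D.Achieves ρ τ B B') : Achieves ρ τ A B' (C ++ D) := fun t ht => by
  rw [eval_append]
  exact hD _ (hC t ht)

theorem achieves_insert {A : Set (Node n)} (h : ∀ t, Set.EqOn t τ A → Sets ρ t ν (τ ν) C) :
    Achieves ρ τ A (insert ν A) C := fun t ht μ hμ => by
  rw [show eval ρ t C = _ from h t ht]
  obtain rfl | hμν := eq_or_ne μ ν
  · exact Function.update_self ..
  · rw [Function.update_of_ne hμν]
    exact ht (Set.mem_of_mem_insert_of_ne hμ hμν)

end Circuit

section CircuitCorrectness

open Prog Circuit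

variable {n m : ℕ} {G : SimpleGraph (Fin n)} {ρ : Var n → GaloisField 2 m}
  {t τ : Node n → GaloisField 2 m} {ν : Node n} {a b c : GaloisField 2 m} {ι : Type}
  {p q q' : Prog n (GaloisField 2 m) (Circuit n)}

theorem ensures_evalCircuit (C : Circuit n) :
    (evalCircuit C ρ).Ensures G fun a => a = Circuit.eval ρ (fun _ => 0) C .out := by
  have hgate (t : Node n → GaloisField 2 m) (g : Gate n) :
      (g.compute ρ t).Ensures G fun a => a = gateValue ρ t g := by
    obtain ⟨ν, _ | _, l, r⟩ := g
    · exact ensures_fadd _ _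
    · exact ensures_fmul _ _
  exact (ensures_fold (g := fun t g => Function.update t g.dst (gateValue ρ t g))
    (fun t g _ => (hgate t g).bind fun a ha => ensures_pure (by rw [ha])) _).bind
      fun t ht => ensures_pure (by rw [ht]; rfl)

theorem ensures_emit (g : Gate n) :
    (emit g).Ensures (m := m) G (Sets ρ t g.dst (gateValue ρ t g)) :=
  (ensures_true _).bind fun _ _ => ensures_pure rfl

theorem ensures_sets_of_eq (h : p.Ensures G (Sets ρ t ν a)) (hab : a = b) :
    p.Ensures G (Sets ρ t ν b) := hab ▸ h

theorem ensures_clear (ν : Node n) : (clear ν).Ensures (m := m) G (Sets ρ t ν 0) :=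
  ensures_sets_of_eq (ensures_emit _) (zero_add 0)

theorem ensures_addNode (ν μ : Node n) :
    (addNode ν μ).Ensures (m := m) G (Sets ρ t ν (t ν + t μ)) := ensures_emit _

theorem ensures_mulVar (ν : Node n) (v : Var n) :
    (mulVar ν v).Ensures (m := m) G (Sets ρ t ν (t ν * ρ v)) := ensures_emit _

theorem ensures_sets_append (hp : p.Ensures G (Sets ρ t ν a))
    (hq : q.Ensures G (Sets ρ (Function.update t ν a) ν b)) :
    (p >>= fun C => q >>= fun D => pure (C ++ D)).Ensures G (Sets ρ t ν b) :=
  hp.bind fun _ hC => hq.bind fun _ hD => ensures_pure (hC.append hD)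

theorem ensures_sets_append_append (hp : p.Ensures G (Sets ρ t ν a))
    (hq : q.Ensures G (Sets ρ (Function.update t ν a) ν b))
    (hq' : q'.Ensures G (Sets ρ (Function.update t ν b) ν c)) :
    (p >>= fun C => q >>= fun D => q' >>= fun E => pure (C ++ D ++ E)).Ensures G (Sets ρ t ν c) :=
  hp.bind fun _ hC => hq.bind fun _ hD => hq'.bind fun _ hE =>
    ensures_pure ((hC.append hD).append hE)

theorem ensures_collect_sets {f : ι → Prog n (GaloisField 2 m) (Circuit n)}
    {a : ι → GaloisField 2 m}
    (h : ∀ i c, (f i).Ensures G (Sets ρ (Function.update t ν c) ν (c + a i))) (l : List ι)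
    (c : GaloisField 2 m) :
    (collect l f).Ensures G (Sets ρ (Function.update t ν c) ν (c + (l.map a).sum)) := by
  induction l generalizing c with
  | nil => exact ensures_pure (by simpa using sets_nil ρ (Function.update t ν c) ν)
  | cons i l ih =>
    rw [collect_cons]
    refine (ensures_true _).bind fun _ _ => ensures_sets_append (h i c) ?_
    rw [Function.update_idem, List.map_cons, List.sum_cons, ← add_assoc]
    exact ih _

variable {V₁ : Fin n → Bool} {v₀ u u₁ u₂ : Fin n} {k r s : ℕ}

theorem ensures_sumGates {ok : Fin n → Bool} (hν : ∀ w, ν ≠ .path k r s w u) (hk : 1 ≤ k)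
    (ht : ∀ w, t (.path k r s w u) = walkSum G V₁ v₀ ρ k r s w u) :
    (sumGates ν k r s u ok).Ensures (m := m) G
      (Sets ρ t ν (∑ w with ok w, walkSum G V₁ v₀ ρ k r s w u)) := by
  classical
  have hsum : ∑ w with ok w, walkSum G V₁ v₀ ρ k r s w u =
      0 + ((List.finRange n).map fun w =>
        if G.Adj u w ∧ ok w then walkSum G V₁ v₀ ρ k r s w u else 0).sum := by
    rw [zero_add, ← Fin.sum_univ_def, Finset.sum_filter]
    refine Finset.sum_congr rfl fun w _ => ?_
    by_cases hadj : G.Adj u w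
    · simp only [hadj, true_and]
    · rw [walkSum_of_not_adj hk fun h => hadj h.symm, ite_self, ite_self]
  rw [hsum]
  refine ensures_sets_append (ensures_clear ν) (ensures_collect_sets (fun w c => ?_) _ 0)
  refine (ensures_adj u w).bind ?_
  rintro _ rfl
  split_ifs with hand hcond hcond
  · exact ensures_sets_of_eq (ensures_addNode _ _) (by
      rw [Function.update_self, Function.update_of_ne (hν w).symm, ht])
  · simp_all
  · simp_all
  · exact ensures_pure (by simpa using sets_nil ρ (Function.update t ν c) ν)

theorem ensures_pathGates_one (hv₀ : V₁ v₀ = true) :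
    (pathGates v₀ V₁ 1 r s u₁ u₂).Ensures (m := m) G
      (Sets ρ t (.path 1 r s u₁ u₂) (walkSum G V₁ v₀ ρ 1 r s u₁ u₂)) := by
  classical
  refine (ensures_adj u₁ u₂).bind ?_
  rintro _ rfl
  by_cases hadj : G.Adj u₁ u₂
  swap
  · simpa [hadj, walkSum_of_not_adj le_rfl hadj] using ensures_clear _
  rw [decide_eq_true hadj, if_pos rfl, if_pos rfl, walkSum_one hv₀ hadj]
  cases hu₂ : V₁ u₂
  · simp only [true_and, Bool.false_eq_true, false_and, and_false, if_false, add_zero, mul_one]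
    split_ifs with hcond
    · obtain ⟨rfl, rfl, rfl⟩ := hcond
      exact ensures_emit _
    · exact ensures_clear _
  · simp only [true_and, Bool.true_eq_false, false_and, and_false, if_false, if_true,
      Nat.reduceAdd]
    split_ifs with hcond
    · obtain ⟨rfl, rfl, rfl⟩ := hcond
      exact ensures_sets_append (ensures_emit _) (ensures_sets_of_eq (ensures_mulVar _ _) (by
        rw [Function.update_self]; rfl))
    · exact ensures_clear _

theorem ensures_pathGates_succ (hk : 1 ≤ k)
    (ht : ∀ r' ≤ r, ∀ s' ≤ s, ∀ w,
      t (.path k r' s' w u₁) = walkSum G V₁ v₀ ρ k r' s' w u₁) :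
    (pathGates v₀ V₁ (k + 1) r s u₁ u₂).Ensures (m := m) G
      (Sets ρ t (.path (k + 1) r s u₁ u₂) (walkSum G V₁ v₀ ρ (k + 1) r s u₁ u₂)) := by
  classical
  have hν (r' s' : ℕ) (w : Fin n) : (.path (k + 1) r s u₁ u₂ : Node n) ≠ .path k r' s' w u₁ := by
    simp
  refine (ensures_adj u₁ u₂).bind ?_
  rintro _ rfl
  by_cases hadj : G.Adj u₁ u₂
  swap
  · simpa [hadj, walkSum_of_not_adj (Nat.le_add_left 1 k) hadj] using ensures_clear _
  rw [decide_eq_true hadj, if_pos rfl, if_neg (by omega)]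
  split_ifs with hu₂ hu₁
  · obtain _ | r' := r
    · rw [walkSum_of_first_eq_zero hu₂]
      exact ensures_clear _
    · rw [walkSum_succ_of_first hadj hu₂]
      refine ensures_sets_append_append
        (ensures_sumGates (hν r' s) hk (ht r' r'.le_succ s le_rfl))
        (ensures_mulVar _ _) (ensures_sets_of_eq (ensures_mulVar _ _) ?_)
      simp
  · rw [walkSum_succ_of_first_of_second hadj hu₁ (by simpa using hu₂)]
    refine ensures_sets_append (ensures_sumGates (hν r s) hk (ht r le_rfl s le_rfl))
      (ensures_sets_of_eq (ensures_mulVar _ _) ?_)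
    simp
  · obtain _ | s' := s
    · rw [walkSum_of_second_eq_zero (Nat.le_add_left 1 k) (by simpa using hu₁) (by simpa using hu₂)]
      exact ensures_clear _
    · rw [walkSum_succ_of_second hadj (by simpa using hu₁) (by simpa using hu₂)]
      refine ensures_sets_append_append
        (ensures_sumGates (hν r s') hk (ht r le_rfl s' s'.le_succ))
        (ensures_mulVar _ _) (ensures_sets_of_eq (ensures_mulVar _ _) ?_)
      simp

theorem ensures_pathGates (hv₀ : V₁ v₀ = true) (hk : 1 ≤ k)
    (ht : ∀ r' ≤ r, ∀ s' ≤ s, ∀ w, 2 ≤ k →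
      t (.path (k - 1) r' s' w u₁) = walkSum G V₁ v₀ ρ (k - 1) r' s' w u₁) :
    (pathGates v₀ V₁ k r s u₁ u₂).Ensures (m := m) G
      (Sets ρ t (.path k r s u₁ u₂) (walkSum G V₁ v₀ ρ k r s u₁ u₂)) := by
  obtain _ | _ | k := k
  · omega
  · exact ensures_pathGates_one hv₀
  · exact ensures_pathGates_succ (by omega) fun r' hr s' hs w => ht r' hr s' hs w (by omega)

theorem ensures_collect_achieves {f : ι → Prog n (GaloisField 2 m) (Circuit n)}
    {A : Set (Node n)} {N : ι → Set (Node n)} {l : List ι}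
    (h : ∀ i ∈ l, ∀ B, A ⊆ B → (f i).Ensures G (Achieves ρ τ B (B ∪ N i))) {B : Set (Node n)}
    (hB : A ⊆ B) :
    (collect l f).Ensures G (Achieves ρ τ B (B ∪ ⋃ i ∈ l, N i)) := by
  induction l generalizing B with
  | nil => exact ensures_pure (by simpa using achieves_nil ρ τ B)
  | cons i l ih =>
    rw [collect_cons]
    have hsplit : B ∪ ⋃ j ∈ i :: l, N j = (B ∪ N i) ∪ ⋃ j ∈ l, N j := by
      simp only [List.mem_cons, Set.iUnion_iUnion_eq_or_left, Set.union_assoc]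
    rw [hsplit]
    exact (ensures_true _).bind fun _ _ => (h i List.mem_cons_self B hB).bind fun C hC =>
      (ih (fun j hj => h j (List.mem_cons_of_mem i hj)) (hB.trans Set.subset_union_left)).bind
        fun D hD => ensures_pure (hC.append hD)

theorem ensures_collect_range'_achieves {f : ℕ → Prog n (GaloisField 2 m) (Circuit n)}
    {A : ℕ → Set (Node n)} {a : ℕ}
    (h : ∀ j ≥ a, (f j).Ensures G (Achieves ρ τ (A j) (A (j + 1)))) (k : ℕ) :
    (collect (List.range' a k) f).Ensures G (Achieves ρ τ (A a) (A (a + k))) := by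
  induction k generalizing a with
  | zero => exact ensures_pure (achieves_nil ρ τ (A a))
  | succ k ih =>
    rw [List.range'_succ, collect_cons, ← Nat.add_assoc, Nat.add_right_comm]
    exact (ensures_true _).bind fun _ _ => (h a le_rfl).bind fun C hC =>
      (ih fun j hj => h j (by omega)).bind fun D hD => ensures_pure (hC.append hD)

/-- The values that the circuit is meant to give to its gates. The output gate is treated apart from
the others, and has no intended value here. -/
noncomputable def pathValue (G : SimpleGraph (Fin n)) (V₁ : Fin n → Bool) (v₀ : Fin n)
    (ρ : Var n → GaloisField 2 m) : Node n → GaloisField 2 m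
  | .path j r s u₁ u₂ => walkSum G V₁ v₀ ρ j r s u₁ u₂
  | .out => 0

/-- The gates that the dynamic program has filled once all lengths below `j` are done. -/
def filledNodes (n r s j : ℕ) : Set (Node n) :=
  {ν | ∃ j' r' s' u₁ u₂, ν = .path j' r' s' u₁ u₂ ∧ 1 ≤ j' ∧ j' < j ∧ r' ≤ r ∧ s' ≤ s}

theorem ensures_collect_pathGates (hv₀ : V₁ v₀ = true) {j : ℕ} (hj : 1 ≤ j) :
    (collect (List.range (r + 1)) fun r' => collect (List.range (s + 1)) fun s' =>
      collect (List.finRange n) fun u₁ => collect (List.finRange n) fun u₂ =>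
        pathGates v₀ V₁ j r' s' u₁ u₂).Ensures (m := m) G
      (Achieves ρ (pathValue G V₁ v₀ ρ) (filledNodes n r s j) (filledNodes n r s (j + 1))) := by
  refine Ensures.mono (ensures_collect_achieves (fun r' hr _ hA₁ =>
    ensures_collect_achieves (fun s' hs _ hA₂ =>
      ensures_collect_achieves (fun u₁ _ _ hA₃ =>
        ensures_collect_achieves (N := fun u₂ => {.path j r' s' u₁ u₂}) (fun u₂ _ B hA₄ => ?_) hA₃)
      hA₂) hA₁) subset_rfl) fun C hC t ht => Set.EqOn.mono ?_ (hC t ht)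
  · rw [Set.union_singleton]
    refine Ensures.mono (ensures_forall.2 fun t => ensures_forall.2 fun ht :
      Set.EqOn t (pathValue G V₁ v₀ ρ) B => ensures_pathGates hv₀ hj
        fun r'' hr'' s'' hs'' w hj2 => ht (hA₄ ?_)) fun C => achieves_insert
    have := List.mem_range.1 hr
    have := List.mem_range.1 hs
    exact ⟨_, _, _, _, _, rfl, by omega, by omega, by omega, by omega⟩
  · rintro _ ⟨j', r', s', u₁, u₂, rfl, hj', hlt, hr', hs'⟩
    obtain hlt | rfl := Nat.lt_succ_iff_lt_or_eq.1 hlt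
    · exact Or.inl ⟨_, _, _, _, _, rfl, hj', hlt, hr', hs'⟩
    · right
      simpa [Nat.lt_succ_iff] using ⟨hr', hs'⟩

theorem ensures_collect_addNode (t : Node n → GaloisField 2 m) (k r s : ℕ) :
    (collect (List.finRange n) fun u₁ => collect (List.finRange n) fun u₂ =>
      addNode .out (.path k r s u₁ u₂)).Ensures (m := m) G
      (Sets ρ (Function.update t .out 0) .out (∑ u₁, ∑ u₂, t (.path k r s u₁ u₂))) := by
  simp only [Fin.sum_univ_def]
  refine ensures_sets_of_eq (ensures_collect_sets (m := m) (a := fun u₁ =>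
    ((List.finRange n).map fun u₂ => t (.path k r s u₁ u₂)).sum) (fun u₁ c =>
      ensures_collect_sets (a := fun u₂ => t (.path k r s u₁ u₂)) (fun u₂ c =>
        ensures_sets_of_eq (ensures_addNode _ _) ?_) _ c) _ 0) (zero_add _)
  simp

theorem ensures_buildCircuit (hv₀ : V₁ v₀ = true) (hk : 1 ≤ k) :
    (buildCircuit k r s v₀ V₁).Ensures (m := m) G fun C => ∀ ρ : Var n → GaloisField 2 m,
      Circuit.eval ρ (fun _ => 0) C .out =
        ∑ p ∈ legitWalks G V₁ v₀ k r s, weight V₁ ρ k (extend p) := by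
  refine ensures_forall.2 fun ρ => ?_
  have hpaths := ensures_collect_range'_achieves (A := filledNodes n r s) (a := 1) (fun j hj =>
    ensures_collect_pathGates (m := m) (G := G) (ρ := ρ) (r := r) (s := s) hv₀ hj) k
  refine hpaths.bind fun C₀ hC₀ => ?_
  have hfilled := hC₀ (fun _ => 0) (by rintro ν ⟨j', _, _, _, _, _, hj', hlt, _⟩; omega)
  refine (ensures_clear (ρ := ρ) (t := Circuit.eval ρ (fun _ => 0) C₀) .out).bind fun C₁ hC₁ =>
    (ensures_collect_addNode (ρ := ρ) (Circuit.eval ρ (fun _ => 0) C₀) k r s).bind fun C₂ hC₂ =>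
      ensures_pure ?_
  rw [Circuit.eval_append, Circuit.eval_append, show Circuit.eval ρ _ C₁ = _ from hC₁,
    show Circuit.eval ρ _ C₂ = _ from hC₂, Function.update_self, ← sum_walkSum]
  exact Finset.sum_congr rfl fun u₁ _ => Finset.sum_congr rfl fun u₂ _ =>
    hfilled ⟨k, r, s, u₁, u₂, rfl, hk, by omega, le_rfl, le_rfl⟩

end CircuitCorrectness

/-! ## Sieving for distinct elements in characteristic two -/

section Sieve

variable {R ι ι' α : Type*} [CommSemiring R]

/-- The sum over all `S ⊆ T` of the product over `i ∈ I` of the linear forms `∑_{a ∈ S} c i a`. In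
characteristic two it is the permanent-like sum of `∏_{i ∈ I} c i (f i)` over all surjections `f`
from `I` to `T`. -/
def sieve (T : Finset α) (I : Finset ι) (c : ι → α → R) : R :=
  ∑ S ∈ T.powerset, ∏ i ∈ I, ∑ a ∈ S, c i a

theorem sieve_congr (T : Finset α) {I : Finset ι} {c d : ι → α → R} (h : ∀ i ∈ I, c i = d i) :
    sieve T I c = sieve T I d :=
  Finset.sum_congr rfl fun _ _ => Finset.prod_congr rfl fun i hi => by rw [h i hi]

theorem sieve_image [DecidableEq ι'] (T : Finset α) (I : Finset ι) (c : ι' → α → R) {f : ι → ι'}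
    (hf : Function.Injective f) : sieve T (I.image f) c = sieve T I fun i => c (f i) :=
  Finset.sum_congr rfl fun _ _ => Finset.prod_image hf.injOn

theorem sieve_insert [DecidableEq α] [DecidableEq ι] {T : Finset α} {a : α} (ha : a ∉ T)
    (I : Finset ι) (c : ι → α → R) :
    sieve (insert a T) I c =
      sieve T I c + ∑ J ∈ I.powerset, (∏ i ∈ J, c i a) * sieve T (I \ J) c := by
  simp only [sieve, Finset.mul_sum]
  rw [Finset.sum_powerset_insert ha, Finset.sum_comm (s := I.powerset)]
  congr 1
  refine Finset.sum_congr rfl fun S hS => ?_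
  have haS : a ∉ S := fun h => ha (Finset.mem_powerset.1 hS h)
  simp only [Finset.sum_insert haS, Finset.prod_add]

theorem sieve_eq_zero_of_card_lt [CharP R 2] {T : Finset α} {I : Finset ι} (c : ι → α → R)
    (h : I.card < T.card) : sieve T I c = 0 := by
  classical
  induction T using Finset.induction_on generalizing I with
  | empty => simp at h
  | insert a T ha ih =>
    rw [Finset.card_insert_of_notMem ha] at h
    have hsmall : ∀ J ∈ I.powerset.erase ∅, (∏ i ∈ J, c i a) * sieve T (I \ J) c = 0 := by
      intro J hJ
      obtain ⟨hne, hJI⟩ := Finset.mem_erase.1 hJ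
      have hlt : (I \ J).card < I.card := Finset.card_lt_card <|
        Finset.sdiff_ssubset (Finset.mem_powerset.1 hJI) (Finset.nonempty_iff_ne_empty.2 hne)
      rw [ih (by omega), mul_zero]
    rw [sieve_insert ha, ← Finset.add_sum_erase _ _ (Finset.empty_mem_powerset I),
      Finset.sum_eq_zero hsmall, Finset.prod_empty, Finset.sdiff_empty, one_mul, add_zero,
      CharTwo.add_self_eq_zero]

theorem sieve_eq_zero_of_eq [CharP R 2] {T : Finset α} {I : Finset ι} (c : ι → α → R)
    (h : I.card ≤ T.card) {i j : ι} (hi : i ∈ I) (hj : j ∈ I) (hij : i ≠ j) (hc : c i = c j) :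
    sieve T I c = 0 := by
  classical
  -- Squaring is additive, so two equal linear forms multiply to a single one.
  have hji : j ∈ I.erase i := Finset.mem_erase.2 ⟨hij.symm, hj⟩
  have hcard : (I.erase i).card < T.card := by
    rw [Finset.card_erase_of_mem hi]
    have := Finset.card_pos.2 ⟨i, hi⟩
    omega
  rw [← sieve_eq_zero_of_card_lt (fun t a => if t = j then c j a * c j a else c t a) hcard]
  refine Finset.sum_congr rfl fun S _ => ?_
  rw [← Finset.mul_prod_erase _ _ hi, ← Finset.mul_prod_erase _ _ hji,
    ← Finset.mul_prod_erase (I.erase i) _ hji, ← mul_assoc, hc, CharTwo.sum_mul_self]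
  simp only [if_true]
  congr 1
  exact Finset.prod_congr rfl fun t ht => by simp only [if_neg (Finset.ne_of_mem_erase ht)]

theorem exists_sieve_eq_one {K : Type*} {I : Finset ι} {w : ι → K}
    (hw : Set.InjOn w I) {r : ℕ} (hr : I.card = r) :
    ∃ Y : Fin r → K → R, sieve Finset.univ I (fun i a => Y a (w i)) = 1 := by
  classical
  let e := I.equivFinOfCardEq hr
  refine ⟨fun a v => if v = w (e.symm a) then 1 else 0, ?_⟩
  have hsum : ∀ (S : Finset (Fin r)) (i : ι) (hi : i ∈ I),
      (∑ a ∈ S, if w i = w (e.symm a) then (1 : R) else 0) = if e ⟨i, hi⟩ ∈ S then 1 else 0 := by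
    intro S i hi
    have hiff : ∀ a, w i = w (e.symm a) ↔ e ⟨i, hi⟩ = a := fun a => by
      rw [hw.eq_iff hi (e.symm a).2, ← Equiv.eq_symm_apply, Subtype.ext_iff]
    simp only [hiff, Finset.sum_ite_eq]
  rw [sieve, Finset.sum_eq_single Finset.univ]
  · exact Finset.prod_eq_one fun i hi => by rw [hsum _ i hi, if_pos (Finset.mem_univ _)]
  · intro S _ hS
    obtain ⟨a, ha⟩ : ∃ a, a ∉ S := by simpa [Finset.eq_univ_iff_forall] using hS
    refine Finset.prod_eq_zero (e.symm a).2 ?_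
    rw [hsum _ _ (e.symm a).2, if_neg (by simpa using ha)]
  · simp

end Sieve

/-! ## Reversal of a closed segment -/

section Reversal

variable {V : Type*} {k i j : ℕ} {P Q : ℕ → V}

/-- Reversal of the interval from `i` to `j`. -/
def rev (i j t : ℕ) : ℕ := if i ≤ t ∧ t ≤ j then i + j - t else t

theorem rev_involutive (i j : ℕ) : Function.Involutive (rev i j) := fun t => by
  unfold rev; split_ifs <;> omega

theorem rev_of_notMem {t : ℕ} (h : t < i ∨ j < t) : rev i j t = t := if_neg (by omega)

theorem rev_left (h : i ≤ j) : rev i j i = j := by simp [rev, h]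

theorem rev_right (h : i ≤ j) : rev i j j = i := by simp [rev, h]

theorem rev_of_mem {t : ℕ} (hi : i ≤ t) (hj : t ≤ j) : rev i j t = i + j - t := if_pos ⟨hi, hj⟩

theorem rev_lt_iff {N : ℕ} (hj : j < N) (t : ℕ) : rev i j t < N ↔ t < N := by
  unfold rev; split_ifs <;> omega

theorem image_rev_range {N : ℕ} (hj : j < N) :
    (Finset.range N).image (rev i j) = Finset.range N := by
  ext t
  simp only [Finset.mem_image, Finset.mem_range]
  exact ⟨fun ⟨u, hu, hut⟩ => hut ▸ (rev_lt_iff hj u).2 hu,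
    fun ht => ⟨rev i j t, (rev_lt_iff hj t).2 ht, rev_involutive i j t⟩⟩

theorem filter_rev {N : ℕ} (hj : j < N) (C : ℕ → Prop) [DecidablePred C] :
    {t ∈ Finset.range N | C (rev i j t)} = {t ∈ Finset.range N | C t}.image (rev i j) := by
  nth_rw 1 [← image_rev_range (i := i) hj]
  simp only [Finset.filter_image, rev_involutive i j _]

theorem comp_rev_of_notMem (hij : i ≤ j) (h : P i = P j) {t : ℕ} (ht : t ≤ i ∨ j ≤ t) :
    P (rev i j t) = P t := by
  obtain rfl | rfl | ht : t = i ∨ t = j ∨ t < i ∨ j < t := by omega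
  · rw [rev_left hij, h]
  · rw [rev_right hij, h]
  · rw [rev_of_notMem ht]

/-- Reversing the `j - i` edges of a closed segment is `rev i (j - 1)` on the indices of edges. -/
theorem edge_rev (hij : i < j) (h : P i = P j) (t : ℕ) :
    s(P (rev i j t), P (rev i j (t + 1))) =
      s(P (rev i (j - 1) t), P (rev i (j - 1) t + 1)) := by
  by_cases hin : i ≤ t ∧ t < j
  · rw [show rev i j t = rev i (j - 1) t + 1 by unfold rev; split_ifs <;> omega,
      show rev i j (t + 1) = rev i (j - 1) t by unfold rev; split_ifs <;> omega, Sym2.eq_swap]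
  · rw [comp_rev_of_notMem hij.le h (by omega), comp_rev_of_notMem hij.le h (by omega),
      rev_of_notMem (by omega)]

/-- The first vertex of the sequence `P 0, …, P k` that is repeated has index `i`, and `j` is the
last index of the same vertex. -/
structure IsRepeat (k : ℕ) (P : ℕ → V) (i j : ℕ) : Prop where
  lt : i < j
  le : j ≤ k
  eq : P i = P j
  last : ∀ j', j < j' → j' ≤ k → P j' ≠ P i
  first : ∀ i' < i, ∀ j', i' < j' → j' ≤ k → P i' ≠ P j'

theorem IsRepeat.unique {i' j' : ℕ} (h : IsRepeat k P i j) (h' : IsRepeat k P i' j') :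
    i = i' ∧ j = j' := by
  obtain rfl : i = i' := by
    rcases lt_trichotomy i i' with hlt | heq | hgt
    · exact absurd h.eq (h'.first i hlt j h.lt h.le)
    · exact heq
    · exact absurd h'.eq (h.first i' hgt j' h'.lt h'.le)
  refine ⟨rfl, ?_⟩
  rcases lt_trichotomy j j' with hlt | heq | hgt
  · exact absurd h'.eq.symm (h.last j' hlt h'.le)
  · exact heq
  · exact absurd h.eq.symm (h'.last j hgt h.le)

theorem exists_isRepeat {a b : ℕ} (hab : a < b) (hb : b ≤ k) (h : P a = P b) :
    ∃ i j, IsRepeat k P i j := by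
  classical
  have hex : ∃ i, ∃ j, i < j ∧ j ≤ k ∧ P i = P j := ⟨a, b, hab, hb, h⟩
  obtain ⟨j, hij, hjk, hP⟩ := Nat.find_spec hex
  refine ⟨Nat.find hex, Nat.findGreatest (fun j => P j = P (Nat.find hex)) k,
    hij.trans_le (Nat.le_findGreatest hjk hP.symm), Nat.findGreatest_le _, ?_,
    fun j' hj hk => Nat.findGreatest_is_greatest hj hk,
    fun i' hi' j' hlt hle heq => Nat.find_min hex hi' ⟨j', hlt, hle, heq⟩⟩
  exact (Nat.findGreatest_spec (P := fun j => P j = P (Nat.find hex)) hjk hP.symm).symm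

theorem exists_isRepeat_of_not_injective {p : Fin (k + 1) → V} (hp : ¬ Function.Injective p) :
    ∃ i j, IsRepeat k (extend p) i j := by
  obtain ⟨a, b, hab, hne⟩ := Function.not_injective_iff.1 hp
  rw [← extend_val p a, ← extend_val p b] at hab
  obtain hlt | hlt := lt_or_gt_of_ne (Fin.val_ne_of_ne hne)
  · exact exists_isRepeat hlt (Nat.lt_succ_iff.1 b.2) hab
  · exact exists_isRepeat hlt (Nat.lt_succ_iff.1 a.2) hab.symm

theorem IsRepeat.not_injective {p : Fin (k + 1) → V} (h : IsRepeat k (extend p) i j) :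
    ¬ Function.Injective p := fun hp => by
  have hlt := h.lt
  have hle := h.le
  have heq := congrArg Fin.val (hp h.eq)
  simp only [Fin.clamp] at heq
  omega

theorem IsRepeat.congr (h : IsRepeat k P i j) (hPQ : ∀ t ≤ k, P t = Q t) :
    IsRepeat k Q i j := by
  have hle := h.le
  have hik : i ≤ k := h.lt.le.trans hle
  refine ⟨h.lt, hle, ?_, fun j' hj' hk => ?_, fun i' hi' j' hj' hk => ?_⟩
  · rw [← hPQ i hik, ← hPQ j hle, h.eq]
  · rw [← hPQ i hik, ← hPQ j' hk]
    exact h.last j' hj' hk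
  · rw [← hPQ i' (by omega), ← hPQ j' hk]
    exact h.first i' hi' j' hj' hk

theorem IsRepeat.reverse (h : IsRepeat k P i j) : IsRepeat k (fun t => P (rev i j t)) i j := by
  have hlt := h.lt
  have hle := h.le
  refine ⟨hlt, hle, ?_, fun j' hj' hk => ?_, fun i' hi' j' hj' hk => ?_⟩
  · simp only [rev_left hlt.le, rev_right hlt.le, h.eq]
  · simp only [rev_left hlt.le, rev_of_notMem (Or.inr hj'), ← h.eq]
    exact h.last j' hj' hk
  · simp only [rev_of_notMem (Or.inl hi')]
    refine h.first i' hi' _ ?_ (Nat.lt_succ_iff.1 ((rev_lt_iff (by omega) j').2 (by omega)))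
    unfold rev; split_ifs <;> omega

open Classical in
/-- The sequence in which the segment between the first and the last visit of the first repeated
vertex is reversed. -/
noncomputable def flip (p : Fin (k + 1) → V) : Fin (k + 1) → V :=
  if h : ∃ ij : ℕ × ℕ, IsRepeat k (extend p) ij.1 ij.2 then
    fun t => extend p (rev h.choose.1 h.choose.2 t)
  else p

variable {p : Fin (k + 1) → V}

theorem flip_eq (h : IsRepeat k (extend p) i j) :
    flip p = fun t : Fin (k + 1) => extend p (rev i j t) := by
  have hex : ∃ ij : ℕ × ℕ, IsRepeat k (extend p) ij.1 ij.2 := ⟨(i, j), h⟩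
  obtain ⟨hi, hj⟩ := hex.choose_spec.unique h
  rw [flip, dif_pos hex, hi, hj]

theorem extend_flip (h : IsRepeat k (extend p) i j) {t : ℕ} (ht : t ≤ k) :
    extend (flip p) t = extend p (rev i j t) := by
  rw [flip_eq h, extend_restrict (fun t => extend p (rev i j t)) ht]

theorem IsRepeat.flip (h : IsRepeat k (extend p) i j) : IsRepeat k (extend (flip p)) i j :=
  h.reverse.congr fun _ ht => (extend_flip h ht).symm

theorem flip_flip (h : IsRepeat k (extend p) i j) : flip (flip p) = p := by
  rw [flip_eq h.flip]
  funext t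
  have hlt : rev i j t < k + 1 := (rev_lt_iff (Nat.lt_succ_of_le h.le) _).2 t.2
  rw [extend_flip h (Nat.lt_succ_iff.1 hlt), rev_involutive, extend_val]

end Reversal

/-! ## Cancellation of the walks that are not simple -/

section Cancellation

variable {V R : Type*} [CommSemiring R] {G : SimpleGraph V} {V₁ : V → Bool} {v₀ : V}
  {k r s i j : ℕ} {P Q : ℕ → V}

theorem firstIdx_rev (hj : j ≤ k) :
    firstIdx V₁ k (fun t => P (rev i j t)) = (firstIdx V₁ k P).image (rev i j) :=
  filter_rev (Nat.lt_succ_iff.2 hj) fun t => V₁ (P t) = true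

theorem secondIdx_eq (V₁ : V → Bool) (k : ℕ) (P : ℕ → V) : secondIdx V₁ k P =
    {t ∈ Finset.range k | Sym2.map V₁ s(P t, P (t + 1)) = s(false, false)} := by
  simp [secondIdx]

theorem secondIdx_rev (hij : i < j) (hj : j ≤ k) (h : P i = P j) :
    secondIdx V₁ k (fun t => P (rev i j t)) = (secondIdx V₁ k P).image (rev i (j - 1)) := by
  rw [secondIdx_eq, secondIdx_eq, ← filter_rev (by omega)]
  simp only [edge_rev hij h]

theorem IsLegit.reverse (hP : IsLegit G V₁ v₀ k r s P) (hij : i < j) (hj : j ≤ k) (h : P i = P j)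
    (hV : V₁ (P i) = false) : IsLegit G V₁ v₀ k r s fun t => P (rev i j t) where
  start := by rw [comp_rev_of_notMem hij.le h (Or.inl i.zero_le), hP.start]
  adj t ht := by
    have hadj := hP.adj (rev i (j - 1) t) ((rev_lt_iff (by omega) t).2 ht)
    rwa [← SimpleGraph.mem_edgeSet, ← edge_rev hij h] at hadj
  card_first := by
    rw [firstIdx_rev hj, Finset.card_image_of_injective _ (rev_involutive _ _).injective,
      hP.card_first]
  card_second := by
    rw [secondIdx_rev hij hj h, Finset.card_image_of_injective _ (rev_involutive _ _).injective,
      hP.card_second]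
  no_return t ht he hf := by
    obtain hin | hout | hend :
        (i ≤ t ∧ t + 2 ≤ j) ∨ (t + 2 ≤ i ∨ j ≤ t) ∨ (t + 1 = i ∨ t + 1 = j) := by omega
    · rw [rev_of_mem (by omega) (by omega), rev_of_mem (by omega) (by omega)] at he
      rw [rev_of_mem (by omega) (by omega)] at hf ⊢
      have hreturn := hP.no_return (i + j - (t + 2)) (by omega)
      rw [show i + j - (t + 2) + 2 = i + j - t by omega,
        show i + j - (t + 2) + 1 = i + j - (t + 1) by omega] at hreturn
      exact hreturn he.symm (he ▸ hf)
    · simp only [comp_rev_of_notMem hij.le h (show t ≤ i ∨ j ≤ t by omega),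
        comp_rev_of_notMem hij.le h (show t + 1 ≤ i ∨ j ≤ t + 1 by omega),
        comp_rev_of_notMem hij.le h (show t + 2 ≤ i ∨ j ≤ t + 2 by omega)] at he hf ⊢
      exact hP.no_return t ht he hf
    · rw [comp_rev_of_notMem hij.le h (by omega)]
      obtain rfl | rfl := hend
      · exact hV
      · rw [← h, hV]

/-- The sum over all `S ⊆ [s]` and `R ⊆ [r]` of the monomial of the walk `P 0, …, P k` in which
`y` is replaced by `∑_{a ∈ R} Y a` and `z` by `∑_{b ∈ S} Z b`, in factored form. -/
def sieveWeight (V₁ : V → Bool) (x : Sym2 V → R) (Y : Fin r → V → R) (Z : Fin s → Sym2 V → R)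
    (k : ℕ) (P : ℕ → V) : R :=
  (∏ t ∈ Finset.range k, x s(P t, P (t + 1))) *
    sieve Finset.univ (firstIdx V₁ k P) (fun t a => Y a (P t)) *
    sieve Finset.univ (secondIdx V₁ k P) (fun t b => Z b s(P t, P (t + 1)))

variable {x : Sym2 V → R} {Y : Fin r → V → R} {Z : Fin s → Sym2 V → R}

theorem sieveWeight_congr (h : ∀ t ≤ k, P t = Q t) :
    sieveWeight V₁ x Y Z k P = sieveWeight V₁ x Y Z k Q := by
  have hedge : ∀ t ∈ Finset.range k, s(P t, P (t + 1)) = s(Q t, Q (t + 1)) := fun t ht => by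
    have htk := Finset.mem_range.1 ht
    rw [h t htk.le, h (t + 1) htk]
  rw [sieveWeight, firstIdx_congr h, secondIdx_congr h, Finset.prod_congr rfl fun t ht => by
      rw [hedge t ht],
    sieve_congr (d := fun t a => Y a (Q t)) _ fun t ht => by
      rw [h t (Nat.lt_succ_iff.1 (Finset.mem_range.1 (Finset.mem_filter.1 ht).1))],
    sieve_congr (d := fun t b => Z b s(Q t, Q (t + 1))) _ fun t ht => by
      rw [hedge t (Finset.mem_filter.1 ht).1], ← sieveWeight]

theorem sieveWeight_rev (hij : i < j) (hj : j ≤ k) (h : P i = P j) :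
    sieveWeight V₁ x Y Z k (fun t => P (rev i j t)) = sieveWeight V₁ x Y Z k P := by
  simp only [sieveWeight, firstIdx_rev hj, secondIdx_rev hij hj h,
    sieve_image _ _ _ (rev_involutive _ _).injective, edge_rev hij h, rev_involutive _ _ _]
  congr 2
  conv_rhs => rw [← image_rev_range (i := i) (show j - 1 < k by omega),
    Finset.prod_image (rev_involutive i (j - 1)).injective.injOn]

theorem sum_weight_eq_sieveWeight {R : Type} [CommSemiring R] {n : ℕ} {V₁ : Fin n → Bool}
    (x : Sym2 (Fin n) → R) (Y : Fin r → Fin n → R) (Z : Fin s → Sym2 (Fin n) → R)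
    (P : ℕ → Fin n) :
    ∑ S : Finset (Fin s), ∑ T : Finset (Fin r),
      weight V₁ (assign x (fun v => ∑ i ∈ T, Y i v) (fun e => ∑ j ∈ S, Z j e)) k P =
      sieveWeight V₁ x Y Z k P := by
  simp only [weight, assign, sieveWeight, sieve, Finset.powerset_univ, Finset.mul_sum,
    Finset.sum_mul]

variable [CharP R 2]

theorem IsLegit.eq_of_mem_firstIdx (hP : IsLegit G V₁ v₀ k r s P)
    (hne : sieveWeight V₁ x Y Z k P ≠ 0) {a b : ℕ} (ha : a ∈ firstIdx V₁ k P)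
    (hb : b ∈ firstIdx V₁ k P) (hab : P a = P b) : a = b := by
  by_contra hne'
  refine hne ?_
  rw [sieveWeight, sieve_eq_zero_of_eq _ (by simp [hP.card_first]) ha hb hne' (by simp only [hab]),
    mul_zero, zero_mul]

theorem IsLegit.eq_of_mem_secondIdx (hP : IsLegit G V₁ v₀ k r s P)
    (hne : sieveWeight V₁ x Y Z k P ≠ 0) {a b : ℕ} (ha : a ∈ secondIdx V₁ k P)
    (hb : b ∈ secondIdx V₁ k P) (hab : s(P a, P (a + 1)) = s(P b, P (b + 1))) : a = b := by
  by_contra hne'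
  refine hne ?_
  rw [sieveWeight, sieve_eq_zero_of_eq (I := secondIdx V₁ k P) _ (by simp [hP.card_second]) ha hb
    hne' (by simp only [hab]), mul_zero]

theorem IsLegit.eq_false_of_isRepeat (hP : IsLegit G V₁ v₀ k r s P)
    (hne : sieveWeight V₁ x Y Z k P ≠ 0) (h : IsRepeat k P i j) : V₁ (P i) = false := by
  by_contra hV
  rw [Bool.not_eq_false] at hV
  have hlt := h.lt
  have hle := h.le
  exact hlt.ne (hP.eq_of_mem_firstIdx hne (by simp [firstIdx, hV]; omega)
    (by simp [firstIdx, ← h.eq, hV]; omega) h.eq)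

/-- A palindromic segment would have two equal vertices of `V₁`, or two equal edges of `E₂`, or a
return from `V₁` to a vertex of `V₂`, or a loop in its middle. -/
theorem IsLegit.exists_rev_ne (hP : IsLegit G V₁ v₀ k r s P)
    (hne : sieveWeight V₁ x Y Z k P ≠ 0) (hij : i < j) (hj : j ≤ k) :
    ∃ t ≤ k, P (rev i j t) ≠ P t := by
  by_contra! hpal
  obtain ⟨c, hc | hc⟩ := Nat.even_or_odd' (i + j)
  · obtain ⟨d, rfl⟩ : ∃ d, c = d + 1 := ⟨c - 1, by omega⟩
    have hd : P (d + 2) = P d := by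
      have := hpal d (by omega)
      rwa [rev_of_mem (by omega) (by omega), show i + j - d = d + 2 by omega] at this
    cases hVd : V₁ (P d) with
    | false =>
      have hVd' := hP.no_return d (by omega) hd hVd
      have := hP.eq_of_mem_secondIdx hne (a := d) (b := d + 1)
        (by simp [secondIdx, hVd, hVd']; omega) (by simp [secondIdx, hd, hVd, hVd']; omega)
        (by rw [hd, Sym2.eq_swap])
      omega
    | true =>
      have := hP.eq_of_mem_firstIdx hne (a := d) (b := d + 2) (by simp [firstIdx, hVd]; omega)
        (by simp [firstIdx, hd, hVd]; omega) hd.symm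
      omega
  · have hloop := hpal c (by omega)
    rw [rev_of_mem (by omega) (by omega), show i + j - c = c + 1 by omega] at hloop
    exact (hP.adj c (by omega)).ne hloop.symm

theorem sum_sieveWeight_of_not_injective [Fintype V] [DecidableEq V] :
    ∑ p ∈ legitWalks G V₁ v₀ k r s with ¬ Function.Injective p,
      sieveWeight V₁ x Y Z k (extend p) = 0 := by
  have hflip {p : Fin (k + 1) → V} {i j : ℕ} (h : IsRepeat k (extend p) i j) :
      sieveWeight V₁ x Y Z k (extend (flip p)) = sieveWeight V₁ x Y Z k (extend p) := by
    rw [sieveWeight_congr fun t ht => extend_flip h ht, sieveWeight_rev h.lt h.le h.eq]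
  classical
  rw [← Finset.sum_filter_ne_zero]
  simp only [Finset.filter_filter]
  refine Finset.sum_involution (fun p _ => flip p) ?_ ?_ ?_ ?_ <;> intro p hp <;>
    obtain ⟨hlegit, hninj, hne⟩ := Finset.mem_filter.1 hp <;>
    rw [mem_legitWalks] at hlegit <;>
    obtain ⟨i, j, hij⟩ := exists_isRepeat_of_not_injective hninj
  · rw [hflip hij, CharTwo.add_self_eq_zero]
  · intro _ heq
    obtain ⟨t, ht, hrev⟩ := hlegit.exists_rev_ne hne hij.lt hij.le
    rw [← extend_flip hij ht, heq] at hrev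
    exact hrev rfl
  · refine Finset.mem_filter.2 ⟨mem_legitWalks.2 ?_, hij.flip.not_injective, hflip hij ▸ hne⟩
    rw [isLegit_congr fun t ht => extend_flip hij ht]
    exact hlegit.reverse hij.lt hij.le hij.eq (hlegit.eq_false_of_isRepeat hne hij)
  · exact flip_flip hij

theorem sum_sieveWeight_eq [Fintype V] [DecidableEq V] :
    ∑ p ∈ legitWalks G V₁ v₀ k r s, sieveWeight V₁ x Y Z k (extend p) =
      ∑ p ∈ legitWalks G V₁ v₀ k r s with Function.Injective p,
        sieveWeight V₁ x Y Z k (extend p) := by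
  rw [← Finset.sum_filter_add_sum_filter_not _ fun p => Function.Injective p,
    sum_sieveWeight_of_not_injective, add_zero]

end Cancellation

/-! ## The polynomial identity test -/

section Phi

variable {n : ℕ} {R R' : Type} [CommSemiring R] [CommSemiring R'] {G : SimpleGraph (Fin n)}
  {V₁ : Fin n → Bool} {v₀ : Fin n} {k r s : ℕ}

/-- The value of `φ f` at the point `(x, Y, Z)`, where `Y i` and `Z j` stand for the copies `y⁽ⁱ⁾`
and `z⁽ʲ⁾` of the variables. -/
noncomputable def phi (G : SimpleGraph (Fin n)) (V₁ : Fin n → Bool) (v₀ : Fin n) (k : ℕ)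
    (x : Sym2 (Fin n) → R) (Y : Fin r → Fin n → R) (Z : Fin s → Sym2 (Fin n) → R) : R :=
  ∑ S : Finset (Fin s), ∑ T : Finset (Fin r), ∑ p ∈ legitWalks G V₁ v₀ k r s,
    weight V₁ (assign x (fun v => ∑ i ∈ T, Y i v) (fun e => ∑ j ∈ S, Z j e)) k (extend p)

theorem phi_eq_sum_simple [CharP R 2] (x : Sym2 (Fin n) → R) (Y : Fin r → Fin n → R)
    (Z : Fin s → Sym2 (Fin n) → R) :
    phi G V₁ v₀ k x Y Z = ∑ p ∈ legitWalks G V₁ v₀ k r s with Function.Injective p,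
      sieveWeight V₁ x Y Z k (extend p) := by
  rw [← sum_sieveWeight_eq, phi]
  simp only [← sum_weight_eq_sieveWeight]
  rw [Finset.sum_congr rfl fun S _ => Finset.sum_comm, Finset.sum_comm]

theorem map_phi (φ : R →+* R') (x : Sym2 (Fin n) → R) (Y : Fin r → Fin n → R)
    (Z : Fin s → Sym2 (Fin n) → R) : φ (phi G V₁ v₀ k x Y Z) =
      phi G V₁ v₀ k (fun e => φ (x e)) (fun i v => φ (Y i v)) (fun j e => φ (Z j e)) := by
  simp only [phi, weight, assign, map_sum, map_prod, map_mul]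

end Phi

section SimpleWalks

variable {V : Type*} {k : ℕ} {P Q : ℕ → V}

theorem injOn_extend {p : Fin (k + 1) → V} (hp : Function.Injective p) :
    Set.InjOn (extend p) (Set.Iic k) := fun a (ha : a ≤ k) b (hb : b ≤ k) hab => by
  have h : min a k = min b k := congrArg Fin.val (hp hab)
  rwa [min_eq_left ha, min_eq_left hb] at h

theorem injOn_edges (hP : Set.InjOn P (Set.Iic k)) :
    Set.InjOn (fun t => s(P t, P (t + 1))) (Set.Iio k) :=
  fun a (ha : a < k) b (hb : b < k) hab => by
    rcases Sym2.eq_iff.1 hab with ⟨h, -⟩ | ⟨h₁, h₂⟩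
    · exact hP ha.le hb.le h
    · have h₁ : a = b + 1 := hP ha.le hb h₁
      have h₂ : a + 1 = b := hP ha hb.le h₂
      omega

theorem eqOn_of_edges_subset (hP : Set.InjOn P (Set.Iic k)) (hQ : Set.InjOn Q (Set.Iic k))
    (h₀ : P 0 = Q 0) (h : ∀ t < k, ∃ u < k, s(Q t, Q (t + 1)) = s(P u, P (u + 1))) :
    Set.EqOn P Q (Set.Iic k) := fun t (ht : t ≤ k) => by
  induction t using Nat.strong_induction_on with
  | _ t ih =>
    cases t with
    | zero => exact h₀
    | succ t =>
      obtain ⟨u, hu, hedge⟩ := h t ht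
      rw [← ih t t.lt_succ_self (Nat.le_of_succ_le ht), Sym2.eq_iff] at hedge
      rcases hedge with ⟨htu, hnext⟩ | ⟨htu, hnext⟩
      · obtain rfl : t = u := hP (Nat.le_of_succ_le ht) hu.le htu
        exact hnext.symm
      · have htu : t = u + 1 := hP (Nat.le_of_succ_le ht) hu htu
        rw [ih u (by omega) hu.le] at hnext
        have : t + 1 = u := hQ ht hu.le hnext
        omega

end SimpleWalks

section PhiPoly

variable {n : ℕ} {R : Type} [CommSemiring R] {G : SimpleGraph (Fin n)} {V₁ : Fin n → Bool}
  {v₀ : Fin n} {k r s : ℕ}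

theorem exists_phi_eq_one [CharP R 2] {p : Fin (k + 1) → Fin n}
    (hp : p ∈ legitWalks G V₁ v₀ k r s) (hinj : Function.Injective p) :
    ∃ (x : Sym2 (Fin n) → R) (Y : Fin r → Fin n → R) (Z : Fin s → Sym2 (Fin n) → R),
      phi G V₁ v₀ k x Y Z = 1 := by
  classical
  have hP := injOn_extend hinj
  have hlegit := mem_legitWalks.1 hp
  obtain ⟨Y, hY⟩ := exists_sieve_eq_one (R := R) (I := firstIdx V₁ k (extend p)) (w := extend p)
    (hP.mono fun t ht => Nat.le_of_lt_succ (Finset.mem_range.1 (Finset.mem_filter.1 ht).1))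
    hlegit.card_first
  obtain ⟨Z, hZ⟩ := exists_sieve_eq_one (R := R) (I := secondIdx V₁ k (extend p))
    ((injOn_edges hP).mono fun t ht => Finset.mem_range.1 (Finset.mem_filter.1 ht).1)
    hlegit.card_second
  refine ⟨fun e => if ∃ u < k, e = s(extend p u, extend p (u + 1)) then 1 else 0, Y, Z, ?_⟩
  rw [phi_eq_sum_simple, Finset.sum_eq_single_of_mem p (Finset.mem_filter.2 ⟨hp, hinj⟩)]
  · rw [sieveWeight, hY, hZ, mul_one, mul_one]
    exact Finset.prod_eq_one fun t ht => if_pos ⟨t, Finset.mem_range.1 ht, rfl⟩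
  · intro q hq hne
    obtain ⟨hq, hqinj⟩ := Finset.mem_filter.1 hq
    obtain ⟨t, ht, hedge⟩ : ∃ t < k, ¬ ∃ u < k,
        s(extend q t, extend q (t + 1)) = s(extend p u, extend p (u + 1)) := by
      by_contra! hall
      refine hne (funext fun t => ?_)
      rw [← extend_val p t, ← extend_val q t]
      exact (eqOn_of_edges_subset hP (injOn_extend hqinj)
        (by rw [hlegit.start, (mem_legitWalks.1 hq).start]) hall (Nat.le_of_lt_succ t.2)).symm
    rw [sieveWeight, Finset.prod_eq_zero (Finset.mem_range.2 ht) (if_neg hedge), zero_mul,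
      zero_mul]

/-- The coordinates of the points `(x, Y, Z)`. -/
abbrev Coord (n r s : ℕ) : Type := Sym2 (Fin n) ⊕ (Fin r × Fin n) ⊕ (Fin s × Sym2 (Fin n))

/-- The value of `φ f` at a point given by a single coordinate vector. -/
noncomputable def phiAt (G : SimpleGraph (Fin n)) (V₁ : Fin n → Bool) (v₀ : Fin n) (k : ℕ)
    (a : Coord n r s → R) : R :=
  phi G V₁ v₀ k (fun e => a (.inl e)) (fun i v => a (.inr (.inl (i, v))))
    (fun j e => a (.inr (.inr (j, e))))

/-- The polynomial `φ f`, obtained by evaluating `φ f` at the indeterminates. -/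
noncomputable def phiPoly (R : Type) [CommSemiring R] (G : SimpleGraph (Fin n))
    (V₁ : Fin n → Bool) (v₀ : Fin n) (k r s : ℕ) : MvPolynomial (Coord n r s) R :=
  phiAt G V₁ v₀ k .X

theorem eval_phiPoly (a : Coord n r s → R) :
    (phiPoly R G V₁ v₀ k r s).eval a = phiAt G V₁ v₀ k a := by
  rw [phiPoly, phiAt, map_phi]
  simp only [MvPolynomial.eval_X, phiAt]

theorem totalDegree_prod_le_card {ι σ R : Type*} [CommSemiring R] (I : Finset ι)
    {g : ι → MvPolynomial σ R} (hg : ∀ i ∈ I, (g i).totalDegree ≤ 1) :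
    (∏ i ∈ I, g i).totalDegree ≤ I.card :=
  (MvPolynomial.totalDegree_finsetProd I g).trans <|
    (Finset.sum_le_card_nsmul I _ 1 hg).trans_eq (by rw [smul_eq_mul, mul_one])

theorem totalDegree_phiPoly_le [Nontrivial R] :
    (phiPoly R G V₁ v₀ k r s).totalDegree ≤ k + r + s := by
  refine MvPolynomial.totalDegree_finsetSum_le fun S _ =>
    MvPolynomial.totalDegree_finsetSum_le fun T _ =>
    MvPolynomial.totalDegree_finsetSum_le fun p hp => ?_
  have hlegit := mem_legitWalks.1 hp
  refine (MvPolynomial.totalDegree_mul _ _).trans (add_le_add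
    ((MvPolynomial.totalDegree_mul _ _).trans (add_le_add ?_ ?_)) ?_)
  · refine (totalDegree_prod_le_card _ fun t _ => ?_).trans_eq (Finset.card_range k)
    exact (MvPolynomial.totalDegree_X _).le
  · refine (totalDegree_prod_le_card _ fun t _ => ?_).trans_eq hlegit.card_first
    exact MvPolynomial.totalDegree_finsetSum_le fun i _ => (MvPolynomial.totalDegree_X _).le
  · refine (totalDegree_prod_le_card _ fun t _ => ?_).trans_eq hlegit.card_second
    exact MvPolynomial.totalDegree_finsetSum_le fun i _ => (MvPolynomial.totalDegree_X _).le

end PhiPoly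

section SchwartzZippel

open Finset MvPolynomial

theorem card_zeros_mul_card_le {σ F : Type*} [Fintype σ] [DecidableEq σ] [CommRing F] [IsDomain F]
    [Fintype F] [DecidableEq F] {P : MvPolynomial σ F} (hP : P ≠ 0) :
    #{a : σ → F | P.eval a = 0} * Fintype.card F ≤
      P.totalDegree * Fintype.card F ^ Fintype.card σ := by
  let e := Fintype.equivFin σ
  have hren : rename e P ≠ 0 := (map_ne_zero_iff _ (rename_injective e e.injective)).2 hP
  have hcard : #{a : σ → F | P.eval a = 0} =
      #{b : Fin (Fintype.card σ) → F | (rename e P).eval b = 0} :=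
    card_equiv (e.arrowCongr (Equiv.refl F)) fun a => by
      simp only [mem_filter, mem_univ, true_and, eval_rename, Equiv.arrowCongr, Equiv.coe_fn_mk,
        Equiv.coe_refl, Function.id_comp, Function.comp_assoc, Equiv.symm_comp_self,
        Function.comp_id]
  have hSZ := schwartz_zippel_totalDegree hren univ
  have hpos : (0 : ℚ≥0) < Fintype.card F := by exact_mod_cast Fintype.card_pos
  rw [Fintype.piFinset_univ, card_univ, div_le_div_iff₀ (by positivity) hpos, ← hcard] at hSZ
  refine le_trans (b := (rename e P).totalDegree * Fintype.card F ^ Fintype.card σ)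
    (by exact_mod_cast hSZ) ?_
  gcongr
  exact totalDegree_rename_le _ _

theorem card_phiAt_zeros_mul_card_le {n : ℕ} {F : Type} [CommRing F] [IsDomain F] [Fintype F]
    [DecidableEq F] [CharP F 2] {G : SimpleGraph (Fin n)} {V₁ : Fin n → Bool} {v₀ : Fin n}
    {k r s : ℕ} {p : Fin (k + 1) → Fin n} (hp : p ∈ legitWalks G V₁ v₀ k r s)
    (hinj : Function.Injective p) :
    #{a : Coord n r s → F | phiAt G V₁ v₀ k a = 0} * Fintype.card F ≤
      (k + r + s) * Fintype.card F ^ Fintype.card (Coord n r s) := by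
  have hne : phiPoly F G V₁ v₀ k r s ≠ 0 := by
    obtain ⟨x, Y, Z, hone⟩ := exists_phi_eq_one (R := F) hp hinj
    intro hzero
    have hval := eval_phiPoly (G := G) (V₁ := V₁) (v₀ := v₀) (k := k)
      (Sum.elim x (Sum.elim (fun i => Y i.1 i.2) fun j => Z j.1 j.2))
    rw [hzero, map_zero] at hval
    exact zero_ne_one (hval.trans hone)
  have hSZ := card_zeros_mul_card_le hne
  simp only [eval_phiPoly] at hSZ
  refine hSZ.trans ?_
  gcongr
  exact totalDegree_phiPoly_le

end SchwartzZippel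

section Test

open Prog

variable {n m : ℕ} {G : SimpleGraph (Fin n)} {V₁ : Fin n → Bool} {v₀ : Fin n} {k r s : ℕ}

theorem sum_sublists {M α : Type*} [AddCommMonoid M] [DecidableEq α] {l : List α} (hl : l.Nodup)
    (H : Finset α → M) :
    (l.sublists.map fun L => H L.toFinset).sum = ∑ S ∈ l.toFinset.powerset, H S := by
  induction l generalizing H with
  | nil => simp
  | cons a l ih =>
    obtain ⟨ha, hl⟩ := List.nodup_cons.1 hl
    rw [((List.sublists_cons_perm_append a l).map _).sum_eq, List.map_append, List.sum_append,
      List.map_map, ih hl, List.toFinset_cons, Finset.sum_powerset_insert (by simpa using ha),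
      ← ih hl fun S => H (insert a S)]
    simp [Function.comp_def]

theorem foldl_add_eq {M α : Type*} [AddMonoid M] (f : α → M) (l : List α) (c : M) :
    l.foldl (fun a i => a + f i) c = c + (l.map f).sum := by
  induction l generalizing c with
  | nil => simp
  | cons i l ih => simp [ih, add_assoc]

theorem ensures_fold_sublists {M : Type} [AddCommMonoid M] {q : ℕ} {H : Finset (Fin q) → M}
    {f : M → List (Fin q) → Prog n (GaloisField 2 m) M}
    (h : ∀ c L, L.Nodup → (f c L).Ensures G fun b => b = c + H L.toFinset) (c : M) :
    (fold (List.finRange q).sublists c f).Ensures G fun b => b = c + ∑ S, H S := by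
  refine (ensures_fold (g := fun c L => c + H L.toFinset) (fun c L hL => h c L ?_) c).mono
    fun b hb => ?_
  · exact (List.mem_sublists.1 hL).nodup (List.nodup_finRange q)
  · rw [hb, foldl_add_eq, sum_sublists (List.nodup_finRange q), List.toFinset_finRange,
      Finset.powerset_univ]

theorem ensures_sumArray {ι : Type} [DecidableEq ι] {q : ℕ} {l : List ι} (hl : ∀ i, i ∈ l)
    (Y : Fin q → ι → GaloisField 2 m) {L : List (Fin q)} (hL : L.Nodup) :
    (sumArray l Y L).Ensures G fun t => t = fun a => ∑ i ∈ L.toFinset, Y i a := by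
  refine (ensures_tabulate (Q := fun a b => b = ∑ i ∈ L.toFinset, Y i a) (fun a => ?_) l).mono
    fun t ht => funext fun a => ht a (hl a)
  refine (ensures_fold (g := fun c i => c + Y i a) (fun c i _ => ensures_fadd _ _) 0).mono
    fun b hb => ?_
  rw [hb, foldl_add_eq, zero_add, List.sum_toFinset _ hL]

theorem mem_pairs (e : Sym2 (Fin n)) : e ∈ pairs n :=
  List.mem_sym2_iff.2 fun v _ => List.mem_finRange v

theorem nodup_pairs : (pairs n).Nodup := (List.nodup_finRange n).sym2

/-- The part of `phiTest` that follows the choice of the random point. -/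
def phiTestAt {F : Type} [Zero F] (C : Circuit n) (x : Sym2 (Fin n) → F) (Y : Fin r → Fin n → F)
    (Z : Fin s → Sym2 (Fin n) → F) : Prog n F Bool := do
  let total ← fold (List.finRange s).sublists 0 fun acc S => do
    let z ← sumArray (pairs n) Z S
    fold (List.finRange r).sublists acc fun acc R => do
      let y ← sumArray (List.finRange n) Y R
      let a ← evalCircuit C (assign x y z)
      exec (.fadd acc a)
  let isZero ← exec (.fzero total)
  pure (!isZero)

theorem phiTest_eq {F : Type} [Zero F] (C : Circuit n) : phiTest (F := F) r s C =
    tabulate 0 (pairs n) (fun _ => exec .rand) >>= fun x =>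
    tabulate (fun _ => 0) (List.finRange r) (fun _ =>
      tabulate 0 (List.finRange n) fun _ => exec .rand) >>= fun Y =>
    tabulate (fun _ => 0) (List.finRange s) (fun _ =>
      tabulate 0 (pairs n) fun _ => exec .rand) >>= fun Z => phiTestAt C x Y Z := rfl

variable {C : Circuit n}

open Classical in
theorem ensures_phiTestAt
    (hC : ∀ ρ : Var n → GaloisField 2 m, Circuit.eval ρ (fun _ => 0) C .out =
      ∑ p ∈ legitWalks G V₁ v₀ k r s, weight V₁ ρ k (extend p))
    (x : Sym2 (Fin n) → GaloisField 2 m) (Y : Fin r → Fin n → GaloisField 2 m)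
    (Z : Fin s → Sym2 (Fin n) → GaloisField 2 m) :
    (phiTestAt C x Y Z).Ensures G fun b => b = decide (phi G V₁ v₀ k x Y Z ≠ 0) := by
  refine (ensures_fold_sublists (H := fun S : Finset (Fin s) => ∑ T : Finset (Fin r),
    ∑ p ∈ legitWalks G V₁ v₀ k r s,
      weight V₁ (assign x (fun v => ∑ i ∈ T, Y i v) (fun e => ∑ j ∈ S, Z j e)) k (extend p))
    (fun c S hS => (ensures_sumArray mem_pairs Z hS).bind fun z hz =>
      ensures_fold_sublists (fun c T hT => ?_) c) 0).bind fun total htotal =>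
        (ensures_fzero total).bind fun b hb => ensures_pure ?_
  · refine (ensures_sumArray List.mem_finRange Y hT).bind fun y hy =>
      (ensures_evalCircuit C).bind fun a ha => (ensures_fadd _ _).mono fun b hb => ?_
    rw [hb, ha, hC, hy, hz]
  · rw [hb, htotal, zero_add, ← phi, decide_not]

theorem dist_rand (a : GaloisField 2 m) :
    (exec (.rand : Instr n (GaloisField 2 m) _)).dist G a =
      (Nat.card (GaloisField 2 m) : ENNReal)⁻¹ := by
  let := Fintype.ofFinite (GaloisField 2 m)
  rw [dist_exec, Nat.card_eq_fintype_card]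
  exact PMF.uniformOfFintype_apply a

theorem sum_coord {F M : Type*} [Fintype F] [AddCommMonoid M] (H : (Coord n r s → F) → M) :
    ∑ x : Sym2 (Fin n) → F, ∑ Y : Fin r → Fin n → F, ∑ Z : Fin s → Sym2 (Fin n) → F,
      H (Sum.elim x (Sum.elim (fun i => Y i.1 i.2) fun j => Z j.1 j.2)) = ∑ a, H a := by
  let e : (Sym2 (Fin n) → F) × (Fin r → Fin n → F) × (Fin s → Sym2 (Fin n) → F) ≃
      (Coord n r s → F) :=
    (Equiv.prodCongr (Equiv.refl _) ((Equiv.prodCongr (Equiv.curry _ _ _).symm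
      (Equiv.curry _ _ _).symm).trans (Equiv.sumArrowEquivProdArrow _ _ _).symm)).trans
        (Equiv.sumArrowEquivProdArrow _ _ _).symm
  rw [← e.sum_comp]
  simp only [Fintype.sum_prod_type]
  rfl

open Classical in
theorem dist_phiTest_false [Fintype (GaloisField 2 m)]
    (hC : ∀ ρ : Var n → GaloisField 2 m, Circuit.eval ρ (fun _ => 0) C .out =
      ∑ p ∈ legitWalks G V₁ v₀ k r s, weight V₁ ρ k (extend p)) :
    (phiTest (F := GaloisField 2 m) r s C).dist G false =
      (Finset.card {a : Coord n r s → GaloisField 2 m | phiAt G V₁ v₀ k a = 0} : ENNReal) /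
        Fintype.card (GaloisField 2 m) ^ Fintype.card (Coord n r s) := by
  have hfalse (x : Sym2 (Fin n) → GaloisField 2 m) (Y : Fin r → Fin n → GaloisField 2 m)
      (Z : Fin s → Sym2 (Fin n) → GaloisField 2 m) : (phiTestAt C x Y Z).dist G false =
        if phiAt G V₁ v₀ k (Sum.elim x (Sum.elim (fun i => Y i.1 i.2) fun j => Z j.1 j.2)) = 0
          then 1 else 0 := by
    rw [(ensures_phiTestAt hC x Y Z).dist_eq_pure, PMF.pure_apply]
    by_cases h : phi G V₁ v₀ k x Y Z = 0
    · rw [h, decide_eq_false (not_not.2 rfl), if_pos rfl]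
      exact (if_pos h).symm
    · rw [decide_eq_true h, if_neg Bool.false_ne_true]
      exact (if_neg h).symm
  rw [phiTest_eq, Finset.card_filter, Nat.cast_sum, ← sum_coord]
  simp only [dist_bind, PMF.bind_apply, tsum_fintype, hfalse,
    dist_tabulate _ _ nodup_pairs mem_pairs,
    dist_tabulate _ _ (List.nodup_finRange _) List.mem_finRange, dist_rand,
    Finset.prod_const, Finset.card_univ, Fintype.card_fin, Nat.card_eq_fintype_card]
  simp only [← Finset.mul_sum, ← mul_assoc, Nat.cast_ite, Nat.cast_one, Nat.cast_zero]
  rw [div_eq_mul_inv, mul_comm, ENNReal.inv_pow]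
  simp only [Fintype.card_sum, Fintype.card_prod, Fintype.card_fin, ← pow_mul, ← pow_add,
    mul_comm, add_left_comm, add_assoc]

theorem dist_phiTest_false_le (hk : 4 * (k + r + s) ≤ Nat.card (GaloisField 2 m))
    (hC : ∀ ρ : Var n → GaloisField 2 m, Circuit.eval ρ (fun _ => 0) C .out =
      ∑ p ∈ legitWalks G V₁ v₀ k r s, weight V₁ ρ k (extend p))
    {p : Fin (k + 1) → Fin n} (hp : p ∈ legitWalks G V₁ v₀ k r s)
    (hinj : Function.Injective p) :
    (phiTest (F := GaloisField 2 m) r s C).dist G false ≤ 1 / 4 := by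
  classical
  let := Fintype.ofFinite (GaloisField 2 m)
  rw [dist_phiTest_false hC]
  have hzeros := card_phiAt_zeros_mul_card_le (F := GaloisField 2 m) hp hinj
  set z := Finset.card {a : Coord n r s → GaloisField 2 m | phiAt G V₁ v₀ k a = 0}
  rw [Nat.card_eq_fintype_card] at hk
  set q := Fintype.card (GaloisField 2 m)
  have hq : 0 < q := Fintype.card_pos
  have hle : z * 4 ≤ q ^ Fintype.card (Coord n r s) := by
    refine Nat.le_of_mul_le_mul_right ?_ hq
    nlinarith [Nat.zero_le (q ^ Fintype.card (Coord n r s))]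
  rw [ENNReal.div_le_iff (by positivity) (by finiteness), one_div, ← ENNReal.div_eq_inv_mul,
    ENNReal.le_div_iff_mul_le (by simp) (by simp)]
  exact_mod_cast hle

end Test

/-! ## Partitions for which a given path is legitimate -/

section Patterns

variable {k r s : ℕ}

/-- The ways in which the vertices of a simple path of length `k` can be distributed over `V₁`
(`true`) and `V₂` (`false`) such that the path becomes `(r, s)`-legitimate. -/
def patterns (k r s : ℕ) : Finset (Fin (k + 1) → Bool) :=
  {b | extend b 0 = true ∧ (firstIdx id k (extend b)).card = r ∧
    (secondIdx id k (extend b)).card = s}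

/-- The number of patterns whose last entry is `c`. -/
def patternCount (k r s : ℕ) (c : Bool) : ℕ :=
  Finset.card {b ∈ patterns k r s | extend b k = c}

theorem card_patterns (k r s : ℕ) :
    (patterns k r s).card = patternCount k r s true + patternCount k r s false := by
  rw [patternCount, patternCount,
    ← Finset.card_filter_add_card_filter_not (s := patterns k r s) (fun b => extend b k = true)]
  simp only [Bool.not_eq_true]

theorem snoc_mem_patterns_iff {b : Fin (k + 1) → Bool} {c : Bool} :
    Fin.snoc b c ∈ patterns (k + 1) (r + if c then 1 else 0)
        (s + if extend b k = false ∧ c = false then 1 else 0) ↔ b ∈ patterns k r s := by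
  have hle : ∀ t ≤ k, extend (Fin.snoc b c : Fin (k + 1 + 1) → Bool) t = extend b t :=
    fun t ht => extend_snoc_of_le b c ht
  simp only [patterns, Finset.mem_filter_univ, card_firstIdx_succ, card_secondIdx_succ,
    firstIdx_congr hle, secondIdx_congr hle, hle 0 k.zero_le, hle k le_rfl, extend_snoc_last, id,
    add_left_inj]

theorem patternCount_succ (k r s : ℕ) (c : Bool) : patternCount (k + 1) r s c =
    Finset.card {b : Fin (k + 1) → Bool | Fin.snoc b c ∈ patterns (k + 1) r s} := by
  symm
  refine Finset.card_bij (fun b _ => Fin.snoc b c)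
    (fun b hb => Finset.mem_filter.2 ⟨(Finset.mem_filter.1 hb).2, extend_snoc_last b c⟩)
    (fun b _ b' _ h => (Fin.snoc_injective2 h).1) fun b hb => ?_
  obtain ⟨hb, hlast⟩ := Finset.mem_filter.1 hb
  have hsnoc : (Fin.snoc (Fin.init b) c : Fin (k + 1 + 1) → Bool) = b := by
    rw [← hlast, show extend b (k + 1) = b (Fin.last (k + 1)) from extend_val b (Fin.last (k + 1)),
      Fin.snoc_init_self]
  exact ⟨Fin.init b, Finset.mem_filter.2 ⟨Finset.mem_univ _, by rwa [hsnoc]⟩, hsnoc⟩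

theorem patternCount_succ_true (k r s : ℕ) :
    patternCount (k + 1) (r + 1) s true = patternCount k r s true + patternCount k r s false := by
  rw [patternCount_succ, ← card_patterns]
  congr 1
  ext b
  rw [Finset.mem_filter_univ, ← snoc_mem_patterns_iff (b := b) (c := true)]
  simp

theorem patternCount_le_succ_false (k r s : ℕ) :
    patternCount k r s true ≤ patternCount (k + 1) r s false := by
  rw [patternCount_succ]
  refine Finset.card_le_card fun b hb => ?_
  obtain ⟨hb, hlast⟩ := Finset.mem_filter.1 hb
  rw [Finset.mem_filter_univ]
  simpa [hlast] using snoc_mem_patterns_iff (c := false).2 hb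

theorem patternCount_succ_false (k r s : ℕ) : patternCount (k + 1) r (s + 1) false =
    patternCount k r (s + 1) true + patternCount k r s false := by
  rw [patternCount_succ, ← Finset.card_filter_add_card_filter_not (fun b => extend b k = true),
    Finset.filter_filter, Finset.filter_filter, patternCount, patternCount]
  congr 2 <;> ext b <;> cases hlast : extend b k
  all_goals
    simp only [Finset.mem_filter, Finset.mem_univ, true_and, hlast, and_true, and_false, not_true,
      not_false_eq_true, Bool.false_eq_true, Bool.true_eq_false]
  · simpa [hlast] using snoc_mem_patterns_iff (b := b) (c := false) (r := r) (s := s + 1)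
  · simpa [hlast] using snoc_mem_patterns_iff (b := b) (c := false) (r := r) (s := s)

/-- The blocks of consecutive entries `false`, all but possibly the last one followed by `true`,
are placed among the `a + 1` entries `true` in one factor and given their lengths in the other. -/
theorem le_patternCount (k a l s : ℕ) (h : a + l + s = k) :
    a.choose l * (l + s - 1).choose s ≤ patternCount k (a + 1) s true ∧
      ∀ l', l = l' + 1 → a.choose l' * (l' + s).choose s ≤ patternCount k (a + 1) s false := by
  induction k generalizing a l s with
  | zero =>
    obtain ⟨rfl, rfl, rfl⟩ : a = 0 ∧ l = 0 ∧ s = 0 := by omega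
    exact ⟨by decide, fun l' h => by omega⟩
  | succ k ih =>
    refine ⟨?_, ?_⟩
    · obtain _ | a := a
      · obtain _ | l := l
        · rw [Nat.choose_eq_zero_of_lt (n := 0 + s - 1) (by omega), mul_zero]
          exact Nat.zero_le _
        · simp
      · rw [patternCount_succ_true]
        obtain _ | l := l
        · have htrue := (ih a 0 s (by omega)).1
          simp only [Nat.choose_zero_right] at htrue ⊢
          exact htrue.trans (Nat.le_add_right _ _)
        · have htrue := (ih a (l + 1) s (by omega)).1
          have hfalse := (ih a (l + 1) s (by omega)).2 l rfl
          rw [show l + 1 + s - 1 = l + s by omega] at htrue ⊢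
          rw [Nat.choose_succ_succ]
          linarith
    · rintro l rfl
      have htrue := (ih a l s (by omega)).1
      obtain _ | s := s
      · simpa using htrue.trans (patternCount_le_succ_false _ _ _)
      · have hfalse := (ih a (l + 1) s (by omega)).2 l rfl
        rw [patternCount_succ_false, ← add_assoc, Nat.choose_succ_succ]
        rw [show l + (s + 1) - 1 = l + s by omega] at htrue
        linarith

theorem Admissible.le_card_patterns (h : Admissible k r s) :
    r.choose (k + 1 - r - s) * (k - r).choose s ≤ (patterns k r s).card := by
  obtain ⟨hle, hfirst, hsecond⟩ := h
  rw [Nat.choose_ne_zero_iff] at hfirst hsecond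
  rw [card_patterns]
  obtain ⟨a, rfl⟩ : ∃ a, r = a + 1 := ⟨r - 1, by omega⟩
  obtain ⟨l, rfl⟩ : ∃ l, k = a + l + s := ⟨k - a - s, by omega⟩
  obtain ⟨htrue, hfalse⟩ := le_patternCount _ a l s rfl
  rw [show a + l + s + 1 - (a + 1) - s = l by omega,
    show a + l + s - (a + 1) = l + s - 1 by omega]
  obtain _ | l := l
  · simp only [Nat.choose_zero_right] at htrue ⊢
    exact htrue.trans (Nat.le_add_right _ _)
  · have hfalse := hfalse l rfl
    rw [show l + 1 + s - 1 = l + s by omega] at htrue ⊢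
    rw [Nat.choose_succ_succ]
    linarith

theorem Admissible.mul_choose_le (h : Admissible k r s) :
    r.choose (k + 1 - r - s) * (k - r).choose s ≤ 2 ^ k := by
  obtain ⟨hle, hfirst, hsecond⟩ := h
  rcases Nat.lt_or_ge k r with hr | hr
  · obtain ⟨rfl, rfl⟩ : r = k + 1 ∧ s = 0 := by omega
    simpa using Nat.one_le_two_pow
  · calc _ ≤ 2 ^ r * 2 ^ (k - r) :=
          Nat.mul_le_mul (Nat.choose_le_two_pow _ _) (Nat.choose_le_two_pow _ _)
      _ = 2 ^ k := by rw [← pow_add, Nat.add_sub_cancel' hr]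

theorem Admissible.mul_choose_pos (h : Admissible k r s) :
    0 < r.choose (k + 1 - r - s) * (k - r).choose s :=
  Nat.mul_pos (Nat.pos_of_ne_zero h.2.1) (Nat.pos_of_ne_zero h.2.2)

open Finset in
theorem card_filter_comp_mem {α β ι : Type*} [Fintype α] [Fintype β] [Fintype ι] [DecidableEq α]
    [DecidableEq (ι → β)] {f : ι → α} (hf : Function.Injective f) (A : Finset (ι → β)) :
    #{g : α → β | g ∘ f ∈ A} = #A * Fintype.card β ^ (Fintype.card α - Fintype.card ι) := by
  classical
  let e := (Equiv.piEquivPiSubtypeProd (· ∈ Set.range f) fun _ => β).trans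
    (((Equiv.ofInjective f hf).symm.arrowCongr (Equiv.refl β)).prodCongr (Equiv.refl _))
  have he (g : α → β) : (e g).1 = g ∘ f := rfl
  rw [card_equiv (t := A ×ˢ univ) e fun g => by simp [he], card_product, card_univ,
    Fintype.card_fun, Fintype.card_subtype_compl,
    ← Fintype.card_congr (Equiv.ofInjective f hf)]

end Patterns

section SimplePaths

variable {n k r s : ℕ} {G : SimpleGraph (Fin n)}

theorem hasSimplePath_iff : HasSimplePath G k ↔ ∃ p : Fin (k + 1) → Fin n, Function.Injective p ∧
    ∀ t < k, G.Adj (extend p t) (extend p (t + 1)) := by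
  constructor
  · rintro ⟨u, v, w, hw, rfl⟩
    refine ⟨fun t => w.getVert t, fun a b hab => ?_, fun t ht => ?_⟩
    · exact Fin.ext (hw.getVert_injOn (Set.mem_ofPred.2 (by omega))
        (Set.mem_ofPred.2 (by omega)) hab)
    · rw [extend_restrict w.getVert (by omega), extend_restrict w.getVert (by omega)]
      exact w.adj_getVert_succ ht
  · rintro ⟨p, hinj, hadj⟩
    have hne : List.ofFn p ≠ [] := by simp
    have hchain : (List.ofFn p).IsChain G.Adj := List.isChain_ofFn.2 fun t ht => by
      have hstep := hadj t (by omega)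
      rwa [extend_val p ⟨t, by omega⟩, extend_val p ⟨t + 1, ht⟩] at hstep
    refine ⟨_, _, .ofSupport _ hne hchain, ?_, ?_⟩
    · rw [SimpleGraph.Walk.isPath_def, SimpleGraph.Walk.support_ofSupport]
      exact List.nodup_ofFn_ofInjective hinj
    · rw [← Nat.add_right_cancel_iff (n := 1), ← SimpleGraph.Walk.length_support,
        SimpleGraph.Walk.support_ofSupport, List.length_ofFn]

theorem mem_legitWalks_of_comp_mem_patterns {p : Fin (k + 1) → Fin n}
    (hinj : Function.Injective p) (hadj : ∀ t < k, G.Adj (extend p t) (extend p (t + 1)))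
    {V₁ : Fin n → Bool} (h : V₁ ∘ p ∈ patterns k r s) : p ∈ legitWalks G V₁ (p 0) k r s := by
  obtain ⟨-, hr, hs⟩ := (Finset.mem_filter_univ _).1 h
  refine mem_legitWalks.2 ⟨rfl, hadj, hr, hs, fun t ht he => ?_⟩
  have := injOn_extend hinj (Set.mem_Iic.2 ht) (Set.mem_Iic.2 (by omega)) he
  omega

end SimplePaths

/-! ## The probability of success -/

section Success

open Prog

variable {n m k r s : ℕ} {G : SimpleGraph (Fin n)}

/-- The random choice of a partition in `trial`, whose part `V₁` contains `v₀`. -/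
def partition {F : Type} (v₀ : Fin n) : Prog n F (Fin n → Bool) :=
  tabulate true (List.finRange n) fun v => if v = v₀ then pure true else exec .coin

theorem ensures_partition (v₀ : Fin n) :
    (partition v₀).Ensures (m := m) G fun V₁ => V₁ v₀ = true := by
  refine (ensures_tabulate (Q := fun v b => v = v₀ → b = true) (fun v => ?_) _).mono fun t ht =>
    ht v₀ (List.mem_finRange _) rfl
  split_ifs with h
  · exact ensures_pure fun _ => rfl
  · exact (ensures_true _).mono fun _ _ h' => absurd h' h

theorem dist_partition {v₀ : Fin n} {V₁ : Fin n → Bool} (h : V₁ v₀ = true) :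
    (partition (F := GaloisField 2 m) v₀).dist G V₁ = 2⁻¹ ^ (n - 1) := by
  have hcoin : ∀ v ∈ Finset.univ.erase v₀, (if v = v₀ then (pure true :
      Prog n (GaloisField 2 m) Bool) else exec .coin).dist G (V₁ v) = 2⁻¹ := fun v hv => by
    rw [if_neg (Finset.mem_erase.1 hv).1, dist_exec]
    exact (PMF.uniformOfFintype_apply _).trans (by simp)
  rw [partition, dist_tabulate _ _ (List.nodup_finRange _) List.mem_finRange,
    ← Finset.mul_prod_erase _ _ (Finset.mem_univ v₀), Finset.prod_congr rfl hcoin, if_pos rfl,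
    dist_pure, h, PMF.pure_apply_self, one_mul, Finset.prod_const,
    Finset.card_erase_of_mem (Finset.mem_univ _), Finset.card_univ, Fintype.card_fin]

theorem ensures_phiTest_false {V₁ : Fin n → Bool} {v₀ : Fin n} {C : Circuit n}
    (h : ¬ HasSimplePath G k)
    (hC : ∀ ρ : Var n → GaloisField 2 m, Circuit.eval ρ (fun _ => 0) C .out =
      ∑ p ∈ legitWalks G V₁ v₀ k r s, weight V₁ ρ k (extend p)) :
    (phiTest (F := GaloisField 2 m) r s C).Ensures G fun b => b = false := by
  rw [phiTest_eq]
  refine (ensures_true _).bind fun x _ => (ensures_true _).bind fun Y _ =>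
    (ensures_true _).bind fun Z _ => (ensures_phiTestAt hC x Y Z).mono fun b hb => ?_
  have hphi : phi G V₁ v₀ k x Y Z = 0 := by
    rw [phi_eq_sum_simple]
    refine Finset.sum_eq_zero fun p hp => absurd ?_ h
    obtain ⟨hlegit, hinj⟩ := Finset.mem_filter.1 hp
    exact hasSimplePath_iff.2 ⟨p, hinj, (mem_legitWalks.1 hlegit).adj⟩
  simpa [hphi] using hb

theorem ensures_trial_false (hk : 1 ≤ k) (h : ¬ HasSimplePath G k) (v₀ : Fin n) :
    (trial (F := GaloisField 2 m) k r s v₀).Ensures G fun b => b = false :=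
  (ensures_partition v₀).bind fun _ hv => (ensures_buildCircuit hv hk).bind fun _ hC =>
    ensures_phiTest_false h hC

theorem ensures_hamiltonian_false (hk : 1 ≤ k) (h : ¬ HasSimplePath G k) :
    (hamiltonian (F := GaloisField 2 m) n k r s).Ensures G fun b => b = false :=
  (ensures_true _).bind fun _ _ => (ensures_true _).bind fun _ _ =>
    ensures_anyOf_false (fun v₀ => ensures_anyOf_false (fun _ => ensures_trial_false hk h v₀) _) _

theorem apply_true_add_apply_false (p : PMF Bool) : p true + p false = 1 := by
  rw [add_comm, ← p.tsum_coe, tsum_bool]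

theorem one_sub_le_apply_true {p : PMF Bool} {ε : ENNReal} (h : p false ≤ ε) :
    1 - ε ≤ p true := by
  rw [tsub_le_iff_right, ← apply_true_add_apply_false p]
  gcongr

theorem three_quarters_le_dist_circuitTest (hk : 1 ≤ k)
    (hm : 4 * (k + r + s) ≤ Nat.card (GaloisField 2 m)) {p : Fin (k + 1) → Fin n}
    (hinj : Function.Injective p) (hadj : ∀ t < k, G.Adj (extend p t) (extend p (t + 1)))
    {V₁ : Fin n → Bool} (hV₁ : V₁ ∘ p ∈ patterns k r s) :
    3 / 4 ≤ (buildCircuit (F := GaloisField 2 m) k r s (p 0) V₁ >>= phiTest r s).dist G true := by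
  have hstart : V₁ (p 0) = true := ((Finset.mem_filter_univ _).1 hV₁).1
  refine le_dist_bind (ensures_buildCircuit hstart hk) fun C hC => ?_
  have hquarter : (1 : ENNReal) - 1 / 4 = 3 / 4 := by
    rw [← ENNReal.toReal_eq_toReal_iff' (by finiteness) (by finiteness), ENNReal.toReal_sub_of_le]
      <;> norm_num
  rw [← hquarter]
  exact one_sub_le_apply_true
    (dist_phiTest_false_le hm hC (mem_legitWalks_of_comp_mem_patterns hinj hadj hV₁) hinj)

theorem card_mul_le_dist_bind {α β : Type} {p : Prog n (GaloisField 2 m) α}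
    {f : α → Prog n (GaloisField 2 m) β} {A : Finset α} {b : β} {c d : ENNReal}
    (hc : ∀ a ∈ A, c ≤ p.dist G a) (hd : ∀ a ∈ A, d ≤ (f a).dist G b) :
    A.card * (c * d) ≤ (p >>= f).dist G b := by
  rw [dist_bind, PMF.bind_apply, ← nsmul_eq_mul]
  exact (Finset.card_nsmul_le_sum A _ _ fun a ha => mul_le_mul' (hc a ha) (hd a ha)).trans
    (ENNReal.sum_le_tsum A)

theorem le_dist_trial (hk : 1 ≤ k) (hm : 4 * (k + r + s) ≤ Nat.card (GaloisField 2 m))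
    {p : Fin (k + 1) → Fin n} (hinj : Function.Injective p)
    (hadj : ∀ t < k, G.Adj (extend p t) (extend p (t + 1))) (hA : Admissible k r s) :
    ((r.choose (k + 1 - r - s) * (k - r).choose s : ℕ) : ENNReal) * 2⁻¹ ^ k * (3 / 4) ≤
      (trial (F := GaloisField 2 m) k r s (p 0)).dist G true := by
  set B := r.choose (k + 1 - r - s) * (k - r).choose s
  set good : Finset (Fin n → Bool) := {V₁ | V₁ ∘ p ∈ patterns k r s}
  have hgood {V₁ : Fin n → Bool} : V₁ ∈ good ↔ V₁ ∘ p ∈ patterns k r s := by simp [good]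
  obtain ⟨e, rfl⟩ : ∃ e, n = k + 1 + e :=
    Nat.exists_eq_add_of_le (by simpa using Fintype.card_le_of_injective p hinj)
  have hcard : B * 2 ^ e ≤ good.card := by
    rw [card_filter_comp_mem hinj]
    simpa using Nat.mul_le_mul_right (2 ^ e) hA.le_card_patterns
  calc (B : ENNReal) * 2⁻¹ ^ k * (3 / 4)
      = (B * 2 ^ e : ℕ) * (2⁻¹ ^ (k + e) * (3 / 4)) := by
        have hcancel : (2 : ENNReal) ^ e * 2⁻¹ ^ e = 1 := by
          rw [← mul_pow, ENNReal.mul_inv_cancel two_ne_zero ENNReal.ofNat_ne_top, one_pow]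
        calc (B : ENNReal) * 2⁻¹ ^ k * (3 / 4) = B * 2⁻¹ ^ k * (3 / 4) * (2 ^ e * 2⁻¹ ^ e) := by
              rw [hcancel, mul_one]
          _ = _ := by push_cast; ring
    _ ≤ good.card * (2⁻¹ ^ (k + e) * (3 / 4)) := by gcongr
    _ ≤ _ := by
        refine card_mul_le_dist_bind (p := partition (p 0)) (fun V₁ hV₁ => ?_) fun V₁ hV₁ => ?_
        · have hstart : V₁ (p 0) = true := ((Finset.mem_filter_univ _).1 (hgood.1 hV₁)).1
          rw [dist_partition hstart, Nat.add_right_comm, Nat.add_sub_cancel]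
        · exact three_quarters_le_dist_circuitTest hk hm hinj hadj (hgood.1 hV₁)

theorem ensures_powTwo_step (i : ℕ) :
    (exec (.arith .mul 2 (2 ^ i))).Ensures (m := m) G fun a => a = 2 ^ (i + 1) :=
  (ensures_arith _ _ _).mono fun _ ha => ha.trans (pow_succ' 2 i).symm

theorem ensures_powTwo (e : ℕ) : (powTwo e).Ensures (m := m) G fun a => a = 2 ^ e := by
  simpa only [powTwo, pow_zero] using
    ensures_fold_range (f := fun a _ => exec (.arith .mul 2 a)) (v := (2 ^ ·))
      fun i (_ : i < e) => ensures_powTwo_step i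

theorem ensures_binomial_step (a i : ℕ) : (do
    let d ← exec (.arith .sub a i)
    let p ← exec (.arith .mul (a.choose i) d)
    let i' ← exec (.arith .add i 1)
    exec (.arith .div p i')).Ensures (m := m) G fun c => c = a.choose (i + 1) := by
  refine (ensures_arith _ _ _).bind fun d hd => (ensures_arith _ _ _).bind fun p hp =>
    (ensures_arith _ _ _).bind fun i' hi => (ensures_arith _ _ _).mono fun c hc => ?_
  rw [hc, hi, hp, hd]
  simp only [ArithOp.eval]
  rw [← Nat.choose_succ_right_eq, Nat.mul_div_cancel _ i.succ_pos]

theorem ensures_binomial (a b : ℕ) :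
    (binomial a b).Ensures (m := m) G fun c => c = a.choose b := by
  simpa only [binomial, Nat.choose_zero_right] using
    ensures_fold_range (v := a.choose) fun i (_ : i < b) => ensures_binomial_step a i

theorem ensures_rounds (k r s : ℕ) : (rounds k r s).Ensures (m := m) G fun T =>
    T = 2 ^ (k + 1) / (r.choose (k + 1 - r - s) * (k - r).choose s) := by
  refine (ensures_arith _ _ _).bind fun k' hk' => (ensures_powTwo _).bind fun p hp =>
    (ensures_arith _ _ _).bind fun d hd => (ensures_arith _ _ _).bind fun t ht =>
    (ensures_binomial _ _).bind fun b₁ hb₁ => (ensures_arith _ _ _).bind fun d' hd' =>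
    (ensures_binomial _ _).bind fun b₂ hb₂ => (ensures_arith _ _ _).bind fun b hb =>
    (ensures_arith _ _ _).mono fun T hT => ?_
  subst hT hb hb₂ hd' hb₁ ht hd hp hk'
  rfl

theorem dist_search_false_le {f : Fin n → Prog n (GaloisField 2 m) Bool} (v : Fin n) (T : ℕ) :
    (anyOf (List.finRange n) fun v => anyOf (List.range T) fun _ => f v).dist G false ≤
      (f v).dist G false ^ T := by
  simp only [dist_anyOf_false, List.map_const', List.prod_replicate, List.length_range]
  rw [← Fin.prod_univ_def, ← Finset.mul_prod_erase _ _ (Finset.mem_univ v)]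
  exact mul_le_of_le_one_right zero_le
    (Finset.prod_le_one' fun v _ => pow_le_one' (PMF.coe_le_one _ _) _)

theorem one_sub_pow_le_half {x : ℝ} (hx : x ≤ 1) {T : ℕ} (hT : 3 / 4 ≤ x * T) :
    (1 - x) ^ T ≤ 1 / 2 := by
  have htwo : 2 ≤ Real.exp (x * T) := by
    have := Real.quadratic_le_exp_of_nonneg (x := x * T) (by linarith)
    nlinarith
  calc (1 - x) ^ T ≤ Real.exp (-x) ^ T :=
        pow_le_pow_left₀ (by linarith) (Real.one_sub_le_exp_neg x) T
    _ = (Real.exp (x * T))⁻¹ := by rw [← Real.exp_nat_mul, ← Real.exp_neg]; congr 1; ring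
    _ ≤ 1 / 2 := by rw [one_div]; exact inv_anti₀ two_pos htwo

theorem apply_false_pow_le_half {D : PMF Bool} {T : ℕ} (hT : 3 / 4 ≤ (D true).toReal * T) :
    D false ^ T ≤ 2⁻¹ := by
  have hfalse : (D false).toReal = 1 - (D true).toReal := by
    rw [eq_sub_iff_add_eq', ← ENNReal.toReal_add (D.apply_ne_top _) (D.apply_ne_top _),
      apply_true_add_apply_false, ENNReal.toReal_one]
  have hle : (D true).toReal ≤ 1 := by
    linarith [ENNReal.toReal_nonneg (a := D false)]
  rw [← ENNReal.toReal_le_toReal (ENNReal.pow_ne_top (D.apply_ne_top _)) (by finiteness),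
    ENNReal.toReal_pow, hfalse]
  simpa using one_sub_pow_le_half hle hT

theorem Admissible.two_pow_le_mul_div (hA : Admissible k r s) :
    2 ^ k ≤ r.choose (k + 1 - r - s) * (k - r).choose s *
      (2 ^ (k + 1) / (r.choose (k + 1 - r - s) * (k - r).choose s)) := by
  have hlt := Nat.lt_mul_div_succ (2 ^ (k + 1)) hA.mul_choose_pos
  have hle := hA.mul_choose_le
  rw [mul_add, mul_one] at hlt
  rw [pow_succ] at hlt ⊢
  omega

theorem half_le_dist_hamiltonian (hk : 1 ≤ k)
    (hm : 4 * (k + r + s) ≤ Nat.card (GaloisField 2 m)) (h : HasSimplePath G k)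
    (hA : Admissible k r s) :
    1 / 2 ≤ (hamiltonian (F := GaloisField 2 m) n k r s).dist G true := by
  obtain ⟨p, hinj, hadj⟩ := hasSimplePath_iff.1 h
  refine le_dist_bind (ensures_true _) fun _ _ => le_dist_bind (ensures_rounds k r s) fun T hT => ?_
  rw [one_div, ← ENNReal.one_sub_inv_two]
  refine one_sub_le_apply_true ((dist_search_false_le (p 0) T).trans (apply_false_pow_le_half ?_))
  have htrial := ENNReal.toReal_mono (PMF.apply_ne_top _ _) (le_dist_trial hk hm hinj hadj hA)
  have hrounds := hA.two_pow_le_mul_div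
  rw [← hT] at hrounds
  set B := r.choose (k + 1 - r - s) * (k - r).choose s
  calc (3 / 4 : ℝ) = 2 ^ k * 2⁻¹ ^ k * (3 / 4) := by rw [← mul_pow]; norm_num
    _ ≤ (B * T : ℕ) * 2⁻¹ ^ k * (3 / 4) := by gcongr; exact_mod_cast hrounds
    _ = B * 2⁻¹ ^ k * (3 / 4) * T := by push_cast; ring
    _ ≤ _ := by gcongr; simpa using htrial

theorem le_card_galoisField_fieldBits (k : ℕ) :
    4 * (2 * k + 1) ≤ Nat.card (GaloisField 2 (fieldBits k)) := by
  have hne : fieldBits k ≠ 0 := fun h => by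
    have := Nat.size_eq_zero.1 h
    omega
  rw [GaloisField.card 2 _ hne]
  exact (Nat.lt_size_self _).le

theorem half_le_answerProb (hk : 1 ≤ k) (hA : Admissible k r s) (h : HasSimplePath G k) :
    1 / 2 ≤ answerProb (runHamiltonian G k r s) true := by
  refine half_le_dist_hamiltonian hk ?_ h hA
  have := le_card_galoisField_fieldBits k
  have := hA.1
  omega

theorem answerProb_eq_one (hk : 1 ≤ k) (h : ¬ HasSimplePath G k) :
    answerProb (runHamiltonian G k r s) false = 1 := by
  change (hamiltonian n k r s).dist G false = 1
  rw [(ensures_hamiltonian_false hk h).dist_eq_pure, PMF.pure_apply_self]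

end Success

/-! ## Running time -/

section Time

open Prog

variable {n m k r s N W W' a b : ℕ} {G : SimpleGraph (Fin n)} {α β ι σ : Type}

theorem pow_add_pow_le_pow {c : ℕ} (hN : 2 ≤ N) (ha : a < c) (hb : b < c) :
    N ^ a + N ^ b ≤ N ^ c := by
  obtain ⟨d, rfl⟩ := Nat.exists_eq_add_of_lt (Nat.zero_lt_of_lt ha)
  rw [zero_add] at ha hb ⊢
  have hpos : 0 < N := by omega
  calc N ^ a + N ^ b ≤ N ^ d + N ^ d := Nat.add_le_add
        (Nat.pow_le_pow_right hpos (by omega)) (Nat.pow_le_pow_right hpos (by omega))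
    _ = N ^ d * 2 := (mul_two _).symm
    _ ≤ N ^ d * N := Nat.mul_le_mul_left _ hN
    _ = N ^ (d + 1) := (pow_succ N d).symm

theorem loop_le_mul_pow {L c : ℕ} (hN : 2 ≤ N) (hW : 1 ≤ W) (hL : L ≤ W') (hc : a < c) :
    L * (W * N ^ a + 1) ≤ W' * W * N ^ c := by
  calc L * (W * N ^ a + 1) ≤ W' * (W * N ^ a + W * N ^ 0) := by
        gcongr
        simpa using hW
    _ = W' * W * (N ^ a + N ^ 0) := by ring
    _ ≤ W' * W * N ^ c := by gcongr; exact pow_add_pow_le_pow hN hc (by omega)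

theorem loop_le_pow {L c : ℕ} (hN : 2 ≤ N) (hL : L ≤ N ^ b) (hc : a + b < c) :
    L * (N ^ a + 1) ≤ N ^ c := by
  calc L * (N ^ a + 1) = L * (1 * N ^ a + 1) := by rw [one_mul]
    _ ≤ N ^ b * 1 * N ^ (a + 1) := loop_le_mul_pow hN le_rfl hL a.lt_succ_self
    _ = N ^ (b + (a + 1)) := by ring
    _ ≤ N ^ c := Nat.pow_le_pow_right (by omega) (by omega)

theorem Prog.TimeLe.bind_of_ensures_mul_pow (c : ℕ) (hN : 2 ≤ N) (hW : 1 ≤ W)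
    {p : Prog n (GaloisField 2 m) α} {f : α → Prog n (GaloisField 2 m) β} {Q : α → Prop}
    (hp : p.TimeLe G (N ^ a)) (hQ : p.Ensures G Q) (hf : ∀ x, Q x → (f x).TimeLe G (W * N ^ b))
    (ha : a < c := by norm_num) (hb : b < c := by norm_num) :
    (p >>= f).TimeLe G (W * N ^ c) := by
  refine (hp.bind_of_ensures hQ hf).mono ?_
  calc N ^ a + W * N ^ b ≤ W * N ^ a + W * N ^ b :=
        Nat.add_le_add_right (Nat.le_mul_of_pos_left _ hW) _
    _ = W * (N ^ a + N ^ b) := (mul_add ..).symm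
    _ ≤ W * N ^ c := Nat.mul_le_mul_left _ (pow_add_pow_le_pow hN ha hb)

theorem Prog.TimeLe.bind_mul_pow (c : ℕ) (hN : 2 ≤ N) (hW : 1 ≤ W)
    {p : Prog n (GaloisField 2 m) α} {f : α → Prog n (GaloisField 2 m) β}
    (hp : p.TimeLe G (N ^ a)) (hf : ∀ x, (f x).TimeLe G (W * N ^ b))
    (ha : a < c := by norm_num) (hb : b < c := by norm_num) :
    (p >>= f).TimeLe G (W * N ^ c) :=
  hp.bind_of_ensures_mul_pow c hN hW (ensures_true p) (fun x _ => hf x) ha hb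

theorem Prog.TimeLe.bind_of_ensures_eq_pow (c : ℕ) (hN : 2 ≤ N) {x : α}
    {p : Prog n (GaloisField 2 m) α} {f : α → Prog n (GaloisField 2 m) β}
    (hp : p.TimeLe G (N ^ a)) (hx : p.Ensures G fun y => y = x) (hf : (f x).TimeLe G (N ^ b))
    (ha : a < c := by norm_num) (hb : b < c := by norm_num) :
    (p >>= f).TimeLe G (N ^ c) :=
  (hp.bind_of_ensures hx fun _ h => h ▸ hf).mono (pow_add_pow_le_pow hN ha hb)

theorem Prog.TimeLe.bind_pow (c : ℕ) (hN : 2 ≤ N) {p : Prog n (GaloisField 2 m) α}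
    {f : α → Prog n (GaloisField 2 m) β} (hp : p.TimeLe G (N ^ a))
    (hf : ∀ x, (f x).TimeLe G (N ^ b)) (ha : a < c := by norm_num) (hb : b < c := by norm_num) :
    (p >>= f).TimeLe G (N ^ c) :=
  (hp.bind hf).mono (pow_add_pow_le_pow hN ha hb)

theorem Prog.timeLe_tabulate_pow [DecidableEq ι] (c : ℕ) (hN : 2 ≤ N) {l : List ι}
    {d : β} {f : ι → Prog n (GaloisField 2 m) β} (hl : l.length ≤ N ^ b)
    (h : ∀ i, (f i).TimeLe G (N ^ a)) (hc : a + b < c := by norm_num) :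
    (tabulate d l f).TimeLe G (N ^ c) :=
  (timeLe_tabulate h l).mono (loop_le_pow hN hl hc)

theorem Prog.timeLe_fold_pow (c : ℕ) (hN : 2 ≤ N) {l : List ι} {x : σ}
    {f : σ → ι → Prog n (GaloisField 2 m) σ} (hl : l.length ≤ N ^ b)
    (h : ∀ y, ∀ i ∈ l, (f y i).TimeLe G (N ^ a)) (hc : a + b < c := by norm_num) :
    (fold l x f).TimeLe G (N ^ c) :=
  (timeLe_fold h x).mono (loop_le_pow hN hl hc)

theorem Prog.timeLe_fold_mul_pow (c : ℕ) (hN : 2 ≤ N) (hW : 1 ≤ W) {l : List ι} {x : σ}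
    {f : σ → ι → Prog n (GaloisField 2 m) σ} (hl : l.length ≤ W')
    (h : ∀ y, ∀ i ∈ l, (f y i).TimeLe G (W * N ^ a)) (hc : a < c := by norm_num) :
    (fold l x f).TimeLe G (W' * W * N ^ c) :=
  (timeLe_fold h x).mono (loop_le_mul_pow hN hW hl hc)

theorem Prog.timeLe_anyOf_mul_pow (c : ℕ) (hN : 2 ≤ N) (hW : 1 ≤ W) {l : List ι}
    {f : ι → Prog n (GaloisField 2 m) Bool} (hl : l.length ≤ W')
    (h : ∀ i, (f i).TimeLe G (W * N ^ a)) (hc : a < c := by norm_num) :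
    (anyOf l f).TimeLe G (W' * W * N ^ c) :=
  (timeLe_anyOf h l).mono (loop_le_mul_pow hN hW hl hc)

/-- Every execution of `p` takes time at most `B` and returns a list of length at most `B`. -/
def Prog.Emits (G : SimpleGraph (Fin n)) (p : Prog n (GaloisField 2 m) (List β)) (B : ℕ) : Prop :=
  p.TimeLe G B ∧ p.Ensures G fun l => l.length ≤ B

section Emits

variable {p q q' : Prog n (GaloisField 2 m) (List β)} {B B' B'' : ℕ}

theorem Prog.Emits.mono (h : p.Emits G B) (hB : B ≤ B') : p.Emits G B' :=
  ⟨h.1.mono hB, h.2.mono fun _ hl => hl.trans hB⟩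

theorem Prog.emits_nil (B : ℕ) : (pure [] : Prog n (GaloisField 2 m) (List β)).Emits G B :=
  ⟨timeLe_pure _ _, ensures_pure B.zero_le⟩

theorem Prog.emits_exec_bind {i : Instr n (GaloisField 2 m) α}
    {f : α → Prog n (GaloisField 2 m) (List β)} (hi : i.cost m ≤ B) (hf : ∀ x, (f x).Emits G B') :
    (exec i >>= f).Emits G (B + B') :=
  ⟨(timeLe_exec hi).bind fun x => (hf x).1,
    (ensures_true _).bind fun x _ => (hf x).2.mono fun _ hl => hl.trans (Nat.le_add_left B' B)⟩

theorem Prog.Emits.append (hp : p.Emits G B) (hq : q.Emits G B') :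
    (p >>= fun C => q >>= fun D => pure (C ++ D)).Emits G (B + B') :=
  ⟨hp.1.bind fun _ => hq.1.bind (B' := 0) fun _ => timeLe_pure _ _,
    hp.2.bind fun _ hC => hq.2.bind fun _ hD =>
      ensures_pure (List.length_append.trans_le (Nat.add_le_add hC hD))⟩

theorem Prog.Emits.append_append (hp : p.Emits G B) (hq : q.Emits G B') (hq' : q'.Emits G B'') :
    (p >>= fun C => q >>= fun D => q' >>= fun E => pure (C ++ D ++ E)).Emits G (B + B' + B'') := by
  refine ⟨(hp.1.bind fun _ => hq.1.bind fun _ => hq'.1.bind (B' := 0) fun _ =>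
    timeLe_pure _ _).mono (add_assoc ..).ge, hp.2.bind fun C hC => hq.2.bind fun D hD =>
      hq'.2.bind fun E hE => ensures_pure ?_⟩
  rw [List.length_append, List.length_append]
  omega

theorem Prog.emits_collect {f : ι → Prog n (GaloisField 2 m) (List β)}
    (h : ∀ i, (f i).Emits G B) (l : List ι) : (collect l f).Emits G (l.length * (B + 1)) := by
  induction l with
  | nil => exact emits_nil _
  | cons i l ih =>
    rw [collect_cons]
    refine (emits_exec_bind (B := 1) le_rfl fun _ => (h i).append ih).mono ?_
    rw [List.length_cons]
    linarith

theorem Prog.emits_collect_pow (c : ℕ) (hN : 2 ≤ N) {l : List ι}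
    {f : ι → Prog n (GaloisField 2 m) (List β)} (hl : l.length ≤ N ^ b)
    (h : ∀ i, (f i).Emits G (N ^ a)) (hc : a + b < c := by norm_num) :
    (collect l f).Emits G (N ^ c) :=
  (emits_collect h l).mono (loop_le_pow hN hl hc)

theorem emits_emit (g : Gate n) : (emit g).Emits (m := m) G 1 :=
  ⟨timeLe_tick.bind (B' := 0) fun _ => timeLe_pure _ _,
    (ensures_true _).bind fun _ _ => ensures_pure le_rfl⟩

theorem emits_clear (ν : Node n) : (clear ν).Emits (m := m) G 1 := emits_emit _

theorem emits_addNode (ν μ : Node n) : (addNode ν μ).Emits (m := m) G 1 := emits_emit _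

theorem emits_mulVar (ν : Node n) (v : Var n) : (mulVar ν v).Emits (m := m) G 1 := emits_emit _

theorem emits_sumGates (ν : Node n) (j r s : ℕ) (u : Fin n) (ok : Fin n → Bool) :
    (sumGates ν j r s u ok).Emits (m := m) G (3 * n + 1) := by
  refine ((emits_clear ν).append (emits_collect (B := 2) (fun w => ?_) _)).mono ?_
  · refine emits_exec_bind (B := 1) (B' := 1) le_rfl fun e => ?_
    split_ifs
    · exact emits_addNode _ _
    · exact emits_nil _
  · rw [List.length_finRange]
    omega

theorem emits_pathGates (v₀ : Fin n) (V₁ : Fin n → Bool) (j r s : ℕ) (u₁ u₂ : Fin n) :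
    (pathGates v₀ V₁ j r s u₁ u₂).Emits (m := m) G (3 * n + 4) := by
  refine (emits_exec_bind (B := 1) (B' := 3 * n + 1 + 1 + 1) le_rfl fun e => ?_).mono (by omega)
  have hclear (ν : Node n) : (clear ν).Emits (m := m) G (3 * n + 1 + 1 + 1) :=
    (emits_clear ν).mono (by omega)
  split_ifs
  · exact (emits_emit _).mono (by omega)
  · exact ((emits_emit _).append (emits_mulVar _ _)).mono (by omega)
  · exact hclear _
  · cases r with
    | zero => exact hclear _
    | succ r =>
      exact (emits_sumGates ..).append_append (emits_mulVar _ _) (emits_mulVar _ _)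
  · exact ((emits_sumGates ..).append (emits_mulVar _ _)).mono (by omega)
  · cases s with
    | zero => exact hclear _
    | succ s =>
      exact (emits_sumGates ..).append_append (emits_mulVar _ _) (emits_mulVar _ _)
  · exact hclear _

end Emits

/-- The number `N` exceeds all parameters of the algorithm and all small constants, so that running
times can be bounded by powers of `N`. -/
structure Dominates (N n m k r s : ℕ) : Prop where
  large : 16 ≤ N
  n_le : n ≤ N
  m_lt : m < N
  k_lt : k < N
  r_lt : r < N
  s_lt : s < N

namespace Dominates

theorem two_le (h : Dominates N n m k r s) : 2 ≤ N := le_trans (by norm_num) h.large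

theorem length_finRange (h : Dominates N n m k r s) : (List.finRange n).length ≤ N ^ 1 := by
  simpa using h.n_le

theorem length_pairs (h : Dominates N n m k r s) : (pairs n).length ≤ N ^ 2 := by
  have hn := h.n_le
  have hN := h.large
  rw [pairs, List.length_sym2, List.length_finRange, Nat.choose_two_right, Nat.add_sub_cancel]
  refine Nat.div_le_of_le_mul ?_
  calc (n + 1) * n ≤ (2 * N) * N := Nat.mul_le_mul (by omega) hn
    _ = 2 * N ^ 2 := by ring

theorem emits_buildCircuit (h : Dominates N n m k r s) (v₀ : Fin n) (V₁ : Fin n → Bool) :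
    (buildCircuit k r s v₀ V₁).Emits (m := m) G (N ^ 14) := by
  have hN := h.two_le
  have hn := h.length_finRange
  have hpath : 3 * n + 4 ≤ N ^ 2 := by nlinarith [h.n_le, h.large]
  have hone : 1 ≤ N ^ 0 := le_rfl
  have hk : (List.range' 1 k).length ≤ N ^ 1 := by simpa using h.k_lt.le
  have hr : (List.range (r + 1)).length ≤ N ^ 1 := by simpa using h.r_lt
  have hs : (List.range (s + 1)).length ≤ N ^ 1 := by simpa using h.s_lt
  have hgates := emits_collect_pow (G := G) 12 hN hk fun j => emits_collect_pow 10 hN hr fun r' =>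
    emits_collect_pow 8 hN hs fun s' => emits_collect_pow 6 hN hn fun u₁ =>
      emits_collect_pow 4 hN hn fun u₂ =>
        (emits_pathGates (m := m) v₀ V₁ j r' s' u₁ u₂).mono hpath
  have hout := emits_collect_pow (G := G) 4 hN hn fun u₁ => emits_collect_pow 2 hN hn fun u₂ =>
    (emits_addNode (m := m) .out (.path k r s u₁ u₂)).mono hone
  refine (hgates.append_append (emits_clear _) hout).mono ?_
  calc N ^ 12 + 1 + N ^ 4 ≤ N ^ 13 + N ^ 4 :=
        Nat.add_le_add_right (pow_add_pow_le_pow (b := 0) hN (by norm_num) (by norm_num)) _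
    _ ≤ N ^ 14 := pow_add_pow_le_pow hN (by norm_num) (by norm_num)

theorem timeLe_linear (h : Dominates N n m k r s) {i : Instr n (GaloisField 2 m) α}
    (hi : i.cost m = m + 1) : (exec i).TimeLe G (N ^ 1) :=
  timeLe_exec (by rw [hi, pow_one]; exact h.m_lt)

theorem timeLe_evalCircuit (h : Dominates N n m k r s) {C : Circuit n}
    (hC : C.length ≤ N ^ 14) (ρ : Var n → GaloisField 2 m) :
    (evalCircuit C ρ).TimeLe G (N ^ 19) := by
  have hN := h.two_le
  have hgate (t : Node n → GaloisField 2 m) (g : Gate n) :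
      (g.compute ρ t).TimeLe G (N ^ 2) := by
    obtain ⟨ν, _ | _, x, y⟩ := g
    · exact (h.timeLe_linear rfl).mono (Nat.pow_le_pow_right (by omega) one_le_two)
    · exact timeLe_exec (Nat.pow_le_pow_left h.m_lt 2)
  exact (timeLe_fold_pow 18 hN hC fun t g _ =>
    (hgate t g).bind_pow (b := 0) 3 hN fun _ => timeLe_pure _ _).bind_pow (b := 0) 19 hN
      fun _ => timeLe_pure _ _

theorem timeLe_sumArray (h : Dominates N n m k r s) [DecidableEq ι] {q : ℕ} {l : List ι}
    (hl : l.length ≤ N ^ 2) (hq : q < N) (Y : Fin q → ι → GaloisField 2 m) {L : List (Fin q)}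
    (hL : L ∈ (List.finRange q).sublists) : (sumArray l Y L).TimeLe G (N ^ 6) := by
  have hlen : L.length ≤ N ^ 1 := by
    simpa using (List.mem_sublists.1 hL).length_le.trans (List.length_finRange.trans_le hq.le)
  exact timeLe_tabulate_pow 6 h.two_le hl fun i =>
    timeLe_fold_pow 3 h.two_le hlen fun c j _ => h.timeLe_linear rfl

theorem timeLe_sum_evalCircuit (h : Dominates N n m k r s) {C : Circuit n}
    (hC : C.length ≤ N ^ 14) (x : Sym2 (Fin n) → GaloisField 2 m)
    (Y : Fin r → Fin n → GaloisField 2 m) (z : Sym2 (Fin n) → GaloisField 2 m)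
    (acc : GaloisField 2 m) :
    (fold (List.finRange r).sublists acc fun acc R => do
      let y ← sumArray (List.finRange n) Y R
      let a ← evalCircuit C (assign x y z)
      exec (.fadd acc a)).TimeLe G (2 ^ r * N ^ 22) := by
  have hN := h.two_le
  have hn : (List.finRange n).length ≤ N ^ 2 :=
    h.length_finRange.trans (Nat.pow_le_pow_right (by omega) one_le_two)
  rw [← mul_one (2 ^ r)]
  refine timeLe_fold_mul_pow (a := 21) 22 hN le_rfl (by simp) fun acc R hR => ?_
  rw [one_mul]
  exact (h.timeLe_sumArray hn h.r_lt Y hR).bind_pow 21 hN fun y =>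
    (h.timeLe_evalCircuit hC _).bind_pow 20 hN fun a => h.timeLe_linear rfl

theorem timeLe_phiTestAt (h : Dominates N n m k r s) {C : Circuit n}
    (hC : C.length ≤ N ^ 14) (x : Sym2 (Fin n) → GaloisField 2 m)
    (Y : Fin r → Fin n → GaloisField 2 m) (Z : Fin s → Sym2 (Fin n) → GaloisField 2 m) :
    (phiTestAt C x Y Z).TimeLe G (2 ^ (r + s) * N ^ 25) := by
  have hN := h.two_le
  have hsum := timeLe_fold_mul_pow (G := G) 24 hN Nat.one_le_two_pow
    (show (List.finRange s).sublists.length ≤ 2 ^ s by simp) (x := 0) fun acc S hS =>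
      (h.timeLe_sumArray h.length_pairs h.s_lt Z hS).bind_mul_pow 23 hN
        (Nat.one_le_two_pow (n := r)) fun z => h.timeLe_sum_evalCircuit hC x Y z acc
  have htest (total : GaloisField 2 m) :
      (exec (.fzero total) >>= fun isZero => pure (!isZero)).TimeLe G (N ^ 2) :=
    (h.timeLe_linear rfl).bind_pow (b := 0) 2 hN fun _ => timeLe_pure _ _
  refine (hsum.bind htest).mono ?_
  calc 2 ^ s * 2 ^ r * N ^ 24 + N ^ 2
      ≤ 2 ^ (r + s) * N ^ 24 + 2 ^ (r + s) * N ^ 2 := by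
        rw [pow_add, mul_comm (2 ^ s)]
        gcongr
        exact Nat.le_mul_of_pos_left _ (by positivity)
    _ = 2 ^ (r + s) * (N ^ 24 + N ^ 2) := (mul_add ..).symm
    _ ≤ 2 ^ (r + s) * N ^ 25 :=
        Nat.mul_le_mul_left _ (pow_add_pow_le_pow hN (by norm_num) (by norm_num))

theorem timeLe_phiTest (h : Dominates N n m k r s) {C : Circuit n} (hC : C.length ≤ N ^ 14) :
    (phiTest r s C).TimeLe (m := m) G (2 ^ (r + s) * N ^ 28) := by
  have hN := h.two_le
  have hone : 1 ≤ 2 ^ (r + s) := Nat.one_le_two_pow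
  have hr : (List.finRange r).length ≤ N ^ 1 := by simpa using h.r_lt.le
  have hs : (List.finRange s).length ≤ N ^ 1 := by simpa using h.s_lt.le
  rw [phiTest_eq]
  exact (timeLe_tabulate_pow 4 hN h.length_pairs fun _ => h.timeLe_linear rfl).bind_mul_pow
    28 hN hone fun x => (timeLe_tabulate_pow 6 hN hr fun _ =>
      timeLe_tabulate_pow 3 hN h.length_finRange fun _ => h.timeLe_linear rfl).bind_mul_pow
    27 hN hone fun Y => (timeLe_tabulate_pow 6 hN hs fun _ =>
      timeLe_tabulate_pow 4 hN h.length_pairs fun _ => h.timeLe_linear rfl).bind_mul_pow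
    26 hN hone fun Z => h.timeLe_phiTestAt hC x Y Z

theorem timeLe_partition (h : Dominates N n m k r s) (v₀ : Fin n) :
    (partition v₀).TimeLe (m := m) G (N ^ 2) := by
  refine timeLe_tabulate_pow (a := 0) 2 h.two_le h.length_finRange fun v => ?_
  split_ifs
  · exact timeLe_pure _ _
  · exact timeLe_exec le_rfl

theorem timeLe_trial (h : Dominates N n m k r s) (v₀ : Fin n) :
    (trial k r s v₀).TimeLe (m := m) G (2 ^ (r + s) * N ^ 30) :=
  have hone : 1 ≤ 2 ^ (r + s) := Nat.one_le_two_pow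
  (h.timeLe_partition v₀).bind_mul_pow 30 h.two_le hone fun V₁ =>
    (h.emits_buildCircuit v₀ V₁).1.bind_of_ensures_mul_pow 29 h.two_le hone
      (h.emits_buildCircuit v₀ V₁).2 fun _ hC => h.timeLe_phiTest hC

end Dominates

theorem lt_two_pow_two_mul {x : ℕ} (hx : x ≤ N) : x < 2 ^ (2 * N) :=
  (show x ≤ 2 * N by omega).trans_lt Nat.lt_two_pow_self

theorem mul_lt_two_pow_two_mul {x y : ℕ} (hx : x < 2 ^ N) (hy : y < 2 ^ N) :
    x * y < 2 ^ (2 * N) := by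
  rw [two_mul, pow_add]
  exact Nat.mul_lt_mul'' hx hy

theorem choose_lt_two_pow (ha : a < N) (b : ℕ) : a.choose b < 2 ^ N :=
  (Nat.choose_le_two_pow a b).trans_lt (Nat.pow_lt_pow_right one_lt_two ha)

namespace Dominates

theorem timeLe_arith (h : Dominates N n m k r s) {op : ArithOp} (ha : a < 2 ^ (2 * N))
    (hb : b < 2 ^ (2 * N)) : (exec (.arith op a b)).TimeLe (m := m) G (N ^ 3) := by
  refine timeLe_exec ?_
  calc (Nat.size a + 1) * (Nat.size b + 1) ≤ (2 * N + 1) * (2 * N + 1) := Nat.mul_le_mul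
        (Nat.succ_le_succ (Nat.size_le.2 ha)) (Nat.succ_le_succ (Nat.size_le.2 hb))
    _ ≤ N ^ 3 := by nlinarith [h.large]

theorem timeLe_powTwo (h : Dominates N n m k r s) {e : ℕ} (he : e ≤ N) :
    (powTwo e).TimeLe (m := m) G (N ^ 5) := by
  have hN := h.two_le
  have hstep (i : ℕ) (hi : i < e) : (exec (.arith .mul 2 (2 ^ i))).TimeLe (m := m) G (N ^ 3) :=
    h.timeLe_arith (lt_two_pow_two_mul hN) (Nat.pow_lt_pow_right one_lt_two (by omega))
  have hfold := timeLe_fold_range (f := fun a _ => exec (.arith .mul 2 a)) (v := (2 ^ ·))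
    (fun i _ => ensures_powTwo_step i) hstep
  rw [pow_zero] at hfold
  exact hfold.mono (loop_le_pow (b := 1) hN (by simpa using he) (by norm_num))

theorem timeLe_binomial_step (h : Dominates N n m k r s) {i : ℕ} (ha : a < N) (hi : i < N) : (do
    let d ← exec (.arith .sub a i)
    let p ← exec (.arith .mul (a.choose i) d)
    let i' ← exec (.arith .add i 1)
    exec (.arith .div p i')).TimeLe (m := m) G (N ^ 6) := by
  have hN := h.two_le
  have hchoose := choose_lt_two_pow ha i
  have hsub : a - i < 2 ^ N := (show a - i ≤ N by omega).trans_lt Nat.lt_two_pow_self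
  have hi₁ := lt_two_pow_two_mul hi
  have hi₂ := lt_two_pow_two_mul hi.le
  have ha₂ := lt_two_pow_two_mul ha.le
  refine (h.timeLe_arith ha₂ hi₂).bind_of_ensures_eq_pow (x := a - i) (b := 5) 6 hN
    (ensures_arith _ _ _) ?_
  refine (h.timeLe_arith ?_ (lt_two_pow_two_mul (by omega))).bind_of_ensures_eq_pow
    (x := a.choose i * (a - i)) (b := 4) 5 hN (ensures_arith _ _ _) ?_
  · exact hchoose.trans_le (Nat.pow_le_pow_right two_pos (by omega))
  exact (h.timeLe_arith hi₂ (lt_two_pow_two_mul (by omega))).bind_of_ensures_eq_pow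
    (x := i + 1) (b := 3) 4 hN (ensures_arith _ _ _)
    (h.timeLe_arith (mul_lt_two_pow_two_mul hchoose hsub) hi₁)

theorem timeLe_binomial (h : Dominates N n m k r s) (ha : a < N) (hb : b ≤ N) :
    (binomial a b).TimeLe (m := m) G (N ^ 8) := by
  have hfold : (binomial a b).TimeLe (m := m) G (b * (N ^ 6 + 1)) := by
    simpa only [binomial, Nat.choose_zero_right] using timeLe_fold_range (v := a.choose)
      (fun i _ => ensures_binomial_step a i) fun i hi => h.timeLe_binomial_step ha (by omega)
  exact hfold.mono (loop_le_pow (b := 1) h.two_le (by simpa using hb) (by norm_num))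

theorem timeLe_rounds (h : Dominates N n m k r s) :
    (rounds k r s).TimeLe (m := m) G (N ^ 17) := by
  have hN := h.two_le
  have hk := h.k_lt
  have hr := h.r_lt
  have hs := h.s_lt
  have hb₁ := choose_lt_two_pow hr (k + 1 - r - s)
  have hb₂ := choose_lt_two_pow (show k - r < N by omega) s
  have hlt : 2 ^ N < 2 ^ (2 * N) := Nat.pow_lt_pow_right one_lt_two (by omega)
  have harith {op : ArithOp} {a b : ℕ} (ha : a ≤ N) (hb : b ≤ N) :
      (exec (.arith op a b)).TimeLe (m := m) G (N ^ 3) :=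
    h.timeLe_arith (lt_two_pow_two_mul ha) (lt_two_pow_two_mul hb)
  refine (harith hk.le (by omega)).bind_of_ensures_eq_pow (x := k + 1) (b := 16) 17 hN
    (ensures_arith _ _ _) ?_
  refine (h.timeLe_powTwo hk).bind_of_ensures_eq_pow (b := 15) 16 hN (ensures_powTwo _) ?_
  refine (harith hk hr.le).bind_of_ensures_eq_pow (x := k + 1 - r) (b := 14) 15 hN
    (ensures_arith _ _ _) ?_
  refine (harith (by omega) hs.le).bind_of_ensures_eq_pow (x := k + 1 - r - s) (b := 13) 14 hN
    (ensures_arith _ _ _) ?_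
  refine (h.timeLe_binomial hr (by omega)).bind_of_ensures_eq_pow (b := 12) 13 hN
    (ensures_binomial _ _) ?_
  refine (harith hk.le hr.le).bind_of_ensures_eq_pow (x := k - r) (b := 11) 12 hN
    (ensures_arith _ _ _) ?_
  refine (h.timeLe_binomial (by omega) hs.le).bind_of_ensures_eq_pow (b := 10) 11 hN
    (ensures_binomial _ _) ?_
  refine (h.timeLe_arith (hb₁.trans hlt) (hb₂.trans hlt)).bind_of_ensures_eq_pow
    (x := r.choose (k + 1 - r - s) * (k - r).choose s) (b := 3) 10 hN (ensures_arith _ _ _) ?_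
  exact h.timeLe_arith (Nat.pow_lt_pow_right one_lt_two (by omega))
    (mul_lt_two_pow_two_mul hb₁ hb₂)

theorem timeLe_search (h : Dominates N n m k r s) {T : ℕ} (hT : 1 ≤ T) :
    (anyOf (List.finRange n) fun v₀ => anyOf (List.range T) fun _ => trial k r s v₀).TimeLe
      (m := m) G (T * 2 ^ (r + s) * N ^ 33) := by
  have hN := h.two_le
  have hone : 1 ≤ 2 ^ (r + s) := Nat.one_le_two_pow
  have hn : (List.finRange n).length ≤ N := by simpa using h.n_le
  have hloop := timeLe_anyOf_mul_pow (G := G) 32 hN (Nat.mul_pos hT hone) hn fun v₀ =>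
    timeLe_anyOf_mul_pow 31 hN hone (List.length_range (n := T)).le fun _ => h.timeLe_trial v₀
  exact hloop.mono (by ring_nf; rfl)

end Dominates

theorem two_pow_fieldBits_le (k : ℕ) : 2 ^ fieldBits k ≤ 8 * (2 * k + 1) := by
  obtain ⟨d, hd⟩ : ∃ d, fieldBits k = d + 1 := Nat.exists_eq_succ_of_ne_zero fun h => by
    have := Nat.size_eq_zero.1 h
    omega
  have hpow : 2 ^ d ≤ 4 * (2 * k + 1) := Nat.lt_size.1 (by
    rw [← fieldBits, hd]
    exact d.lt_succ_self)
  rw [hd, pow_succ]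
  omega

theorem Dominates.timeLe_setup (h : Dominates N n (fieldBits k) k r s) :
    (exec .setup).TimeLe (m := fieldBits k) G (N ^ 6) := by
  have hk : 8 * (2 * k + 1) ≤ N ^ 2 := by nlinarith [h.k_lt, h.large]
  refine timeLe_exec ?_
  calc 4 ^ fieldBits k * (fieldBits k + 1) ^ 2
      = (2 ^ fieldBits k) ^ 2 * (fieldBits k + 1) ^ 2 := by
        rw [← pow_mul, mul_comm (fieldBits k), pow_mul, show 2 ^ 2 = 4 from rfl]
    _ ≤ (N ^ 2) ^ 2 * N ^ 2 := Nat.mul_le_mul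
        (Nat.pow_le_pow_left ((two_pow_fieldBits_le k).trans hk) 2) (Nat.pow_le_pow_left h.m_lt 2)
    _ = N ^ 6 := by ring

theorem Dominates.timeLe_hamiltonian (h : Dominates N n (fieldBits k) k r s)
    (hA : Admissible k r s) : (hamiltonian n k r s).TimeLe (m := fieldBits k) G
      (2 ^ (k + 1) / (r.choose (k + 1 - r - s) * (k - r).choose s) * 2 ^ (r + s) * N ^ 35) := by
  have hN := h.two_le
  have hT : 1 ≤ 2 ^ (k + 1) / (r.choose (k + 1 - r - s) * (k - r).choose s) :=
    (Nat.one_le_div_iff hA.mul_choose_pos).2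
      (hA.mul_choose_le.trans (Nat.pow_le_pow_right two_pos k.le_succ))
  have hW := Nat.mul_pos hT (Nat.two_pow_pos (r + s))
  exact h.timeLe_setup.bind_mul_pow 35 hN hW fun _ =>
    h.timeLe_rounds.bind_of_ensures_mul_pow 34 hN hW (ensures_rounds k r s) fun _ hT' => by
      rw [hT']
      exact h.timeLe_search hT

theorem dominates (hk : k ≤ n) (hr : r ≤ k + 1) (hs : s ≤ k + 1) :
    Dominates (20 * (n + 1)) n (fieldBits k) k r s := by
  have hbits : fieldBits k ≤ 4 * (2 * k + 1) := Nat.size_le.2 Nat.lt_two_pow_self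
  constructor <;> omega

theorem runsInTime_hamiltonian (G : SimpleGraph (Fin n)) (hk : k ≤ n) (hA : Admissible k r s) :
    RunsInTime (runHamiltonian G k r s) (2 * (20 * ((n : ℝ) + 1)) ^ 35 * (2 ^ (r + s + k) /
      ((r.choose (k + 1 - r - s) : ℝ) * ((k - r).choose s : ℝ)))) := by
  have hrs := hA.1
  set B := r.choose (k + 1 - r - s) * (k - r).choose s with hB
  have htime := (dominates hk (by omega) (by omega)).timeLe_hamiltonian (G := G) hA
  have hT : ((2 ^ (k + 1) / B : ℕ) : ℝ) ≤ 2 ^ (k + 1) / B := by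
    exact_mod_cast Nat.cast_div_le (α := ℝ) (m := 2 ^ (k + 1)) (n := B)
  rw [← Nat.cast_mul, ← hB]
  intro o ho
  calc (o.2 : ℝ)
      ≤ ((2 ^ (k + 1) / B * 2 ^ (r + s) * (20 * (n + 1)) ^ 35 : ℕ) : ℝ) := by
        exact_mod_cast htime o ho
    _ = ((2 ^ (k + 1) / B : ℕ) : ℝ) * 2 ^ (r + s) * (20 * ((n : ℝ) + 1)) ^ 35 := by push_cast; rfl
    _ ≤ 2 ^ (k + 1) / B * 2 ^ (r + s) * (20 * ((n : ℝ) + 1)) ^ 35 := by gcongr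
    _ = 2 * (20 * ((n : ℝ) + 1)) ^ 35 * (2 ^ (r + s + k) / B) := by
        rw [pow_add 2 (r + s) k, pow_succ]
        ring

theorem RunsInTime.mono {D : PMF (α × ℕ)} {x y : ℝ} (h : RunsInTime D x) (hxy : x ≤ y) :
    RunsInTime D y :=
  fun o ho => (h o ho).trans hxy

theorem exists_runsInTime_hamiltonian : ∃ C c : ℕ, ∀ (n : ℕ) (G : SimpleGraph (Fin n))
    (k r s : ℕ), 1 ≤ k → k ≤ n → Admissible k r s → RunsInTime (runHamiltonian G k r s)
      (C * ((2 : ℝ) ^ (r + s + k) * (n : ℝ) ^ c /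
        ((r.choose (k + 1 - r - s) : ℝ) * ((k - r).choose s : ℝ)))) := by
  refine ⟨2 * 40 ^ 35, 35, fun n G k r s hk hkn hA => (runsInTime_hamiltonian G hkn hA).mono ?_⟩
  have hn : (1 : ℝ) ≤ n := by exact_mod_cast hk.trans hkn
  set B := (r.choose (k + 1 - r - s) : ℝ) * ((k - r).choose s : ℝ)
  calc 2 * (20 * ((n : ℝ) + 1)) ^ 35 * (2 ^ (r + s + k) / B)
      ≤ 2 * (40 * n) ^ 35 * (2 ^ (r + s + k) / B) := by gcongr 2 * ?_ ^ 35 * _; linarith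
    _ = _ := by push_cast; ring

end Time

/-! ## The exponent for `r = ⌊0.5 k⌋` and `s = ⌊0.208 k⌋` -/

section Exponent

open Nat in
theorem factorial_mul_pow_le (b j : ℕ) : b ! * b ^ j ≤ j ! * b ^ b := by
  rcases Nat.le_total j b with h | h
  · have hfact : j ! * b.descFactorial (b - j) = b ! := by
      simpa only [Nat.sub_sub_self h] using Nat.factorial_mul_descFactorial (Nat.sub_le b j)
    calc b ! * b ^ j = j ! * b.descFactorial (b - j) * b ^ j := by rw [hfact]
      _ ≤ j ! * b ^ (b - j) * b ^ j := by gcongr; exact Nat.descFactorial_le_pow _ _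
      _ = j ! * b ^ b := by rw [mul_assoc, ← pow_add, Nat.sub_add_cancel h]
  · calc b ! * b ^ j = b ! * b ^ (j - b) * b ^ b := by
          rw [mul_assoc, ← pow_add, Nat.sub_add_cancel h]
      _ ≤ j ! * b ^ b := by gcongr; exact Nat.factorial_mul_pow_sub_le_factorial h

open Nat in
theorem pow_mul_pow_mul_choose_le {b c i j : ℕ} (h : j + i = b + c) :
    b ^ j * c ^ i * (j + i).choose j ≤ (b + c).choose b * (b ^ b * c ^ c) := by
  refine le_of_mul_le_mul_left (a := b ! * c !) ?_
    (Nat.mul_pos (Nat.factorial_pos b) (Nat.factorial_pos c))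
  calc b ! * c ! * (b ^ j * c ^ i * (j + i).choose j)
      = (j + i).choose j * ((b ! * b ^ j) * (c ! * c ^ i)) := by ring
    _ ≤ (j + i).choose j * ((j ! * b ^ b) * (i ! * c ^ c)) := Nat.mul_le_mul_left _
        (Nat.mul_le_mul (factorial_mul_pow_le b j) (factorial_mul_pow_le c i))
    _ = (j + i).choose j * j ! * i ! * (b ^ b * c ^ c) := by ring
    _ = (b + c).choose b * b ! * c ! * (b ^ b * c ^ c) := by
        rw [Nat.choose_symm_add, Nat.choose_symm_add, Nat.add_choose_mul_factorial_mul_factorial,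
          Nat.add_choose_mul_factorial_mul_factorial, h]
    _ = b ! * c ! * ((b + c).choose b * (b ^ b * c ^ c)) := by ring

theorem add_pow_self_le (b c : ℕ) :
    (b + c) ^ (b + c) ≤ (b + c + 1) * ((b + c).choose b * (b ^ b * c ^ c)) := by
  rw [add_pow b c (b + c)]
  refine (Finset.sum_le_card_nsmul _ _ ((b + c).choose b * (b ^ b * c ^ c)) fun j hj => ?_).trans
    (by simp)
  obtain ⟨i, hi⟩ := Nat.exists_eq_add_of_le (Nat.lt_succ_iff.1 (Finset.mem_range.1 hj))
  have hterm := pow_mul_pow_mul_choose_le hi.symm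
  rwa [← hi, show i = b + c - j by omega] at hterm

theorem pow_le_pow_mul_exp {x y : ℝ} (hx : 0 ≤ x) (hy : 0 < y) (b : ℕ) :
    x ^ b ≤ y ^ b * Real.exp (b * (x / y - 1)) := by
  have h : x / y ≤ Real.exp (x / y - 1) := by
    simpa using Real.add_one_le_exp (x / y - 1)
  calc x ^ b = y ^ b * (x / y) ^ b := by rw [← mul_pow, mul_div_cancel₀ _ hy.ne']
    _ ≤ y ^ b * Real.exp (x / y - 1) ^ b := by gcongr
    _ = y ^ b * Real.exp (b * (x / y - 1)) := by rw [← Real.exp_nat_mul]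

theorem pow_self_mul_pow_self_le {β γ : ℝ} (hβ : 0 < β) (hγ : 0 < γ) (hβγ : β + γ = 1) {b c : ℕ}
    (hbc : 0 < b + c) : (b : ℝ) ^ b * (c : ℝ) ^ c ≤ β ^ b * γ ^ c * ((b : ℝ) + c) ^ (b + c) *
      Real.exp (((b : ℝ) - β * (b + c)) ^ 2 / (β * γ * (b + c))) := by
  have ha : (0 : ℝ) < b + c := by exact_mod_cast hbc
  have hb := pow_le_pow_mul_exp (Nat.cast_nonneg b) (mul_pos hβ ha) b
  have hc := pow_le_pow_mul_exp (Nat.cast_nonneg c) (mul_pos hγ ha) c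
  have hexp : (b : ℝ) * (b / (β * (b + c)) - 1) + c * (c / (γ * (b + c)) - 1) =
      ((b : ℝ) - β * (b + c)) ^ 2 / (β * γ * (b + c)) := by
    obtain rfl : γ = 1 - β := by linarith
    field_simp
    ring
  calc (b : ℝ) ^ b * (c : ℝ) ^ c ≤ ((β * (b + c)) ^ b * Real.exp (b * (b / (β * (b + c)) - 1))) *
        ((γ * (b + c)) ^ c * Real.exp (c * (c / (γ * (b + c)) - 1))) := by gcongr
    _ = β ^ b * γ ^ c * ((b : ℝ) + c) ^ (b + c) *
        Real.exp (b * (b / (β * (b + c)) - 1) + c * (c / (γ * (b + c)) - 1)) := by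
      rw [Real.exp_add, mul_pow, mul_pow, pow_add]
      ring
    _ = _ := by rw [hexp]

theorem one_le_choose_mul_exp {β γ : ℝ} (hβ : 0 < β) (hγ : 0 < γ) (hβγ : β + γ = 1) {b c : ℕ}
    (hbc : 0 < b + c) : 1 ≤ ((b : ℝ) + c + 1) * (b + c).choose b * (β ^ b * γ ^ c) *
      Real.exp (((b : ℝ) - β * (b + c)) ^ 2 / (β * γ * (b + c))) := by
  have ha : (0 : ℝ) < b + c := by exact_mod_cast hbc
  have hpow : ((b : ℝ) + c) ^ (b + c) ≤
      (b + c + 1) * ((b + c).choose b * ((b : ℝ) ^ b * (c : ℝ) ^ c)) := by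
    exact_mod_cast add_pow_self_le b c
  refine le_of_mul_le_mul_left ?_ (pow_pos ha (b + c))
  calc ((b : ℝ) + c) ^ (b + c) * 1
      ≤ (b + c + 1) * ((b + c).choose b * ((b : ℝ) ^ b * (c : ℝ) ^ c)) := by rwa [mul_one]
    _ ≤ (b + c + 1) * ((b + c).choose b * (β ^ b * γ ^ c * ((b : ℝ) + c) ^ (b + c) *
        Real.exp (((b : ℝ) - β * (b + c)) ^ 2 / (β * γ * (b + c))))) := by
      gcongr _ * (_ * ?_)
      exact pow_self_mul_pow_self_le hβ hγ hβγ hbc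
    _ = _ := by ring

theorem one_le_choose_mul_of_close {b c k : ℕ} (hbc : 5 ≤ b + c) (hk : b + c ≤ k)
    (hle : 1000 * b ≤ 416 * (b + c) + 3000) (hge : 416 * (b + c) ≤ 1000 * b + 3000) :
    1 ≤ ((k : ℝ) + 1) * (b + c).choose b * (0.416 ^ b * 0.584 ^ c) * Real.exp 9 := by
  have hbc' : (5 : ℝ) ≤ b + c := by exact_mod_cast hbc
  have hk' : (b : ℝ) + c ≤ k := by exact_mod_cast hk
  have hle' : 1000 * (b : ℝ) ≤ 416 * (b + c) + 3000 := by exact_mod_cast hle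
  have hge' : 416 * ((b : ℝ) + c) ≤ 1000 * b + 3000 := by exact_mod_cast hge
  have hdev : ((b : ℝ) - 0.416 * (b + c)) ^ 2 / (0.416 * 0.584 * (b + c)) ≤ 9 := by
    have hsq : ((b : ℝ) - 0.416 * (b + c)) ^ 2 ≤ 3 ^ 2 :=
      sq_le_sq' (by linarith) (by linarith)
    rw [div_le_iff₀ (by linarith)]
    linarith
  refine (one_le_choose_mul_exp (β := 0.416) (γ := 0.584) (b := b) (c := c) (by norm_num)
    (by norm_num) (by norm_num) (by omega)).trans ?_
  gcongr

theorem two_rpow_mul_rpow_mul_rpow_le :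
    (2 : ℝ) ^ (1.708 : ℝ) * 0.416 ^ (0.416 : ℝ) * 0.584 ^ (0.584 : ℝ) ≤ 1.657 := by
  refine (pow_le_pow_iff_left₀ (by positivity) (by norm_num) (n := 250) (by norm_num)).1 ?_
  rw [mul_pow, mul_pow, ← Real.rpow_mul_natCast (by norm_num),
    ← Real.rpow_mul_natCast (by norm_num), ← Real.rpow_mul_natCast (by norm_num),
    show (1.708 : ℝ) * (250 : ℕ) = (427 : ℕ) by norm_num,
    show (0.416 : ℝ) * (250 : ℕ) = (104 : ℕ) by norm_num,
    show (0.584 : ℝ) * (250 : ℕ) = (146 : ℕ) by norm_num,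
    Real.rpow_natCast, Real.rpow_natCast, Real.rpow_natCast,
    show 427 = 213 + 214 from rfl, pow_add]
  norm_num

theorem two_pow_mul_pow_mul_pow_le {k a i j : ℕ} (ha : 1000 * a ≤ 1708 * k)
    (hi : 416 * k ≤ 1000 * i + 4000) (hj : 584 * k ≤ 1000 * j) :
    (2 : ℝ) ^ a * (0.416 ^ i * 0.584 ^ j) ≤ 0.416⁻¹ ^ 4 * 1.657 ^ k := by
  have ha' : 1000 * (a : ℝ) ≤ 1708 * k := by exact_mod_cast ha
  have hi' : 416 * (k : ℝ) ≤ 1000 * i + 4000 := by exact_mod_cast hi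
  have hj' : 584 * (k : ℝ) ≤ 1000 * j := by exact_mod_cast hj
  have htwo : (2 : ℝ) ^ (a : ℝ) ≤ 2 ^ (1.708 * (k : ℝ)) :=
    Real.rpow_le_rpow_of_exponent_le one_le_two (by linarith)
  have hβ : (0.416 : ℝ) ^ ((i + 4 : ℕ) : ℝ) ≤ 0.416 ^ (0.416 * (k : ℝ)) :=
    Real.rpow_le_rpow_of_exponent_ge (by norm_num) (by norm_num) (by push_cast; linarith)
  have hγ : (0.584 : ℝ) ^ (j : ℝ) ≤ 0.584 ^ (0.584 * (k : ℝ)) :=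
    Real.rpow_le_rpow_of_exponent_ge (by norm_num) (by norm_num) (by linarith)
  rw [Real.rpow_natCast] at htwo hβ hγ
  calc (2 : ℝ) ^ a * (0.416 ^ i * 0.584 ^ j)
      = 0.416⁻¹ ^ 4 * (2 ^ a * 0.416 ^ (i + 4) * 0.584 ^ j) := by
        rw [pow_add]
        field_simp
    _ ≤ 0.416⁻¹ ^ 4 * (2 ^ (1.708 * (k : ℝ)) * 0.416 ^ (0.416 * (k : ℝ)) *
        0.584 ^ (0.584 * (k : ℝ))) := by gcongr
    _ = 0.416⁻¹ ^ 4 * (2 ^ (1.708 : ℝ) * 0.416 ^ (0.416 : ℝ) * 0.584 ^ (0.584 : ℝ)) ^ k := by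
      rw [mul_pow, mul_pow, Real.rpow_mul_natCast (by norm_num),
        Real.rpow_mul_natCast (by norm_num), Real.rpow_mul_natCast (by norm_num)]
    _ ≤ 0.416⁻¹ ^ 4 * 1.657 ^ k := by
      gcongr
      exact two_rpow_mul_rpow_mul_rpow_le

theorem admissible_half {k : ℕ} (hk : 10 ≤ k) : Admissible k (k / 2) (208 * k / 1000) :=
  ⟨by omega, (Nat.choose_pos (by omega)).ne', (Nat.choose_pos (by omega)).ne'⟩

theorem two_pow_div_choose_half_le {k r s : ℕ} (hk : 10 ≤ k) (hr : r = k / 2)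
    (hs : s = 208 * k / 1000) :
    (2 : ℝ) ^ (r + s + k) / ((r.choose (k + 1 - r - s) : ℝ) * ((k - r).choose s : ℝ)) ≤
      Real.exp 18 * 0.416⁻¹ ^ 4 * ((k : ℝ) + 1) ^ 2 * 1.657 ^ k := by
  obtain ⟨b, hb⟩ : ∃ b, r = b + (k + 1 - r - s) := Nat.exists_eq_add_of_le' (by omega)
  obtain ⟨c, hc⟩ : ∃ c, k - r = s + c := Nat.exists_eq_add_of_le (by omega)
  have hpos : (0 : ℝ) < r.choose (k + 1 - r - s) * (k - r).choose s := by
    have := (admissible_half hk).mul_choose_pos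
    rw [← hr, ← hs] at this
    exact_mod_cast this
  -- Both coefficients are about `0.5 k` choose `0.208 k`, and `0.416 = 0.208 / 0.5`.
  have h₁ := one_le_choose_mul_of_close (b := b) (c := k + 1 - r - s) (k := k)
    (by omega) (by omega) (by omega) (by omega)
  have h₂ := one_le_choose_mul_of_close (b := s) (c := c) (k := k)
    (by omega) (by omega) (by omega) (by omega)
  rw [Nat.choose_symm_add, ← hb] at h₁
  rw [← hc] at h₂
  have hpow := two_pow_mul_pow_mul_pow_le (k := k) (a := r + s + k) (i := b + s)
    (j := (k + 1 - r - s) + c) (by omega) (by omega) (by omega)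
  rw [div_le_iff₀ hpos]
  set A := (r.choose (k + 1 - r - s) : ℝ)
  set A' := ((k - r).choose s : ℝ)
  calc (2 : ℝ) ^ (r + s + k)
      ≤ 2 ^ (r + s + k) *
        ((((k : ℝ) + 1) * A * (0.416 ^ b * 0.584 ^ (k + 1 - r - s)) * Real.exp 9) *
          (((k : ℝ) + 1) * A' * (0.416 ^ s * 0.584 ^ c) * Real.exp 9)) :=
        le_mul_of_one_le_right (by positivity) (one_le_mul_of_one_le_of_one_le h₁ h₂)
    _ = Real.exp 18 * ((k : ℝ) + 1) ^ 2 * (A * A') *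
        (2 ^ (r + s + k) * (0.416 ^ (b + s) * 0.584 ^ ((k + 1 - r - s) + c))) := by
      rw [show (18 : ℝ) = 9 + 9 by norm_num, Real.exp_add, pow_add 0.416, pow_add 0.584]
      ring
    _ ≤ Real.exp 18 * ((k : ℝ) + 1) ^ 2 * (A * A') * (0.416⁻¹ ^ 4 * 1.657 ^ k) := by gcongr
    _ = _ := by ring

end Exponent

/-! ## The undirected `k`-path problem -/

section KPathAlgorithm

open Prog

variable {n m k : ℕ} {G : SimpleGraph (Fin n)} {F : Type}

/-- The parameter `r` of the call `Hamiltonian(G, k, r, s)` in the algorithm for the `k`-path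
problem. -/
def vertexParam (k : ℕ) : ℕ := if k < 10 then k + 1 else k / 2

/-- The parameter `s` of the call `Hamiltonian(G, k, r, s)` in the algorithm for the `k`-path
problem. -/
def edgeParam (k : ℕ) : ℕ := if k < 10 then 0 else 208 * k / 1000

theorem kPath_eq [Zero F] : kPath (F := F) n k = exec (.arith .lt k n) >>= fun b =>
    if b = 0 then pure false else hamiltonian n k (vertexParam k) (edgeParam k) := by
  rw [kPath, vertexParam, edgeParam]
  split_ifs <;> rfl

theorem admissible_params (k : ℕ) : Admissible k (vertexParam k) (edgeParam k) := by
  rw [vertexParam, edgeParam]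
  split_ifs with hk
  · simp [Admissible]
  · exact admissible_half (not_lt.1 hk)

theorem exists_two_pow_div_choose_params_le : ∃ K : ℕ, ∀ k : ℕ,
    (2 : ℝ) ^ (vertexParam k + edgeParam k + k) /
      (((vertexParam k).choose (k + 1 - vertexParam k - edgeParam k) : ℝ) *
        ((k - vertexParam k).choose (edgeParam k) : ℝ)) ≤ K * ((k : ℝ) + 1) ^ 2 * 1.657 ^ k := by
  obtain ⟨K, hK⟩ := exists_nat_ge (2 ^ 19 + Real.exp 18 * 0.416⁻¹ ^ 4)
  refine ⟨K, fun k => ?_⟩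
  rcases lt_or_ge k 10 with hk | hk
  · rw [vertexParam, edgeParam, if_pos hk, if_pos hk, Nat.sub_self, Nat.zero_sub,
      Nat.choose_zero_right, Nat.choose_zero_right, Nat.cast_one, mul_one, div_one]
    calc (2 : ℝ) ^ (k + 1 + 0 + k) ≤ 2 ^ 19 := pow_le_pow_right₀ one_le_two (by omega)
      _ ≤ K := (le_add_of_nonneg_right (by positivity)).trans hK
      _ = K * 1 ^ 2 * 1 := by ring
      _ ≤ K * ((k : ℝ) + 1) ^ 2 * 1.657 ^ k := by
        gcongr
        · exact le_add_of_nonneg_left k.cast_nonneg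
        · exact one_le_pow₀ (by norm_num)
  · rw [vertexParam, edgeParam, if_neg (not_lt.2 hk), if_neg (not_lt.2 hk)]
    refine (two_pow_div_choose_half_le hk rfl rfl).trans ?_
    gcongr
    exact (le_add_of_nonneg_left (by positivity)).trans hK

theorem ensures_lt : (exec (.arith .lt k n) : Prog n (GaloisField 2 m) ℕ).Ensures G
    fun b => b = 0 ↔ n ≤ k :=
  (ensures_arith _ _ _).mono fun b hb => by
    rw [hb]
    simp [ArithOp.eval]

theorem lt_of_hasSimplePath (h : HasSimplePath G k) : k < n := by
  obtain ⟨p, hp, -⟩ := hasSimplePath_iff.1 h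
  simpa using Fintype.card_le_of_injective p hp

theorem half_le_answerProb_kPath (hk : 1 ≤ k) (h : HasSimplePath G k) :
    1 / 2 ≤ answerProb (runKPath G k) true := by
  change 1 / 2 ≤ (kPath n k).dist G true
  rw [kPath_eq]
  refine le_dist_bind ensures_lt fun b hb => ?_
  rw [if_neg fun hzero => (lt_of_hasSimplePath h).not_ge (hb.1 hzero)]
  exact half_le_answerProb hk (admissible_params k) h

theorem answerProb_kPath_eq_one (hk : 1 ≤ k) (h : ¬ HasSimplePath G k) :
    answerProb (runKPath G k) false = 1 := by
  have hfalse : (kPath n k).Ensures (m := fieldBits k) G fun b => b = false := by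
    rw [kPath_eq]
    refine (ensures_true _).bind fun b _ => ?_
    split_ifs
    · exact ensures_pure rfl
    · exact ensures_hamiltonian_false hk h
  change (kPath n k).dist G false = 1
  rw [hfalse.dist_eq_pure, PMF.pure_apply_self]

theorem add_one_le_two_mul_pow (k : ℕ) : (k : ℝ) + 1 ≤ 2 * 1.657 ^ k := by
  have hbernoulli := one_add_mul_le_pow (show (-2 : ℝ) ≤ 0.657 by norm_num) k
  norm_num at hbernoulli ⊢
  linarith [Nat.cast_nonneg (α := ℝ) k]

theorem runsInTime_kPath {x : ℝ} (hx : 0 ≤ x) (h : k ≤ n →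
    RunsInTime (runHamiltonian G k (vertexParam k) (edgeParam k)) x) :
    RunsInTime (runKPath G k) (2 * ((n : ℝ) + 1) * 1.657 ^ k + x) := by
  have hcost : (exec (.arith .lt k n)).TimeLe (m := fieldBits k) G ((k + 1) * (n + 1)) :=
    timeLe_exec (Nat.mul_le_mul (Nat.succ_le_succ (Nat.size_le.2 Nat.lt_two_pow_self))
      (Nat.succ_le_succ (Nat.size_le.2 Nat.lt_two_pow_self)))
  have htime : (kPath n k).TimeLe (m := fieldBits k) G ((k + 1) * (n + 1) + ⌊x⌋₊) := by
    rw [kPath_eq]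
    refine hcost.bind_of_ensures ensures_lt fun b hb => ?_
    split_ifs with hzero
    · exact timeLe_pure _ _
    · exact fun o ho => Nat.le_floor (h (not_le.1 (mt hb.2 hzero)).le o ho)
  intro o ho
  calc (o.2 : ℝ) ≤ ((k + 1) * (n + 1) + ⌊x⌋₊ : ℕ) := by exact_mod_cast htime o ho
    _ = ((k : ℝ) + 1) * (n + 1) + ⌊x⌋₊ := by push_cast; rfl
    _ ≤ 2 * 1.657 ^ k * (n + 1) + x := by
      gcongr
      · exact add_one_le_two_mul_pow k
      · exact Nat.floor_le hx
    _ = 2 * ((n : ℝ) + 1) * 1.657 ^ k + x := by ring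

theorem exists_runsInTime_kPath : ∃ C c : ℕ, ∀ (n : ℕ) (G : SimpleGraph (Fin n)) (k : ℕ),
    RunsInTime (runKPath G k) (C * ((n : ℝ) + 1) ^ c * (1.657 : ℝ) ^ k) := by
  obtain ⟨K, hK⟩ := exists_two_pow_div_choose_params_le
  refine ⟨2 + 2 * 20 ^ 35 * K, 37, fun n G k => ?_⟩
  have hham (hkn : k ≤ n) := (runsInTime_hamiltonian G hkn (admissible_params k)).mono
    (y := 2 * (20 * ((n : ℝ) + 1)) ^ 35 * (K * ((n : ℝ) + 1) ^ 2 * 1.657 ^ k)) <| by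
      gcongr
      exact (hK k).trans (by gcongr)
  refine (runsInTime_kPath (by positivity) hham).mono ?_
  have hn : (n : ℝ) + 1 ≤ ((n : ℝ) + 1) ^ 37 :=
    le_self_pow₀ (le_add_of_nonneg_left n.cast_nonneg) (by norm_num)
  calc 2 * ((n : ℝ) + 1) * 1.657 ^ k +
        2 * (20 * ((n : ℝ) + 1)) ^ 35 * (K * ((n : ℝ) + 1) ^ 2 * 1.657 ^ k)
      ≤ 2 * ((n : ℝ) + 1) ^ 37 * 1.657 ^ k +
        2 * (20 * ((n : ℝ) + 1)) ^ 35 * (K * ((n : ℝ) + 1) ^ 2 * 1.657 ^ k) := by gcongr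
    _ = _ := by push_cast; ring

end KPathAlgorithm

end KPath

theorem mainTheorem2 :
    (∃ C c : ℕ, ∀ (n : ℕ) (G : SimpleGraph (Fin n)) (k r s : ℕ), 1 ≤ k → k ≤ n →
      KPath.Admissible k r s →
      KPath.RunsInTime (KPath.runHamiltonian G k r s)
        (C * ((2 : ℝ) ^ (r + s + k) * (n : ℝ) ^ c /
          ((r.choose (k + 1 - r - s) : ℝ) * ((k - r).choose s : ℝ))))) ∧
    (∀ (n : ℕ) (G : SimpleGraph (Fin n)) (k r s : ℕ), 1 ≤ k → KPath.Admissible k r s →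
      KPath.HasSimplePath G k → 1 / 2 ≤ KPath.answerProb (KPath.runHamiltonian G k r s) true) ∧
    (∀ (n : ℕ) (G : SimpleGraph (Fin n)) (k r s : ℕ), 1 ≤ k →
      ¬ KPath.HasSimplePath G k → KPath.answerProb (KPath.runHamiltonian G k r s) false = 1) ∧
    ((∃ C c : ℕ, ∀ (n : ℕ) (G : SimpleGraph (Fin n)) (k : ℕ), 1 ≤ k →
      KPath.RunsInTime (KPath.runKPath G k) (C * ((n : ℝ) + 1) ^ c * (1.657 : ℝ) ^ k)) ∧
    (∀ (n : ℕ) (G : SimpleGraph (Fin n)) (k : ℕ), 1 ≤ k →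
      KPath.HasSimplePath G k → 1 / 2 ≤ KPath.answerProb (KPath.runKPath G k) true) ∧
    (∀ (n : ℕ) (G : SimpleGraph (Fin n)) (k : ℕ), 1 ≤ k →
      ¬ KPath.HasSimplePath G k → KPath.answerProb (KPath.runKPath G k) false = 1)) :=
  have ⟨C, c, hkPath⟩ := KPath.exists_runsInTime_kPath
  ⟨KPath.exists_runsInTime_hamiltonian,
    fun _ _ _ _ _ => KPath.half_le_answerProb, fun _ _ _ _ _ => KPath.answerProb_eq_one,
    ⟨C, c, fun n G k _ => hkPath n G k⟩, fun _ _ _ => KPath.half_le_answerProb_kPath,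
    fun _ _ _ => KPath.answerProb_kPath_eq_one⟩
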